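/- Let $k=\mathbb F_q$ be a finite field and let $A$ be a finite-dimensional $1$-Gorenstein $k$-algebra, i.e. $A$ has injective dimension at most $1$ both as a left and as a right module over itself. Let $\operatorname{mod}A$ be the category of finite-dimensional $A$-modules. For a full subcategory $\mathcal E\subseteq \operatorname{mod}A$ that contains $0$ and is closed under extensions and isomorphisms, let $\mathcal H(\mathcal E)$ be its Ringel–Hall algebra: the $\mathbb Q$-vector space with basis the isoclasses $[M]$ of objects of $\mathcal E$ and with product $$[M]\diamond[N]=\sum_{[L]}\frac{|\operatorname{Ext}^1(M,N)_L|}{|\operatorname{Hom}(M,N)|}\,[L],$$ where $\operatorname{Ext}^1(M,N)_L$ is the set of classes of extensions $0\to N\to L'\to M\to 0$ with $L'\cong L$. Let $\mathcal P^{\le 1}(A)$ be the category of modules of projective dimension at most $1$ and let $\langle U,V\rangle=\dim_k\operatorname{Hom}(U,V)-\dim_k\operatorname{Ext}^1(U,V)$ be the Euler form on it, which is defined on its Grothendieck group $K_0(\mathcal P^{\le 1}(A))$. Let $I$ be the two-sided ideal of $\mathcal H(A)=\mathcal H(\operatorname{mod}A)$ generated by all $[L]-[K\oplus M]$ for which there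 is a short exact sequence $0\to K\to L\to M\to 0$ with $K\in\mathcal P^{\le1}(A)$, and let $S_A=\{a[K] : a\in\mathbb Q\setminus\{0\},\ K\in\mathcal P^{\le 1}(A)\}\subseteq\mathcal H(A)/I$. The right Ore localization $\mathcal{MH}(A)=(\mathcal H(A)/I)[S_A^{-1}]$ exists; it is called the modified Ringel–Hall algebra. Let the quantum torus $\mathbb T(A)\subseteq\mathcal{MH}(A)$ be the $\mathbb Q$-subalgebra generated by the elements $[K]$ and $[K]^{-1}$, $K\in\mathcal P^{\le 1}(A)$. For $\alpha=\widehat U-\widehat V\in K_0(\mathcal P^{\le1}(A))$ with $U,V\in\mathcal P^{\le1}(A)$, the element $$[K_\alpha]=q^{-\langle\alpha,\widehat V\rangle}\,[U]\diamond[V]^{-1}\in\mathbb T(A)$$ depends only on $\alpha$. As an abelian group, $K_0(\mathcal P^{\le1}(A))$ is isomorphic to $K_0(\operatorname{mod}A)$. Let $\operatorname{Gproj}A$ be the category of finitely generated Gorenstein projective modules, that is, kernels $\operatorname{Ker}(P^0\to P^1)$ for acyclic complexes $P^\bullet$ of finitely generated projective modules such that $\operatorname{Hom}_A(P^\bullet,A)$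 is also acyclic. It contains $0$ and is closed under extensions. Gorsky's semi-derived Hall algebra $\mathcal{SDH}(\operatorname{Gproj}A)$ is the localization of $\mathcal H(\operatorname{Gproj}A)$ at the classes of all projective-injective objects of the exact category $\operatorname{Gproj}A$. Let $D_{sg}(\operatorname{mod}A)=D^b(\operatorname{mod}A)/K^b(\operatorname{proj}A)$ be the singularity category. Then the following hold. 1. There is an isomorphism of $\mathbb Q$-algebras $\mathcal{MH}(A)\cong\mathcal{SDH}(\operatorname{Gproj}A)$. 2. Every object of $D_{sg}(\operatorname{mod}A)$ is isomorphic to the image of a module (a stalk complex in degree $0$). For every choice of one module $M$ representing each isoclass of $D_{sg}(\operatorname{mod}A)$, the elements $[M]$ form a basis of $\mathcal{MH}(A)$ as a free right $\mathbb T(A)$-module and also as a free left $\mathbb T(A)$-module; and the elements $[M]\diamond[K_\alpha]$, where $M$ runs over the chosen modules and $\alpha$ over $K_0(\mathcal P^{\le 1}(A))\cong K_0(\operatorname{mod}A)$, form a basis of $\mathcal{MH}(A)$ over $\mathbb Q$. -/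

import Mathlib

open CategoryTheory CategoryTheory.Abelian CategoryTheory.Limits

universe u
namespace RingelHall
set_option linter.unusedSectionVars false
variable {A : Type u} [Ring A] [Finite A]

/-! Throughout, `A` is a finite ring (later a finite-dimensional algebra over a finite field) and
`FGModuleCat A` is the abelian category of finitely generated left `A`-modules. -/

/-! ### Extensions and Hall numbers -/

instance hasExtFG : HasExt.{u + 1} (FGModuleCat.{u} A) := HasExt.standard _

/-- `Ext¹(M, N)_L`: the classes of extensions `0 → N → L → M → 0` with middle term `L`. -/
def extWithMiddle (M N L : FGModuleCat.{u} A) : Set (Ext M N 1) :=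
  {e | ∃ (i : N ⟶ L) (p : L ⟶ M) (w : i ≫ p = 0)
    (h : (ShortComplex.mk i p w).ShortExact), h.extClass = e}

instance finite_carrier (M : FGModuleCat.{u} A) : Finite M :=
  Module.finite_of_finite A

theorem shortExact_iff (S : ShortComplex (FGModuleCat.{u} A)) :
    S.ShortExact ↔ Function.Injective S.f.hom.hom ∧ Function.Surjective S.g.hom.hom ∧
      Function.Exact S.f.hom.hom S.g.hom.hom := by
  constructor
  · intro h
    have h' := h.map_of_exact (forget₂ (FGModuleCat.{u} A) (ModuleCat.{u} A))
    exact ⟨h'.moduleCat_injective_f, h'.moduleCat_surjective_g,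
      (ShortComplex.ShortExact.moduleCat_exact_iff_function_exact _).1 h'.exact⟩
  · rintro ⟨h1, h2, h3⟩
    have e : (S.map (forget₂ (FGModuleCat.{u} A) (ModuleCat.{u} A))).Exact :=
      (ShortComplex.ShortExact.moduleCat_exact_iff_function_exact _).2 h3
    have e' := (S.exact_map_iff_of_faithful (forget₂ (FGModuleCat.{u} A) (ModuleCat.{u} A))).1 e
    have : Mono S.f := (forget₂ (FGModuleCat.{u} A) (ModuleCat.{u} A)).mono_of_mono_map
      ((ModuleCat.mono_iff_injective _).2 h1)
    have : Epi S.g := (forget₂ (FGModuleCat.{u} A) (ModuleCat.{u} A)).epi_of_epi_map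
      ((ModuleCat.epi_iff_surjective _).2 h2)
    exact ⟨e'⟩

theorem extClass_eq_iff {M N L : FGModuleCat.{u} A} {i i' : N ⟶ L} {p p' : L ⟶ M}
    {w : i ≫ p = 0} {w' : i' ≫ p' = 0} (h : (ShortComplex.mk i p w).ShortExact)
    (h' : (ShortComplex.mk i' p' w').ShortExact) :
    h.extClass = h'.extClass ↔ ∃ φ : L ≅ L, i ≫ φ.hom = i' ∧ φ.hom ≫ p' = p := by
  constructor
  · intro he
    have z : h.extClass.comp (Ext.mk₀ i') (add_zero 1) = 0 := by
      rw [he]; exact h'.extClass_comp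
    obtain ⟨x, hx⟩ := Ext.contravariant_sequence_exact₁ h L (Ext.mk₀ i') (add_zero 1) z
    obtain ⟨ψ, rfl⟩ := (Ext.mk₀_bijective _ _).2 x
    have hψ : i ≫ ψ = i' := by
      apply (Ext.mk₀_bijective _ _).1
      simpa using hx
    have hk : i ≫ (ψ ≫ p' - p) = 0 := by
      simp [Preadditive.comp_sub, reassoc_of% hψ, w, w']
    have := h.epi_g
    let g : M ⟶ M := h.gIsCokernel.desc (CokernelCofork.ofπ _ hk)
    have hg : p ≫ g = ψ ≫ p' - p := h.gIsCokernel.fac (CokernelCofork.ofπ _ hk) WalkingParallelPair.one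
    let F : ShortComplex.mk i p w ⟶ ShortComplex.mk i' p' w' :=
      { τ₁ := 𝟙 N, τ₂ := ψ, τ₃ := 𝟙 M + g, comm₁₂ := by simp [hψ],
        comm₂₃ := by simp [Preadditive.comp_add, hg] }
    have nat := ShortComplex.ShortExact.extClass_naturality h h' F
    have z2 : (Ext.mk₀ g).comp h'.extClass (zero_add 1) = 0 := by
      simpa [F, Ext.mk₀_add, Ext.add_comp, ← he] using nat
    obtain ⟨y, hy⟩ := Ext.covariant_sequence_exact₃ M h' (Ext.mk₀ g) (zero_add 1) z2
    obtain ⟨r, rfl⟩ := (Ext.mk₀_bijective _ _).2 y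
    have hr : r ≫ p' = g := by
      apply (Ext.mk₀_bijective _ _).1
      simpa using hy
    let G : ShortComplex.mk i p w ⟶ ShortComplex.mk i' p' w' :=
      { τ₁ := 𝟙 N, τ₂ := ψ - p ≫ r, τ₃ := 𝟙 M,
        comm₁₂ := by simp [Preadditive.comp_sub, hψ, reassoc_of% w],
        comm₂₃ := by simp [Preadditive.sub_comp, hr, hg] }
    have hiso : IsIso G.τ₂ := by
      have : IsIso G.τ₁ := inferInstanceAs (IsIso (𝟙 N))
      have : IsIso G.τ₃ := inferInstanceAs (IsIso (𝟙 M))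
      exact ShortComplex.isIso₂_of_shortExact_of_isIso₁₃ G h h'
    refine ⟨@asIso _ _ _ _ G.τ₂ hiso, ?_, ?_⟩
    · simpa [G] using G.comm₁₂.symm
    · simpa [G] using G.comm₂₃
  · rintro ⟨φ, h1, h2⟩
    let F : ShortComplex.mk i p w ⟶ ShortComplex.mk i' p' w' :=
      { τ₁ := 𝟙 N, τ₂ := φ.hom, τ₃ := 𝟙 M, comm₁₂ := by simp [h1], comm₂₃ := by simp [h2] }
    simpa [F] using ShortComplex.ShortExact.extClass_naturality h h' F

/-- Short exact sequences `0 → N → L → M → 0` with fixed terms. -/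
@[ext]
structure SES (M N L : FGModuleCat.{u} A) : Type u where
  i : N ⟶ L
  p : L ⟶ M
  w : i ≫ p = 0
  ex : (ShortComplex.mk i p w).ShortExact

instance finite_hom (M N : FGModuleCat.{u} A) : Finite (M ⟶ N) :=
  Finite.of_injective (fun f => (f.hom.hom : M → N)) fun _ _ h => by
    ext x; exact congrFun h x

instance finite_iso (M N : FGModuleCat.{u} A) : Finite (M ≅ N) :=
  Finite.of_injective (fun f => f.hom) fun _ _ h => Iso.ext h

instance finite_SES (M N L : FGModuleCat.{u} A) : Finite (SES M N L) :=
  Finite.of_injective (fun s => (s.i, s.p)) fun _ _ h =>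
    SES.ext (congrArg Prod.fst h) (congrArg Prod.snd h)

/-- The extension class of a short exact sequence. -/
noncomputable def SES.cls {M N L : FGModuleCat.{u} A} (s : SES M N L) : extWithMiddle M N L :=
  ⟨s.ex.extClass, _, _, _, _, rfl⟩

theorem SES.cls_surjective {M N L : FGModuleCat.{u} A} :
    Function.Surjective (SES.cls (M := M) (N := N) (L := L)) := by
  rintro ⟨e, i, p, w, h, rfl⟩
  exact ⟨⟨i, p, w, h⟩, rfl⟩

instance finite_extWithMiddle (M N L : FGModuleCat.{u} A) : Finite (extWithMiddle M N L) :=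
  Finite.of_surjective _ SES.cls_surjective

theorem card_fiber {M N L : FGModuleCat.{u} A} (s : SES M N L) :
    Nat.card {t : SES M N L // t.cls = s.cls} * Nat.card (M ⟶ N) = Nat.card (L ≅ L) := by
  rw [← Nat.card_prod]
  obtain ⟨i, p, w, h⟩ := s
  have key : ∀ t : {t : SES M N L // t.cls = SES.cls ⟨i, p, w, h⟩},
      ∃ φ : L ≅ L, i ≫ φ.hom = t.1.i ∧ φ.hom ≫ t.1.p = p := fun t =>
    (extClass_eq_iff h t.1.ex).1 (congrArg Subtype.val t.2).symm
  choose φ hφ1 hφ2 using key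
  let sh : (M ⟶ N) → (L ≅ L) := fun f =>
    { hom := 𝟙 L + p ≫ f ≫ i, inv := 𝟙 L - p ≫ f ≫ i,
      hom_inv_id := by simp [Preadditive.comp_sub, Preadditive.add_comp, reassoc_of% w]
      inv_hom_id := by simp [Preadditive.comp_add, Preadditive.sub_comp, reassoc_of% w] }
  have := h.mono_f
  have := h.epi_g
  dsimp only at *
  refine Nat.card_congr (Equiv.ofBijective (fun x => sh x.2 ≪≫ φ x.1) ⟨?_, ?_⟩)
  · rintro ⟨t, f⟩ ⟨t', f'⟩ heq
    have e : (𝟙 L + p ≫ f ≫ i) ≫ (φ t).hom = (𝟙 L + p ≫ f' ≫ i) ≫ (φ t').hom :=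
      congrArg Iso.hom heq
    have e1 : t = t' := by
      apply Subtype.ext; apply SES.ext
      · rw [← hφ1 t, ← hφ1 t']
        have := congrArg (fun z => i ≫ z) e
        simpa [Preadditive.comp_add, Preadditive.add_comp, reassoc_of% w] using this
      · have e2 : (sh f ≪≫ φ t).inv ≫ p = (sh f' ≪≫ φ t').inv ≫ p := by
          rw [show sh f ≪≫ φ t = sh f' ≪≫ φ t' from heq]
        rw [← cancel_epi (φ t).hom, hφ2 t]
        have : t'.1.p = (φ t').inv ≫ p := by
          rw [Iso.eq_inv_comp]; exact hφ2 t'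
        rw [this]
        have : (φ t').inv ≫ p = (φ t).inv ≫ p := by
          simpa [sh, Preadditive.sub_comp, w] using e2.symm
        rw [this]; simp
    subst e1
    have e3 := (cancel_mono _).1 e
    have e4 := add_left_cancel e3
    rw [cancel_epi, cancel_mono] at e4
    rw [e4]
  · intro χ
    have hse : (ShortComplex.mk (i ≫ χ.hom) (χ.inv ≫ p) (by simp [w])).ShortExact :=
      ShortComplex.shortExact_of_iso (S₁ := ShortComplex.mk i p w)
        (ShortComplex.isoMk (Iso.refl _) χ (Iso.refl _) (by simp) (by simp)) h
    let t : {t : SES M N L // t.cls = SES.cls ⟨i, p, w, h⟩} :=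
      ⟨⟨i ≫ χ.hom, χ.inv ≫ p, _, hse⟩, Subtype.ext
        ((extClass_eq_iff h hse).2 ⟨χ, rfl, by simp⟩).symm⟩
    -- `χ ≫ φ t⁻¹` fixes `i` and `p`
    have k1 : i ≫ χ.hom = i ≫ (φ t).hom := (hφ1 t).symm
    have k2 : (φ t).hom ≫ χ.inv ≫ p = p := hφ2 t
    have k3 : χ.hom ≫ (φ t).inv ≫ p = p := by
      have : (φ t).inv ≫ p = χ.inv ≫ p := by rw [Iso.inv_comp_eq]; exact k2.symm
      rw [this]; simp
    have m1 : i ≫ (χ.hom ≫ (φ t).inv - 𝟙 L) = 0 := by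
      simp [Preadditive.comp_sub, reassoc_of% k1]
    let d : M ⟶ L := h.gIsCokernel.desc (CokernelCofork.ofπ _ m1)
    have hd : p ≫ d = χ.hom ≫ (φ t).inv - 𝟙 L :=
      h.gIsCokernel.fac (CokernelCofork.ofπ _ m1) WalkingParallelPair.one
    have m2 : d ≫ p = 0 := by
      rw [← cancel_epi p, reassoc_of% hd]
      simp [Preadditive.sub_comp, k3]
    let f : M ⟶ N := h.fIsKernel.lift (KernelFork.ofι _ m2)
    have hf : f ≫ i = d := h.fIsKernel.fac (KernelFork.ofι _ m2) WalkingParallelPair.zero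
    refine ⟨(t, f), Iso.ext ?_⟩
    change (𝟙 L + p ≫ f ≫ i) ≫ (φ t).hom = χ.hom
    rw [hf, hd]; simp

theorem card_ext_mul (M N L : FGModuleCat.{u} A) :
    Nat.card (extWithMiddle M N L) * Nat.card (L ≅ L) =
      Nat.card (SES M N L) * Nat.card (M ⟶ N) := by
  have := Fintype.ofFinite (extWithMiddle M N L)
  have e := Nat.card_congr (Equiv.sigmaFiberEquiv (SES.cls (M := M) (N := N) (L := L)))
  rw [← e, Nat.card_sigma, Finset.sum_mul]
  have : ∀ x : extWithMiddle M N L, Nat.card {t : SES M N L // t.cls = x} * Nat.card (M ⟶ N)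
      = Nat.card (L ≅ L) := by
    intro x
    obtain ⟨s, rfl⟩ := SES.cls_surjective x
    exact card_fiber s
  simp [this]


/-- The Hall number `|Ext¹(M, N)_L| / |Hom(M, N)|`. -/
noncomputable def hallCoeff (M N L : FGModuleCat.{u} A) : ℚ :=
  (Nat.card (extWithMiddle M N L) : ℚ) / (Nat.card (M ⟶ N) : ℚ)

theorem card_hom_pos (M N : FGModuleCat.{u} A) : 0 < Nat.card (M ⟶ N) := Nat.card_pos

instance nonempty_aut (M : FGModuleCat.{u} A) : Nonempty (M ≅ M) := ⟨Iso.refl M⟩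

theorem card_aut_ne (M : FGModuleCat.{u} A) : (Nat.card (M ≅ M) : ℚ) ≠ 0 := by
  exact_mod_cast (Nat.card_pos (α := (M ≅ M))).ne'

theorem hallCoeff_eq (M N L : FGModuleCat.{u} A) :
    hallCoeff M N L = (Nat.card (SES M N L) : ℚ) / (Nat.card (L ≅ L) : ℚ) := by
  rw [hallCoeff, div_eq_div_iff (by exact_mod_cast (card_hom_pos M N).ne') (card_aut_ne L)]
  exact_mod_cast card_ext_mul M N L

theorem card_SES_congr {M N L M' N' L' : FGModuleCat.{u} A} (a : M ≅ M') (b : N ≅ N')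
    (c : L ≅ L') : Nat.card (SES M N L) = Nat.card (SES M' N' L') := by
  refine Nat.card_congr
    { toFun := fun s => ⟨b.inv ≫ s.i ≫ c.hom, c.inv ≫ s.p ≫ a.hom, by simp [reassoc_of% s.w],
        ShortComplex.shortExact_of_iso
          (ShortComplex.isoMk (S₁ := ShortComplex.mk s.i s.p s.w) b c a
            (by simp) (by simp)) s.ex⟩
      invFun := fun s => ⟨b.hom ≫ s.i ≫ c.inv, c.hom ≫ s.p ≫ a.inv, by simp [reassoc_of% s.w],
        ShortComplex.shortExact_of_iso
          (ShortComplex.isoMk (S₁ := ShortComplex.mk s.i s.p s.w) b.symm c.symm a.symm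
            (by simp) (by simp)) s.ex⟩
      left_inv := fun s => by ext1 <;> simp
      right_inv := fun s => by ext1 <;> simp }

theorem card_iso_congr {L L' : FGModuleCat.{u} A} (c : L ≅ L') (K : FGModuleCat.{u} A) :
    Nat.card (K ≅ L) = Nat.card (K ≅ L') :=
  Nat.card_congr
    { toFun := fun e => e ≪≫ c, invFun := fun e => e ≪≫ c.symm,
      left_inv := fun e => by ext1; simp, right_inv := fun e => by ext1; simp }

/-- Isomorphism classes of the objects of a full subcategory. -/
def IsoCl (E : ObjectProperty (FGModuleCat.{u} A)) : Type (u + 1) :=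
  Quotient (isIsomorphicSetoid E.FullSubcategory)

section
variable {E : ObjectProperty (FGModuleCat.{u} A)}

/-- The isomorphism class of an object of the full subcategory `E`. -/
def IsoCl.mk (M : FGModuleCat.{u} A) (hM : E M) : IsoCl E :=
  Quotient.mk (isIsomorphicSetoid E.FullSubcategory) ⟨M, hM⟩

/-- A representative of an isomorphism class. -/
noncomputable def IsoCl.rep (x : IsoCl E) : FGModuleCat.{u} A :=
  (Quotient.out (s := isIsomorphicSetoid E.FullSubcategory) x).obj

theorem IsoCl.rep_mem (x : IsoCl E) : E x.rep :=
  (Quotient.out (s := isIsomorphicSetoid E.FullSubcategory) x).property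

theorem IsoCl.mk_rep (x : IsoCl E) : IsoCl.mk x.rep x.rep_mem = x :=
  Quotient.out_eq (s := isIsomorphicSetoid E.FullSubcategory) x

theorem IsoCl.mk_eq_iff {M N : FGModuleCat.{u} A} {hM : E M} {hN : E N} :
    IsoCl.mk M hM = IsoCl.mk N hN ↔ Nonempty (M ≅ N) := by
  refine (Quotient.eq (r := isIsomorphicSetoid E.FullSubcategory)).trans ⟨?_, ?_⟩
  · rintro ⟨e⟩; exact ⟨E.ι.mapIso e⟩
  · rintro ⟨e⟩; exact ⟨E.fullyFaithfulι.preimageIso e⟩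

theorem IsoCl.rep_mk (M : FGModuleCat.{u} A) (hM : E M) :
    Nonempty ((IsoCl.mk M hM).rep ≅ M) :=
  IsoCl.mk_eq_iff.1 (IsoCl.mk_rep _)

theorem IsoCl.eq_of_iso {x y : IsoCl E} (e : x.rep ≅ y.rep) : x = y := by
  rw [← x.mk_rep, ← y.mk_rep, IsoCl.mk_eq_iff]; exact ⟨e⟩

theorem card_middle {M N L : FGModuleCat.{u} A} (s : SES M N L) :
    Nat.card L = Nat.card N * Nat.card M := by
  obtain ⟨h1, h2, h3⟩ := (shortExact_iff _).1 s.ex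
  have e1 : Nat.card L = Nat.card (LinearMap.ker s.p.hom.hom) * Nat.card M := by
    rw [← Nat.card_congr (LinearMap.quotKerEquivOfSurjective _ h2).toEquiv]
    exact Submodule.card_eq_card_quotient_mul_card (LinearMap.ker s.p.hom.hom)
  have e2 : LinearMap.ker s.p.hom.hom = LinearMap.range s.i.hom.hom :=
    h3.linearMap_ker_eq
  rw [e1, e2, ← Nat.card_congr (LinearEquiv.ofInjective _ h1).toEquiv]

theorem finite_isoCl_card (n : ℕ) : {x : IsoCl E | Nat.card x.rep = n}.Finite := by
  classical
  refine Set.Finite.of_finite_image (f := fun x : IsoCl E => (IsoCl.mk x.rep trivial :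
    IsoCl (⊤ : ObjectProperty (FGModuleCat.{u} A)))) ?_ ?_
  · refine (Set.finite_range (fun S : Submodule A (Fin n → A) =>
      (IsoCl.mk (FGModuleCat.of A ((Fin n → A) ⧸ S)) trivial :
        IsoCl (⊤ : ObjectProperty (FGModuleCat.{u} A))))).subset ?_
    rintro _ ⟨x, hx, rfl⟩
    have e : Fin n ≃ x.rep := (finCongr hx).symm.trans (Finite.equivFin _).symm
    let φ : (Fin n → A) →ₗ[A] x.rep := Fintype.linearCombination A (fun i => e i)
    have hφ : Function.Surjective φ := fun y => by
      refine ⟨Pi.single (e.symm y) 1, ?_⟩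
      simp [φ, Fintype.linearCombination_apply_single]
    refine ⟨LinearMap.ker φ, IsoCl.mk_eq_iff.2 ⟨?_⟩⟩
    exact (φ.quotKerEquivOfSurjective hφ).toFGModuleCatIso
  · intro x _ y _ h
    obtain ⟨e⟩ := IsoCl.mk_eq_iff.1 h
    exact IsoCl.eq_of_iso e

theorem finite_support_hallCoeff (M N : FGModuleCat.{u} A) :
    (Function.support fun z : IsoCl E => hallCoeff M N z.rep).Finite := by
  refine (finite_isoCl_card (Nat.card N * Nat.card M)).subset fun z hz => ?_
  rw [Function.mem_support, hallCoeff_eq] at hz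
  have h0 : Nat.card (SES M N z.rep) ≠ 0 := fun h => hz (by simp [h])
  obtain ⟨⟨s⟩, -⟩ := Nat.card_ne_zero.1 h0
  exact card_middle s

/-- `[M] ◇ [N] = ∑_[L] (|Ext¹(M,N)_L| / |Hom(M,N)|) [L]`. -/
noncomputable def hallProd (x y : IsoCl E) : IsoCl E →₀ ℚ :=
  Finsupp.ofSupportFinite (fun z => hallCoeff x.rep y.rep z.rep)
    (finite_support_hallCoeff x.rep y.rep)

theorem hallProd_apply (x y z : IsoCl E) :
    hallProd x y z = (Nat.card (SES x.rep y.rep z.rep) : ℚ) / (Nat.card (z.rep ≅ z.rep) : ℚ) :=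
  hallCoeff_eq _ _ _

theorem sum_iso_div (F : Finset (IsoCl E)) (K : FGModuleCat.{u} A) (hK : E K)
    (hF : IsoCl.mk K hK ∈ F) :
    ∑ z ∈ F, (Nat.card (z.rep ≅ K) : ℚ) / (Nat.card (z.rep ≅ z.rep) : ℚ) = 1 := by
  obtain ⟨e⟩ := IsoCl.rep_mk K hK
  rw [Finset.sum_eq_single_of_mem _ hF]
  · rw [card_iso_congr e.symm, div_self (card_aut_ne _)]
  · intro z _ hz
    have : IsEmpty (z.rep ≅ K) := ⟨fun f => hz (IsoCl.eq_of_iso (f ≪≫ e.symm))⟩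
    simp

end

theorem ses_left {M N P L L' X : FGModuleCat.{u} A} {i : N ⟶ L} {p : L ⟶ M} {j : P ⟶ X}
    {π : X ⟶ L} {k : L' ⟶ X} {j' : P ⟶ L'} {s : L' ⟶ N} {w1 : i ≫ p = 0} {w2 : j ≫ π = 0}
    {w3 : k ≫ π ≫ p = 0} (h1 : (ShortComplex.mk i p w1).ShortExact)
    (h2 : (ShortComplex.mk j π w2).ShortExact) (h3 : (ShortComplex.mk k (π ≫ p) w3).ShortExact)
    (hj : j' ≫ k = j) (hs : s ≫ i = k ≫ π) :
    ∃ w : j' ≫ s = 0, (ShortComplex.mk j' s w).ShortExact := by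
  have := h1.mono_f
  dsimp only at this
  have w : j' ≫ s = 0 := by
    rw [← cancel_mono i, Category.assoc, hs, reassoc_of% hj, w2, zero_comp]
  refine ⟨w, ?_⟩
  rw [shortExact_iff] at h1 h2 h3 ⊢
  obtain ⟨a1, a2, a3⟩ := h1
  obtain ⟨b1, b2, b3⟩ := h2
  obtain ⟨c1, c2, c3⟩ := h3
  dsimp only at *
  have hj' : ∀ x, k.hom.hom (j'.hom.hom x) = j.hom.hom x := fun x => by rw [← hj]; rfl
  have hs' : ∀ x, i.hom.hom (s.hom.hom x) = π.hom.hom (k.hom.hom x) := fun x =>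
    congrArg (fun f => f.hom.hom x) hs
  have c3' : ∀ x, p.hom.hom (π.hom.hom x) = 0 ↔ ∃ y, k.hom.hom y = x := fun x => c3 x
  refine ⟨fun x y hxy => b1 ?_, fun n => ?_, fun l => ⟨fun hl => ?_, ?_⟩⟩
  · rw [← hj', ← hj', hxy]
  · obtain ⟨x, hx⟩ := b2 (i.hom.hom n)
    obtain ⟨l, rfl⟩ := (c3' x).1 (by rw [hx]; exact (a3 _).2 ⟨n, rfl⟩)
    exact ⟨l, a1 (by rw [hs', hx])⟩
  · obtain ⟨x, hx⟩ := (b3 (k.hom.hom l)).1 (by rw [← hs', hl, map_zero])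
    exact ⟨x, c1 (by rw [hj', hx])⟩
  · rintro ⟨x, rfl⟩
    exact congrArg (fun f => f.hom.hom x) w

theorem ses_right {M N P L L' X : FGModuleCat.{u} A} {i : N ⟶ L} {p : L ⟶ M} {r : X ⟶ M}
    {π : X ⟶ L} {k : L' ⟶ X} {j' : P ⟶ L'} {s : L' ⟶ N} {w1 : k ≫ r = 0} {w2 : j' ≫ s = 0}
    {w3 : (j' ≫ k) ≫ π = 0} (h1 : (ShortComplex.mk k r w1).ShortExact)
    (h2 : (ShortComplex.mk j' s w2).ShortExact)
    (h3 : (ShortComplex.mk (j' ≫ k) π w3).ShortExact)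
    (hp : π ≫ p = r) (hs : s ≫ i = k ≫ π) :
    ∃ w : i ≫ p = 0, (ShortComplex.mk i p w).ShortExact := by
  have := h2.epi_g
  dsimp only at this
  have w : i ≫ p = 0 := by
    rw [← cancel_epi s, reassoc_of% hs, hp, w1, comp_zero]
  refine ⟨w, ?_⟩
  rw [shortExact_iff] at h1 h2 h3 ⊢
  obtain ⟨a1, a2, a3⟩ := h1
  obtain ⟨b1, b2, b3⟩ := h2
  obtain ⟨c1, c2, c3⟩ := h3
  dsimp only at *
  have hp' : ∀ x, p.hom.hom (π.hom.hom x) = r.hom.hom x := fun x => by rw [← hp]; rfl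
  have hs' : ∀ x, i.hom.hom (s.hom.hom x) = π.hom.hom (k.hom.hom x) := fun x =>
    congrArg (fun f => f.hom.hom x) hs
  have c3' : ∀ x, π.hom.hom x = 0 ↔ ∃ y, k.hom.hom (j'.hom.hom y) = x := fun x => c3 x
  refine ⟨?_, fun m => ?_, fun y => ⟨fun hy => ?_, ?_⟩⟩
  · rw [injective_iff_map_eq_zero]
    intro n hn
    obtain ⟨l, rfl⟩ := b2 n
    rw [hs'] at hn
    obtain ⟨y, hy⟩ := (c3' _).1 hn
    rw [← a1 hy]
    exact congrArg (fun f => f.hom.hom y) w2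
  · obtain ⟨x, rfl⟩ := a2 m
    exact ⟨π.hom.hom x, hp' x⟩
  · obtain ⟨x, rfl⟩ := c2 y
    rw [hp'] at hy
    obtain ⟨l, rfl⟩ := (a3 x).1 hy
    exact ⟨s.hom.hom l, hs' l⟩
  · rintro ⟨x, rfl⟩
    exact congrArg (fun f => f.hom.hom x) w

/-- The monomorphisms `k` completing an epimorphism `r` to a short exact sequence. -/
def KerTo (L' : FGModuleCat.{u} A) {X M : FGModuleCat.{u} A} (r : X ⟶ M) : Type u :=
  {k : L' ⟶ X // ∃ w : k ≫ r = 0, (ShortComplex.mk k r w).ShortExact}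

/-- The epimorphisms `π` completing a monomorphism `j` to a short exact sequence. -/
def CokerOf (L : FGModuleCat.{u} A) {P X : FGModuleCat.{u} A} (j : P ⟶ X) : Type u :=
  {π : X ⟶ L // ∃ w : j ≫ π = 0, (ShortComplex.mk j π w).ShortExact}

theorem card_kerTo {L' X M K : FGModuleCat.{u} A} {r : X ⟶ M} {k₀ : K ⟶ X} {w₀ : k₀ ≫ r = 0}
    (h₀ : (ShortComplex.mk k₀ r w₀).ShortExact) :
    Nat.card (KerTo L' r) = Nat.card (L' ≅ K) := by
  have := h₀.mono_f
  dsimp only at this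
  symm
  refine Nat.card_congr (Equiv.ofBijective (fun e => ⟨e.hom ≫ k₀, by simp [w₀],
    ShortComplex.shortExact_of_iso (S₁ := ShortComplex.mk k₀ r w₀)
      (ShortComplex.isoMk e.symm (Iso.refl _) (Iso.refl _) (by simp) (by simp)) h₀⟩) ⟨?_, ?_⟩)
  · intro e e' h
    have := congrArg Subtype.val h
    exact Iso.ext ((cancel_mono _).1 this)
  · rintro ⟨k, w, h⟩
    refine ⟨h.fIsKernel.conePointUniqueUpToIso h₀.fIsKernel, Subtype.ext ?_⟩
    exact h.fIsKernel.conePointUniqueUpToIso_hom_comp h₀.fIsKernel WalkingParallelPair.zero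

theorem card_cokerOf {L X P K : FGModuleCat.{u} A} {j : P ⟶ X} {π₀ : X ⟶ K} {w₀ : j ≫ π₀ = 0}
    (h₀ : (ShortComplex.mk j π₀ w₀).ShortExact) :
    Nat.card (CokerOf L j) = Nat.card (L ≅ K) := by
  have := h₀.epi_g
  dsimp only at this
  symm
  refine Nat.card_congr (Equiv.ofBijective (fun e => ⟨π₀ ≫ e.inv, by simp [reassoc_of% w₀],
    ShortComplex.shortExact_of_iso (S₁ := ShortComplex.mk j π₀ w₀)
      (ShortComplex.isoMk (Iso.refl _) (Iso.refl _) e.symm (by simp) (by simp)) h₀⟩) ⟨?_, ?_⟩)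
  · intro e e' h
    have := congrArg Subtype.val h
    have h2 : e.inv = e'.inv := (cancel_epi _).1 this
    exact Iso.ext_inv h2
  · rintro ⟨k, w, h⟩
    refine ⟨h.gIsCokernel.coconePointUniqueUpToIso h₀.gIsCokernel, Subtype.ext ?_⟩
    exact h.gIsCokernel.comp_coconePointUniqueUpToIso_inv h₀.gIsCokernel WalkingParallelPair.one

/-- Two-step filtrations of `X`, seen from both sides. -/
@[ext]
structure Filt (M N P L L' X : FGModuleCat.{u} A) : Type u where
  a : SES M N L
  b : SES L P X
  c : SES M L' X
  d : SES N P L'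
  hr : b.p ≫ a.p = c.p
  hj : d.i ≫ c.i = b.i
  hs : d.p ≫ a.i = c.i ≫ b.p

theorem card_filt_left (M N P L L' X : FGModuleCat.{u} A) :
    Nat.card (Filt M N P L L' X) =
      Nat.card (Σ σ : SES M N L × SES L P X, KerTo L' (σ.2.p ≫ σ.1.p)) := by
  refine Nat.card_congr (Equiv.ofBijective (fun F => ⟨(F.a, F.b), ⟨F.c.i, by
    rw [F.hr]; exact ⟨F.c.w, F.c.ex⟩⟩⟩) ⟨?_, ?_⟩)
  · intro F G h
    have ha : F.a = G.a := congrArg (fun x => x.1.1) h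
    have hb : F.b = G.b := congrArg (fun x => x.1.2) h
    have hk : F.c.i = G.c.i := congrArg (fun x => x.2.1) h
    have hc : F.c = G.c := SES.ext hk (by rw [← F.hr, ← G.hr, ha, hb])
    have := F.c.ex.mono_f
    have := F.a.ex.mono_f
    dsimp only at *
    have hd : F.d = G.d := SES.ext
      (by rw [← cancel_mono F.c.i, F.hj, hb, hk, G.hj])
      (by rw [← cancel_mono F.a.i, F.hs, ha, G.hs, hk, hb])
    exact Filt.ext ha hb hc hd
  · rintro ⟨⟨⟨i, p, w1, h1⟩, ⟨j, π, w2, h2⟩⟩, ⟨k, w3, h3⟩⟩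
    have := h1.mono_f
    have := h3.mono_f
    dsimp only at *
    have e1 := h3.exact.lift_f j (by simp [reassoc_of% w2])
    have e2 := h1.exact.lift_f (k ≫ π) (by simpa using w3)
    obtain ⟨w, hw⟩ := ses_left h1 h2 h3 e1 e2
    exact ⟨⟨⟨i, p, w1, h1⟩, ⟨j, π, w2, h2⟩, ⟨k, π ≫ p, w3, h3⟩, ⟨_, _, w, hw⟩, rfl, e1, e2⟩, rfl⟩

theorem card_filt_right (M N P L L' X : FGModuleCat.{u} A) :
    Nat.card (Filt M N P L L' X) =
      Nat.card (Σ τ : SES M L' X × SES N P L', CokerOf L (τ.2.i ≫ τ.1.i)) := by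
  refine Nat.card_congr (Equiv.ofBijective (fun F => ⟨(F.c, F.d), ⟨F.b.p, by
    rw [F.hj]; exact ⟨F.b.w, F.b.ex⟩⟩⟩) ⟨?_, ?_⟩)
  · intro F G h
    have hc : F.c = G.c := congrArg (fun x => x.1.1) h
    have hd : F.d = G.d := congrArg (fun x => x.1.2) h
    have hk : F.b.p = G.b.p := congrArg (fun x => x.2.1) h
    have hb : F.b = G.b := SES.ext (by rw [← F.hj, ← G.hj, hc, hd]) hk
    have := F.b.ex.epi_g
    have := F.d.ex.epi_g
    dsimp only at *
    have ha : F.a = G.a := SES.ext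
      (by rw [← cancel_epi F.d.p, F.hs, hd, G.hs, hk, hc])
      (by rw [← cancel_epi F.b.p, F.hr, hk, G.hr, hc])
    exact Filt.ext ha hb hc hd
  · rintro ⟨⟨⟨k, r, w1, h1⟩, ⟨j', s, w2, h2⟩⟩, ⟨π, w3, h3⟩⟩
    have := h2.epi_g
    have := h3.epi_g
    dsimp only at *
    have e1 := h3.exact.g_desc r (by simp [w1])
    have e2 := h2.exact.g_desc (k ≫ π) (by simpa using w3)
    obtain ⟨w, hw⟩ := ses_right h1 h2 h3 e1 e2
    exact ⟨⟨⟨_, _, w, hw⟩, ⟨j' ≫ k, π, w3, h3⟩, ⟨k, r, w1, h1⟩, ⟨j', s, w2, h2⟩, e1, rfl, e2⟩, rfl⟩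

instance finite_kerTo (L' : FGModuleCat.{u} A) {X M : FGModuleCat.{u} A} (r : X ⟶ M) :
    Finite (KerTo L' r) := by unfold KerTo; infer_instance

instance finite_cokerOf (L : FGModuleCat.{u} A) {P X : FGModuleCat.{u} A} (j : P ⟶ X) :
    Finite (CokerOf L j) := by unfold CokerOf; infer_instance

section
variable {E : ObjectProperty (FGModuleCat.{u} A)} [E.IsClosedUnderExtensions]

theorem mk_mem_support (x y : IsoCl E) {K : FGModuleCat.{u} A} (s : SES x.rep y.rep K) :
    ∃ hK : E K, IsoCl.mk K hK ∈ (hallProd x y).support := by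
  have hK : E K := E.prop_X₂_of_shortExact s.ex y.rep_mem x.rep_mem
  refine ⟨hK, ?_⟩
  obtain ⟨e⟩ := IsoCl.rep_mk K hK
  rw [Finsupp.mem_support_iff, hallProd_apply, card_SES_congr (Iso.refl _) (Iso.refl _) e]
  have : Nonempty (SES x.rep y.rep K) := ⟨s⟩
  refine div_ne_zero ?_ (card_aut_ne _)
  exact_mod_cast (Nat.card_pos (α := SES x.rep y.rep K)).ne'

theorem sum_filt_left (x y z l w : IsoCl E) :
    ∑ l' ∈ (hallProd y z).support,
      (Nat.card (Filt x.rep y.rep z.rep l.rep l'.rep w.rep) : ℚ) /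
        (Nat.card (l'.rep ≅ l'.rep) : ℚ) =
      (Nat.card (SES x.rep y.rep l.rep) : ℚ) * (Nat.card (SES l.rep z.rep w.rep) : ℚ) := by
  have := Fintype.ofFinite (SES x.rep y.rep l.rep × SES l.rep z.rep w.rep)
  have h (l' : IsoCl E) : (Nat.card (Filt x.rep y.rep z.rep l.rep l'.rep w.rep) : ℚ) /
      (Nat.card (l'.rep ≅ l'.rep) : ℚ) =
      ∑ σ : SES x.rep y.rep l.rep × SES l.rep z.rep w.rep,
        (Nat.card (l'.rep ≅ kernel (σ.2.p ≫ σ.1.p)) : ℚ) / (Nat.card (l'.rep ≅ l'.rep) : ℚ) := by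
    rw [card_filt_left, Nat.card_sigma, Nat.cast_sum, Finset.sum_div]
    refine Finset.sum_congr rfl fun σ _ => ?_
    have := σ.2.ex.epi_g
    have := σ.1.ex.epi_g
    dsimp only at *
    rw [card_kerTo (k₀ := kernel.ι (σ.2.p ≫ σ.1.p)) (w₀ := kernel.condition _)
      ⟨ShortComplex.exact_kernel _⟩]
  simp_rw [h]
  rw [Finset.sum_comm]
  rw [← Nat.cast_mul, ← Nat.card_prod, Nat.card_eq_fintype_card, ← Finset.card_univ,
    Finset.cast_card]
  refine Finset.sum_congr rfl fun σ _ => ?_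
  obtain ⟨⟨i, p, w1, h1⟩, ⟨j, π, w2, h2⟩⟩ := σ
  have := h1.epi_g
  have := h2.epi_g
  have := h1.mono_f
  dsimp only at *
  have h3 : (ShortComplex.mk (kernel.ι (π ≫ p)) (π ≫ p) (kernel.condition _)).ShortExact :=
    ⟨ShortComplex.exact_kernel _⟩
  have := h3.mono_f
  dsimp only at *
  have e1 := h3.exact.lift_f j (by simp [reassoc_of% w2])
  have e2 := h1.exact.lift_f (kernel.ι (π ≫ p) ≫ π) (by simp)
  obtain ⟨w', hw⟩ := ses_left h1 h2 h3 e1 e2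
  obtain ⟨hK, hm⟩ := mk_mem_support y z ⟨_, _, w', hw⟩
  exact sum_iso_div _ _ hK hm

theorem sum_filt_right (x y z l' w : IsoCl E) :
    ∑ l ∈ (hallProd x y).support,
      (Nat.card (Filt x.rep y.rep z.rep l.rep l'.rep w.rep) : ℚ) /
        (Nat.card (l.rep ≅ l.rep) : ℚ) =
      (Nat.card (SES x.rep l'.rep w.rep) : ℚ) * (Nat.card (SES y.rep z.rep l'.rep) : ℚ) := by
  have := Fintype.ofFinite (SES x.rep l'.rep w.rep × SES y.rep z.rep l'.rep)
  have h (l : IsoCl E) : (Nat.card (Filt x.rep y.rep z.rep l.rep l'.rep w.rep) : ℚ) /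
      (Nat.card (l.rep ≅ l.rep) : ℚ) =
      ∑ τ : SES x.rep l'.rep w.rep × SES y.rep z.rep l'.rep,
        (Nat.card (l.rep ≅ cokernel (τ.2.i ≫ τ.1.i)) : ℚ) / (Nat.card (l.rep ≅ l.rep) : ℚ) := by
    rw [card_filt_right, Nat.card_sigma, Nat.cast_sum, Finset.sum_div]
    refine Finset.sum_congr rfl fun σ _ => ?_
    have := σ.2.ex.mono_f
    have := σ.1.ex.mono_f
    dsimp only at *
    rw [card_cokerOf (π₀ := cokernel.π (σ.2.i ≫ σ.1.i)) (w₀ := cokernel.condition _)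
      ⟨ShortComplex.exact_cokernel _⟩]
  simp_rw [h]
  rw [Finset.sum_comm]
  rw [← Nat.cast_mul, ← Nat.card_prod, Nat.card_eq_fintype_card, ← Finset.card_univ,
    Finset.cast_card]
  refine Finset.sum_congr rfl fun σ _ => ?_
  obtain ⟨⟨k, r, w1, h1⟩, ⟨j', s, w2, h2⟩⟩ := σ
  have := h1.mono_f
  have := h2.mono_f
  have := h2.epi_g
  dsimp only at *
  have h3 : (ShortComplex.mk (j' ≫ k) (cokernel.π (j' ≫ k)) (cokernel.condition _)).ShortExact :=
    ⟨ShortComplex.exact_cokernel _⟩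
  have := h3.epi_g
  dsimp only at *
  have e1 := h3.exact.g_desc r (by simp [w1])
  have e2 := h2.exact.g_desc (k ≫ cokernel.π (j' ≫ k)) (by
    rw [← Category.assoc, cokernel.condition])
  obtain ⟨w', hw⟩ := ses_right h1 h2 h3 e1 e2
  obtain ⟨hK, hm⟩ := mk_mem_support x y ⟨_, _, w', hw⟩
  exact sum_iso_div _ _ hK hm

theorem hallProd_assoc (x y z w : IsoCl E) :
    ∑ l ∈ (hallProd x y).support, hallProd x y l * hallProd l z w =
      ∑ l' ∈ (hallProd y z).support, hallProd y z l' * hallProd x l' w := by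
  have h1 (l : IsoCl E) : hallProd x y l * hallProd l z w =
      ∑ l' ∈ (hallProd y z).support,
        (Nat.card (Filt x.rep y.rep z.rep l.rep l'.rep w.rep) : ℚ) /
        (Nat.card (l'.rep ≅ l'.rep) : ℚ) / (Nat.card (l.rep ≅ l.rep) : ℚ) /
        (Nat.card (w.rep ≅ w.rep) : ℚ) := by
    rw [← Finset.sum_div, ← Finset.sum_div, sum_filt_left, hallProd_apply, hallProd_apply]
    ring
  have h2 (l' : IsoCl E) : hallProd y z l' * hallProd x l' w =
      ∑ l ∈ (hallProd x y).support,
        (Nat.card (Filt x.rep y.rep z.rep l.rep l'.rep w.rep) : ℚ) /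
        (Nat.card (l.rep ≅ l.rep) : ℚ) / (Nat.card (l'.rep ≅ l'.rep) : ℚ) /
        (Nat.card (w.rep ≅ w.rep) : ℚ) := by
    rw [← Finset.sum_div, ← Finset.sum_div, sum_filt_right, hallProd_apply, hallProd_apply]
    ring
  simp_rw [h1, h2]
  rw [Finset.sum_comm]
  refine Finset.sum_congr rfl fun _ _ => Finset.sum_congr rfl fun _ _ => ?_
  ring

end

section
variable {E : ObjectProperty (FGModuleCat.{u} A)} [E.ContainsZero]

/-- The isomorphism class of the zero module. -/
noncomputable def IsoCl.zero : IsoCl E :=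
  IsoCl.mk E.exists_prop_of_containsZero.choose
    E.exists_prop_of_containsZero.choose_spec.2

theorem IsoCl.zero_rep : IsZero (IsoCl.zero : IsoCl E).rep := by
  obtain ⟨e⟩ := IsoCl.rep_mk (E := E) E.exists_prop_of_containsZero.choose
    E.exists_prop_of_containsZero.choose_spec.2
  exact E.exists_prop_of_containsZero.choose_spec.1.of_iso e

theorem card_SES_zero_right (M N L : FGModuleCat.{u} A) (hN : IsZero N) :
    Nat.card (SES M N L) = Nat.card (L ≅ M) := by
  symm
  refine Nat.card_congr (Equiv.ofBijective (fun e => ⟨0, e.hom, by simp, ?_⟩) ⟨?_, ?_⟩)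
  · have : Mono (0 : N ⟶ L) := ⟨fun _ _ _ => hN.eq_of_tgt _ _⟩
    exact { exact := (ShortComplex.exact_iff_mono _ rfl).2 (inferInstanceAs (Mono e.hom)),
            mono_f := this, epi_g := inferInstanceAs (Epi e.hom) }
  · intro e e' h
    exact Iso.ext (congrArg SES.p h)
  · rintro ⟨i, p, w, h⟩
    obtain rfl : i = 0 := hN.eq_of_src _ _
    have : Mono p := (ShortComplex.exact_iff_mono _ rfl).1 h.exact
    have : Epi p := h.epi_g
    have : IsIso p := isIso_of_mono_of_epi p
    exact ⟨asIso p, rfl⟩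

theorem card_SES_zero_left (M N L : FGModuleCat.{u} A) (hM : IsZero M) :
    Nat.card (SES M N L) = Nat.card (L ≅ N) := by
  symm
  refine Nat.card_congr (Equiv.ofBijective (fun e => ⟨e.inv, 0, by simp, ?_⟩) ⟨?_, ?_⟩)
  · have : Epi (0 : L ⟶ M) := ⟨fun _ _ _ => hM.eq_of_src _ _⟩
    exact { exact := (ShortComplex.exact_iff_epi _ rfl).2 (inferInstanceAs (Epi e.inv)),
            mono_f := inferInstanceAs (Mono e.inv), epi_g := this }
  · intro e e' h
    exact Iso.ext_inv (congrArg SES.i h)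
  · rintro ⟨i, p, w, h⟩
    obtain rfl : p = 0 := hM.eq_of_tgt _ _
    have : Epi i := (ShortComplex.exact_iff_epi _ rfl).1 h.exact
    have : Mono i := h.mono_f
    have : IsIso i := isIso_of_mono_of_epi i
    exact ⟨(asIso i).symm, rfl⟩

theorem iso_div (x z : IsoCl E) :
    (Nat.card (z.rep ≅ x.rep) : ℚ) / (Nat.card (z.rep ≅ z.rep) : ℚ) = Finsupp.single x 1 z := by
  by_cases h : x = z
  · subst h
    rw [div_self (card_aut_ne _), Finsupp.single_eq_same]
  · have : IsEmpty (z.rep ≅ x.rep) := ⟨fun f => h (IsoCl.eq_of_iso f).symm⟩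
    rw [Finsupp.single_eq_of_ne' h]
    simp

theorem hallProd_zero (x : IsoCl E) : hallProd x IsoCl.zero = Finsupp.single x 1 := by
  ext z
  rw [hallProd_apply, card_SES_zero_right _ _ _ IsoCl.zero_rep, iso_div]

theorem zero_hallProd (x : IsoCl E) : hallProd IsoCl.zero x = Finsupp.single x 1 := by
  ext z
  rw [hallProd_apply, card_SES_zero_left _ _ _ IsoCl.zero_rep, iso_div]

end

/-! ### Hall algebras of extension-closed subcategories -/

/-- The underlying rational vector space of the Hall algebra of the full subcategory `E`, with
basis the isomorphism classes of objects of `E`. If `E` contains `0` and is closed under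
extensions, then `E` is an exact category whose conflations are the short exact sequences of
modules with all terms in `E`, its `Ext¹` is that of the category of modules, and the instances
below make this the Hall algebra of `E`. -/
def HallAlg (E : ObjectProperty (FGModuleCat.{u} A)) : Type (u + 1) := IsoCl E →₀ ℚ

namespace HallAlg
variable {E : ObjectProperty (FGModuleCat.{u} A)}

noncomputable instance : AddCommGroup (HallAlg E) :=
  inferInstanceAs (AddCommGroup (IsoCl E →₀ ℚ))

noncomputable instance : Module ℚ (HallAlg E) :=
  inferInstanceAs (Module ℚ (IsoCl E →₀ ℚ))

/-- The basis of the isomorphism classes. -/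
noncomputable def basis : Module.Basis (IsoCl E) ℚ (HallAlg E) :=
  Module.Basis.ofRepr (LinearEquiv.refl ℚ (IsoCl E →₀ ℚ))

/-- A finitely supported function on isomorphism classes, as an element of the Hall algebra. -/
noncomputable def ofFinsupp (v : IsoCl E →₀ ℚ) : HallAlg E := basis.repr.symm v

theorem ofFinsupp_eq_sum (v : IsoCl E →₀ ℚ) :
    ofFinsupp v = ∑ x ∈ v.support, v x • basis x :=
  basis.repr_symm_apply v

theorem ofFinsupp_single (x : IsoCl E) : ofFinsupp (Finsupp.single x 1) = basis x :=
  basis.repr_symm_single_one x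

/-- The Hall product, as a bilinear map. -/
noncomputable def mulMap : HallAlg E →ₗ[ℚ] HallAlg E →ₗ[ℚ] HallAlg E :=
  basis.constr ℚ fun x => basis.constr ℚ fun y => ofFinsupp (hallProd x y)

theorem mulMap_basis (x y : IsoCl E) : mulMap (basis x) (basis y) = ofFinsupp (hallProd x y) := by
  rw [mulMap, Module.Basis.constr_basis, Module.Basis.constr_basis]

theorem mulMap_assoc_basis [E.IsClosedUnderExtensions] (x y z : IsoCl E) :
    mulMap (mulMap (basis x) (basis y)) (basis z) =
      mulMap (basis x) (mulMap (basis y) (basis z)) := by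
  rw [mulMap_basis x y, mulMap_basis y z, ofFinsupp_eq_sum, ofFinsupp_eq_sum]
  simp only [map_sum, map_smul, LinearMap.sum_apply, LinearMap.smul_apply, mulMap_basis]
  apply basis.repr.injective
  ext t
  simp only [map_sum, map_smul, ofFinsupp, LinearEquiv.apply_symm_apply, Finsupp.finsetSum_apply,
    Finsupp.smul_apply, smul_eq_mul]
  exact hallProd_assoc x y z t

theorem mulMap_assoc [E.IsClosedUnderExtensions] (u v w : HallAlg E) :
    mulMap (mulMap u v) w = mulMap u (mulMap v w) := by
  have h1 (x y : IsoCl E) (w : HallAlg E) : mulMap (mulMap (basis x) (basis y)) w =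
      mulMap (basis x) (mulMap (basis y) w) := by
    have : mulMap (mulMap (basis x) (basis y)) = mulMap (basis x) ∘ₗ mulMap (basis y) :=
      basis.ext fun z => mulMap_assoc_basis x y z
    exact congrArg (fun f => f w) this
  have h2 (x : IsoCl E) (v w : HallAlg E) : mulMap (mulMap (basis x) v) w =
      mulMap (basis x) (mulMap v w) := by
    have : mulMap.flip w ∘ₗ mulMap (basis x) = mulMap (basis x) ∘ₗ mulMap.flip w :=
      basis.ext fun y => h1 x y w
    exact congrArg (fun f => f v) this
  have : mulMap.flip w ∘ₗ mulMap.flip v = mulMap.flip (mulMap v w) :=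
    basis.ext fun x => h2 x v w
  exact congrArg (fun f => f u) this

variable [E.ContainsZero]

theorem one_mulMap (v : HallAlg E) : mulMap (basis IsoCl.zero) v = v := by
  have : mulMap (basis IsoCl.zero) = (LinearMap.id : HallAlg E →ₗ[ℚ] HallAlg E) :=
    basis.ext fun x => by rw [mulMap_basis, zero_hallProd, ofFinsupp_single]; rfl
  rw [this]; rfl

theorem mulMap_one (v : HallAlg E) : mulMap v (basis IsoCl.zero) = v := by
  have : mulMap.flip (basis IsoCl.zero) = (LinearMap.id : HallAlg E →ₗ[ℚ] HallAlg E) :=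
    basis.ext fun x => by rw [LinearMap.flip_apply, mulMap_basis, hallProd_zero, ofFinsupp_single]; rfl
  exact congrArg (fun f => f v) this

noncomputable instance [E.IsClosedUnderExtensions] : Ring (HallAlg E) :=
  { (inferInstance : AddCommGroup (HallAlg E)) with
    mul := fun u v => mulMap u v
    one := basis IsoCl.zero
    left_distrib := fun u v w => map_add (mulMap u) v w
    right_distrib := fun u v w => by
      change mulMap (u + v) w = _
      rw [map_add]; rfl
    zero_mul := fun u => by
      change mulMap 0 u = 0
      rw [map_zero]; rfl
    mul_zero := fun u => map_zero (mulMap u)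
    mul_assoc := mulMap_assoc
    one_mul := one_mulMap
    mul_one := mulMap_one }

noncomputable instance [E.IsClosedUnderExtensions] : Algebra ℚ (HallAlg E) :=
  Algebra.ofModule
    (fun r u v => by change mulMap (r • u) v = r • mulMap u v; rw [map_smul]; rfl)
    (fun r u v => map_smul (mulMap u) r v)

/-- The basis element `[M]`. -/
noncomputable def cls (M : FGModuleCat.{u} A) (hM : E M) : HallAlg E := basis (IsoCl.mk M hM)

end HallAlg

/-! ### Homological notions -/

instance finite_mop : Finite Aᵐᵒᵖ := Finite.of_equiv A MulOpposite.opEquiv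

/-- `A` is `1`-Gorenstein: `A` has injective dimension at most `1` as a left and as a right
module (right `A`-modules are left modules over the opposite ring). -/
def IsOneGorenstein (A : Type u) [Ring A] [Finite A] : Prop :=
  HasInjectiveDimensionLE (FGModuleCat.of A A) 1 ∧
    HasInjectiveDimensionLE (FGModuleCat.of Aᵐᵒᵖ A) 1

/-- The modules of projective dimension at most `1`. -/
def projDimLEOne (A : Type u) [Ring A] [Finite A] : ObjectProperty (FGModuleCat.{u} A) :=
  fun M => HasProjectiveDimensionLE M 1

/-- Totally acyclic complexes of finitely generated projective modules: `P` is acyclic, and so is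
the complex `Hom(P, A)`. -/
structure IsTotallyAcyclic (P : CochainComplex (FGModuleCat.{u} A) ℤ) : Prop where
  projective : ∀ n, Projective (P.X n)
  acyclic : P.Acyclic
  dual_acyclic : ∀ (l m n : ℤ), l + 1 = m → m + 1 = n → ∀ f : P.X m ⟶ FGModuleCat.of A A,
    P.d l m ≫ f = 0 → ∃ g : P.X n ⟶ FGModuleCat.of A A, P.d m n ≫ g = f

/-- The (finitely generated) Gorenstein projective modules. -/
def gproj (A : Type u) [Ring A] [Finite A] : ObjectProperty (FGModuleCat.{u} A) := fun M =>
  ∃ P : CochainComplex (FGModuleCat.{u} A) ℤ, IsTotallyAcyclic P ∧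
    Nonempty (M ≅ kernel (P.d 0 1))

/-- The Euler form `dim Hom(M, N) - dim Ext¹(M, N)`, to be used when `M` or `N` has projective
and injective dimension at most `1`. -/
noncomputable def eulerForm (k : Type*) [Field k] [Algebra k A] (M N : FGModuleCat.{u} A) : ℤ :=
  (Module.finrank k (M ⟶ N) : ℤ) - (Module.finrank k (Ext M N 1) : ℤ)

/-- The Grothendieck group of the full subcategory `E`, with respect to the short exact sequences
of modules with all terms in `E`. -/
def K0 (E : ObjectProperty (FGModuleCat.{u} A)) : Type (u + 1) :=
  FreeAbelianGroup (IsoCl E) ⧸ AddSubgroup.closure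
    {x | ∃ (S : ShortComplex (FGModuleCat.{u} A)) (_ : S.ShortExact)
      (h₁ : E S.X₁) (h₂ : E S.X₂) (h₃ : E S.X₃),
      x = FreeAbelianGroup.of (IsoCl.mk S.X₂ h₂) -
        (FreeAbelianGroup.of (IsoCl.mk S.X₁ h₁) + FreeAbelianGroup.of (IsoCl.mk S.X₃ h₃))}

noncomputable instance (E : ObjectProperty (FGModuleCat.{u} A)) : AddCommGroup (K0 E) :=
  inferInstanceAs (AddCommGroup (FreeAbelianGroup (IsoCl E) ⧸ AddSubgroup.closure _))

/-- The class of an object in the Grothendieck group. -/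
def K0.cls {E : ObjectProperty (FGModuleCat.{u} A)} (M : FGModuleCat.{u} A) (hM : E M) : K0 E :=
  QuotientAddGroup.mk (FreeAbelianGroup.of (IsoCl.mk M hM))

/-! ### The singularity category -/

noncomputable instance hasDerivedFG : HasDerivedCategory.{u + 1} (FGModuleCat.{u} A) :=
  HasDerivedCategory.standard _

/-- The bounded derived category of finitely generated modules. -/
abbrev BoundedDerived (A : Type u) [Ring A] [Finite A] : Type _ :=
  (DerivedCategory.TStructure.t (C := FGModuleCat.{u} A)).bounded.FullSubcategory

/-- The perfect objects of the bounded derived category: those isomorphic to a bounded complex of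
finitely generated projective modules. -/
def perfect (A : Type u) [Ring A] [Finite A] : ObjectProperty (BoundedDerived A) := fun X =>
  ∃ (K : CochainComplex (FGModuleCat.{u} A) ℤ) (a b : ℤ),
    K.IsStrictlyGE a ∧ K.IsStrictlyLE b ∧ (∀ n, Projective (K.X n)) ∧
      Nonempty (X.obj ≅ DerivedCategory.Q.obj K)

/-- The singularity category: the Verdier quotient of the bounded derived category by the perfect
objects, that is, its localization at the morphisms with perfect cone. -/
abbrev SingularityCategory (A : Type u) [Ring A] [Finite A] : Type _ :=
  (perfect A).trW.Localization

/-- A module, as a stalk complex concentrated in degree `0`. -/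
noncomputable def stalk (M : FGModuleCat.{u} A) : BoundedDerived A :=
  ⟨(DerivedCategory.singleFunctor _ 0).obj M, ⟨⟨0, inferInstance⟩, ⟨0, inferInstance⟩⟩⟩

/-- A module, as an object of the singularity category. -/
noncomputable def stalkSg (M : FGModuleCat.{u} A) : SingularityCategory A :=
  (perfect A).trW.Q.obj (stalk M)

/-- The isomorphism classes of objects of the singularity category. -/
abbrev SgClass (A : Type u) [Ring A] [Finite A] : Type _ :=
  Quotient (isIsomorphicSetoid (SingularityCategory A))

/-- The isomorphism class of a module in the singularity category. -/
noncomputable def sgClass (M : FGModuleCat.{u} A) : SgClass A :=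
  Quotient.mk (isIsomorphicSetoid (SingularityCategory A)) (stalkSg M)

/-! ### Localizations of noncommutative algebras -/

section
universe v
variable {R : Type v} [Ring R] [Algebra ℚ R]

/-- The defining relations of the universal `S`-inverting algebra: the generators `inl a` multiply
and add as in `R`, and `inr s` is a two-sided inverse of `inl s`. -/
inductive LocRel (S : Set R) : FreeAlgebra ℚ (R ⊕ S) → FreeAlgebra ℚ (R ⊕ S) → Prop
  | add (a b : R) : LocRel S (FreeAlgebra.ι ℚ (Sum.inl (a + b)))
      (FreeAlgebra.ι ℚ (Sum.inl a) + FreeAlgebra.ι ℚ (Sum.inl b))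
  | mul (a b : R) : LocRel S (FreeAlgebra.ι ℚ (Sum.inl (a * b)))
      (FreeAlgebra.ι ℚ (Sum.inl a) * FreeAlgebra.ι ℚ (Sum.inl b))
  | scalar (r : ℚ) : LocRel S (FreeAlgebra.ι ℚ (Sum.inl (algebraMap ℚ R r)))
      (algebraMap ℚ (FreeAlgebra ℚ (R ⊕ S)) r)
  | mul_inv (s : S) : LocRel S
      (FreeAlgebra.ι ℚ (Sum.inl (s : R)) * FreeAlgebra.ι ℚ (Sum.inr s)) 1
  | inv_mul (s : S) : LocRel S
      (FreeAlgebra.ι ℚ (Sum.inr s) * FreeAlgebra.ι ℚ (Sum.inl (s : R))) 1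

/-- The universal `S`-inverting algebra `R[S⁻¹]`. -/
abbrev Loc (S : Set R) : Type v := RingQuot (LocRel S)

/-- The canonical map `R → R[S⁻¹]`. -/
noncomputable def toLoc (S : Set R) : R →ₐ[ℚ] Loc S :=
  AlgHom.ofLinearMap
    { toFun := fun a => RingQuot.mkAlgHom ℚ (LocRel S) (FreeAlgebra.ι ℚ (Sum.inl a))
      map_add' := fun a b => by rw [← map_add]; exact RingQuot.mkAlgHom_rel ℚ (.add a b)
      map_smul' := fun r a => by
        rw [RingHom.id_apply, Algebra.smul_def, RingQuot.mkAlgHom_rel ℚ (.mul _ a), map_mul,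
          RingQuot.mkAlgHom_rel ℚ (.scalar r), AlgHom.commutes, Algebra.smul_def] }
    (by
      have h := RingQuot.mkAlgHom_rel ℚ (LocRel.scalar (S := S) 1)
      rw [map_one, map_one, map_one] at h
      exact h)
    (fun a b => by
      have h := RingQuot.mkAlgHom_rel ℚ (LocRel.mul (S := S) a b)
      rw [map_mul] at h
      exact h)

theorem isUnit_toLoc (S : Set R) {s : R} (hs : s ∈ S) : IsUnit (toLoc S s) := by
  have h1 := RingQuot.mkAlgHom_rel ℚ (LocRel.mul_inv (S := S) ⟨s, hs⟩)
  have h2 := RingQuot.mkAlgHom_rel ℚ (LocRel.inv_mul (S := S) ⟨s, hs⟩)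
  rw [map_mul, map_one] at h1 h2
  exact ⟨⟨_, _, h1, h2⟩, rfl⟩

/-- `i : R → R'` is a right (Ore) localization of `R` at the multiplicatively closed set `S`:
elements of `S` become units, every element of `R'` has the form `i(a) i(s)⁻¹`, and
`i(a) = i(b)` exactly if `a t = b t` for some `t ∈ S`. -/
structure IsRightLocalization {R' : Type*} [Ring R'] (S : Set R) (i : R →+* R') : Prop where
  one_mem : 1 ∈ S
  mul_mem : ∀ s ∈ S, ∀ t ∈ S, s * t ∈ S
  isUnit : ∀ s ∈ S, IsUnit (i s)
  exists_frac : ∀ x : R', ∃ a : R, ∃ s ∈ S, x = i a * Ring.inverse (i s)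
  eq_iff : ∀ a b : R, i a = i b ↔ ∃ t ∈ S, a * t = b * t

end

/-! ### Semi-derived Hall algebras -/

/-- Projective objects of the exact category `F`. -/
def IsExactProjective (F : ObjectProperty (FGModuleCat.{u} A)) (P : FGModuleCat.{u} A) : Prop :=
  ∀ S : ShortComplex (FGModuleCat.{u} A), S.ShortExact → F S.X₁ → F S.X₂ → F S.X₃ →
    ∀ f : P ⟶ S.X₃, ∃ g : P ⟶ S.X₂, g ≫ S.g = f

/-- Injective objects of the exact category `F`. -/
def IsExactInjective (F : ObjectProperty (FGModuleCat.{u} A)) (I : FGModuleCat.{u} A) : Prop :=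
  ∀ S : ShortComplex (FGModuleCat.{u} A), S.ShortExact → F S.X₁ → F S.X₂ → F S.X₃ →
    ∀ f : S.X₁ ⟶ I, ∃ g : S.X₂ ⟶ I, S.f ≫ g = f

/-- The classes of projective-injective objects in the Hall algebra of `F`. -/
def projInjClasses (F : ObjectProperty (FGModuleCat.{u} A)) : Set (HallAlg F) :=
  {x | ∃ (P : FGModuleCat.{u} A) (hP : F P),
    IsExactProjective F P ∧ IsExactInjective F P ∧ x = HallAlg.cls P hP}

/-- The semi-derived Hall algebra of a Frobenius category `F`: the localization of the Hall
algebra of `F` at the classes of the projective-injective objects. -/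
abbrev SemiDerivedHall (F : ObjectProperty (FGModuleCat.{u} A)) [F.ContainsZero]
    [F.IsClosedUnderExtensions] : Type (u + 1) :=
  Loc (projInjClasses F)

/-! ### The modified Ringel-Hall algebra -/

/-- The Hall algebra of the category of all finitely generated modules. -/
abbrev HallMod (A : Type u) [Ring A] [Finite A] : Type (u + 1) :=
  HallAlg (⊤ : ObjectProperty (FGModuleCat.{u} A))

/-- The generators `[L] - [K ⊕ M]` of the ideal `I`, as pairs, one for each short exact sequence
`0 → K → L → M → 0` with `K` of projective dimension at most `1`. -/
inductive ModRel : HallMod A → HallMod A → Prop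
  | mk (S : ShortComplex (FGModuleCat.{u} A)) (hS : S.ShortExact) (hK : projDimLEOne A S.X₁) :
      ModRel (HallAlg.cls S.X₂ trivial) (HallAlg.cls (S.X₁ ⊞ S.X₃) trivial)

/-- The quotient of the Hall algebra by the two-sided ideal `I`. -/
abbrev HallQuot (A : Type u) [Ring A] [Finite A] : Type (u + 1) :=
  RingQuot (ModRel (A := A))

/-- The class `[M]` in the quotient by `I`. -/
noncomputable def HallQuot.cls (M : FGModuleCat.{u} A) : HallQuot A :=
  RingQuot.mkAlgHom ℚ ModRel (HallAlg.cls M trivial)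

/-- The set of all `a [K]`, with `a` a nonzero rational and `K` of projective dimension at
most `1`. -/
def invertedSet (A : Type u) [Ring A] [Finite A] : Set (HallQuot A) :=
  {x | ∃ (a : ℚ) (K : FGModuleCat.{u} A), a ≠ 0 ∧ projDimLEOne A K ∧ x = a • HallQuot.cls K}

/-- The modified Ringel-Hall algebra. -/
abbrev ModifiedHall (A : Type u) [Ring A] [Finite A] : Type (u + 1) :=
  Loc (invertedSet A)

/-- The class `[M]` in the modified Ringel-Hall algebra. -/
noncomputable def ModifiedHall.cls (M : FGModuleCat.{u} A) : ModifiedHall A :=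
  toLoc (invertedSet A) (HallQuot.cls M)

/-- The quantum torus: the subalgebra generated by the `[K]` and their inverses, for `K` of
projective dimension at most `1`. -/
noncomputable def quantumTorus (A : Type u) [Ring A] [Finite A] : Subalgebra ℚ (ModifiedHall A) :=
  Algebra.adjoin ℚ {x | ∃ K : FGModuleCat.{u} A, projDimLEOne A K ∧
    (x = ModifiedHall.cls K ∨ x = Ring.inverse (ModifiedHall.cls K))}

end RingelHall

open RingelHall

/-!
The isomorphism from the modified Ringel–Hall algebra to the semi-derived Hall algebra replaces a
module by a Gorenstein projective resolution of length one, and everything else is read off from the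
Hall algebra of the Gorenstein projective modules, whose localization is easy to control.

Resolutions. Duality over the prime field turns the injective dimension of `A` on one side into the
projective dimension of the dual of `A`, so that every module `M` embeds into a module `K` of
projective dimension at most one (`gorenstein_of_isOneGorenstein`). Pulling back a projective
resolution of `K` along `M → K` gives `0 → P → G → M → 0` with `P` projective and `G` a submodule of
a projective module (`exists_gorenstein_resolution`). Such submodules are the modules without
extensions by projective modules, which are the Gorenstein projective ones (`gproj_iff`).

The isomorphism. Write `⟨M, N⟩` for the quotient of the orders of `Hom(M, N)` and `Ext¹(M, N)`. The
element `resCl M = ⟨M, P⟩⁻¹ [G] [P]⁻¹` is independent of the resolution, since the pullback of two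
resolutions of `M` splits in two ways. Lifting extensions along resolutions and averaging over the
fibres shows that `M ↦ resCl M` is multiplicative for the Hall product (`resCl_mul_resCl`). It
satisfies the relations of the modified algebra (`resCl_mid`), and `[G] ↦ [G]` is its inverse
(`modifiedEquivSemiDerived`).

Injectivity. Finite modules are determined by the numbers of homomorphisms into them
(`iso_of_card_hom_eq`), hence direct summands can be cancelled. Multiplication by the class of a
projective module `P` in the Hall algebra of the Gorenstein projective modules sends the basis
elements `[G]` to multiples of the distinct basis elements `[G ⊞ P]`; so `[P]` is regular and
normal, and the Hall algebra embeds into its Ore localization (`toLoc_gproj_injective`). As every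
element of the modified algebra comes from this Hall algebra after multiplication by some `[K]`, it
is a right localization (`isRightLocalization_modifiedHall`).

The singularity category. Killing the top cohomology of a bounded complex by a shifted projective
module reduces it to a shifted module. Syzygies and cosyzygies of Gorenstein projective modules
absorb the shift (`exists_sgClass_eq`). The functors `N ↦ Extⁿ(M, N)` for large `n` depend only on
`M` in the singularity category (`exists_ext_equiv`) and determine the `n`-th syzygy of `M` in the
stable category. For a Gorenstein projective module the syzygies determine the module, so Gorenstein
projective modules isomorphic in the singularity category become isomorphic after adding projective
modules (`stablyIso_of_sgClass_eq`).

The bases. The Grothendieck group of all modules has the classes of the simple modules as a basis,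
and the one of the modules of projective dimension at most one the classes of their projective
covers; independence follows from the Euler pairing between the two (`simpleBasis`, `coverBasis`).
In particular the class of a projective module determines the module (`iso_of_cls_eq`), and the
elements `[K_α]` are well defined and span the quantum torus (`mem_span_of_mem_quantumTorus`).
Finitely many products `[M] [K_α]` become, after multiplication with one `[R]`, multiples of
distinct basis elements `[G ⊞ Q]` of the Hall algebra of the Gorenstein projective modules, which
gives their independence (`linearIndependent_cls_mul_torusMonomial`). Freeness over the quantum
torus on both sides follows, because `[K_α]` commutes with every `[M]` up to a factor.
-/

namespace RingelHall
set_option linter.unusedSectionVars false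
variable {A : Type u} [Ring A] [Finite A]

/-! ### Finitely generated modules over a finite ring -/

theorem epi_iff_surjective {M N : FGModuleCat.{u} A} (f : M ⟶ N) :
    Epi f ↔ Function.Surjective f.hom.hom := by
  constructor
  · intro h
    have := (forget₂ (FGModuleCat.{u} A) (ModuleCat.{u} A)).map_epi f
    exact (ModuleCat.epi_iff_surjective _).1 this
  · intro h
    exact (forget₂ (FGModuleCat.{u} A) (ModuleCat.{u} A)).epi_of_epi_map
      ((ModuleCat.epi_iff_surjective _).2 h)

theorem mono_iff_injective {M N : FGModuleCat.{u} A} (f : M ⟶ N) :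
    Mono f ↔ Function.Injective f.hom.hom := by
  constructor
  · intro h
    have := (forget₂ (FGModuleCat.{u} A) (ModuleCat.{u} A)).map_mono f
    exact (ModuleCat.mono_iff_injective _).1 this
  · intro h
    exact (forget₂ (FGModuleCat.{u} A) (ModuleCat.{u} A)).mono_of_mono_map
      ((ModuleCat.mono_iff_injective _).2 h)

theorem projective_of_module (P : FGModuleCat.{u} A) [Module.Projective A P] : Projective P where
  factors {E X} f e _ := by
    obtain ⟨g, hg⟩ := Module.projective_lifting_property e.hom.hom f.hom.hom
      ((epi_iff_surjective e).1 inferInstance)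
    exact ⟨FGModuleCat.ofHom g, by ext1; exact hg⟩

/-- The free module of rank `n`. -/
abbrev free (A : Type u) [Ring A] (n : ℕ) : FGModuleCat.{u} A := FGModuleCat.of A (Fin n → A)

instance projective_free (n : ℕ) : Projective (free A n) := by
  have : Module.Projective A (Fin n → A) := inferInstance
  exact projective_of_module _

theorem exists_free_epi (M : FGModuleCat.{u} A) : ∃ (n : ℕ) (f : free A n ⟶ M), Epi f := by
  obtain ⟨n, f, hf⟩ := Module.Finite.exists_fin' A M
  exact ⟨n, FGModuleCat.ofHom f, (epi_iff_surjective _).2 hf⟩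

/-- The short exact sequence of an epimorphism and its kernel. -/
noncomputable def SES.ofEpi {L M : FGModuleCat.{u} A} (p : L ⟶ M) [Epi p] :
    SES M (kernel p) L where
  i := kernel.ι p
  p := p
  w := kernel.condition p
  ex := ⟨ShortComplex.exact_kernel p⟩

/-- The short exact sequence of a monomorphism and its cokernel. -/
noncomputable def SES.ofMono {N L : FGModuleCat.{u} A} (i : N ⟶ L) [Mono i] :
    SES (cokernel i) N L where
  i := i
  p := cokernel.π i
  w := cokernel.condition i
  ex := ⟨ShortComplex.exact_cokernel i⟩

theorem exists_cover (M : FGModuleCat.{u} A) :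
    ∃ (P K : FGModuleCat.{u} A) (_ : SES M K P), Projective P := by
  obtain ⟨n, f, hf⟩ := exists_free_epi M
  exact ⟨_, _, SES.ofEpi f, inferInstance⟩

/-- The split short exact sequence `0 → N → N ⊞ M → M → 0`. -/
noncomputable def SES.split (N M : FGModuleCat.{u} A) : SES M N (N ⊞ M) where
  i := biprod.inl
  p := biprod.snd
  w := by simp
  ex := (ShortComplex.Splitting.ofHasBinaryBiproduct N M).shortExact

instance SES.mono_i {M N L : FGModuleCat.{u} A} (s : SES M N L) : Mono s.i := s.ex.mono_f

instance SES.epi_p {M N L : FGModuleCat.{u} A} (s : SES M N L) : Epi s.p := s.ex.epi_g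

attribute [simp] SES.w

@[simp]
theorem SES.w_assoc {M N L X : FGModuleCat.{u} A} (s : SES M N L) (f : M ⟶ X) :
    s.i ≫ s.p ≫ f = 0 := by
  rw [← Category.assoc, s.w, zero_comp]

/-- Change of the middle term of a short exact sequence along an isomorphism. -/
noncomputable def SES.congrMid {M N L L' : FGModuleCat.{u} A} (s : SES M N L) (e : L ≅ L') :
    SES M N L' where
  i := s.i ≫ e.hom
  p := e.inv ≫ s.p
  w := by simp
  ex := ShortComplex.shortExact_of_iso (S₁ := ShortComplex.mk s.i s.p s.w)
    (ShortComplex.isoMk (Iso.refl _) e (Iso.refl _) (by simp) (by simp)) s.ex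

/-- Change of the left term of a short exact sequence along an isomorphism. -/
noncomputable def SES.congrLeft {M N N' L : FGModuleCat.{u} A} (s : SES M N L) (e : N ≅ N') :
    SES M N' L where
  i := e.inv ≫ s.i
  p := s.p
  w := by simp
  ex := ShortComplex.shortExact_of_iso (S₁ := ShortComplex.mk s.i s.p s.w)
    (ShortComplex.isoMk e (Iso.refl _) (Iso.refl _) (by simp) (by simp)) s.ex

/-- Change of the right term of a short exact sequence along an isomorphism. -/
noncomputable def SES.congrRight {M M' N L : FGModuleCat.{u} A} (s : SES M N L) (e : M ≅ M') :
    SES M' N L where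
  i := s.i
  p := s.p ≫ e.hom
  w := by simp
  ex := ShortComplex.shortExact_of_iso (S₁ := ShortComplex.mk s.i s.p s.w)
    (ShortComplex.isoMk (Iso.refl _) (Iso.refl _) e (by simp) (by simp)) s.ex

/-- The extension class of a short exact sequence, as an element of `Ext¹`. -/
noncomputable def SES.extCl {M N L : FGModuleCat.{u} A} (s : SES M N L) : Ext M N 1 := s.ex.extClass

@[simp]
theorem SES.comp_extCl {M N L : FGModuleCat.{u} A} (s : SES M N L) :
    (Ext.mk₀ s.p).comp s.extCl (zero_add 1) = 0 := s.ex.comp_extClass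

@[simp]
theorem SES.extCl_comp {M N L : FGModuleCat.{u} A} (s : SES M N L) :
    s.extCl.comp (Ext.mk₀ s.i) (add_zero 1) = 0 := s.ex.extClass_comp

/-- The pushout of a short exact sequence along a morphism from its left term. -/
theorem SES.exists_pushout {M N L N' : FGModuleCat.{u} A} (s : SES M N L) (f : N ⟶ N') :
    ∃ (L' : FGModuleCat.{u} A) (t : SES M N' L') (g : L ⟶ L'),
      s.i ≫ g = f ≫ t.i ∧ g ≫ t.p = s.p ∧ t.extCl = s.extCl.comp (Ext.mk₀ f) (add_zero 1) := by
  let π : pushout f s.i ⟶ M := pushout.desc 0 s.p (by simp)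
  have h1 : pushout.inl f s.i ≫ π = 0 := pushout.inl_desc ..
  have h2 : pushout.inr f s.i ≫ π = s.p := pushout.inr_desc ..
  have : Epi π := epi_of_epi_fac h2
  have hc : IsColimit (CokernelCofork.ofπ π h1) := by
    refine CokernelCofork.IsColimit.ofπ' π h1 fun {Z} k hk => ?_
    have hk' : s.i ≫ pushout.inr f s.i ≫ k = 0 := by
      rw [← pushout.condition_assoc, hk, comp_zero]
    refine ⟨s.ex.exact.desc (pushout.inr f s.i ≫ k) hk', ?_⟩
    apply pushout.hom_ext
    · rw [reassoc_of% h1, hk, zero_comp]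
    · rw [reassoc_of% h2]
      exact s.ex.exact.g_desc _ _
  let t : SES M N' (pushout f s.i) :=
    { i := pushout.inl f s.i, p := π, w := h1
      ex := { exact := ShortComplex.exact_of_g_is_cokernel _ hc
              mono_f := inferInstanceAs (Mono (pushout.inl f s.i))
              epi_g := this } }
  refine ⟨_, t, pushout.inr f s.i, pushout.condition.symm, h2, ?_⟩
  let F : ShortComplex.mk s.i s.p s.w ⟶ ShortComplex.mk t.i t.p t.w :=
    { τ₁ := f, τ₂ := pushout.inr f s.i, τ₃ := 𝟙 M, comm₁₂ := pushout.condition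
      comm₂₃ := by simpa using h2 }
  simpa [F, SES.extCl] using (ShortComplex.ShortExact.extClass_naturality s.ex t.ex F).symm

/-- The pullback of a short exact sequence along a morphism to its right term. -/
theorem SES.exists_pullback {M N L M' : FGModuleCat.{u} A} (s : SES M N L) (f : M' ⟶ M) :
    ∃ (L' : FGModuleCat.{u} A) (t : SES M' N L') (g : L' ⟶ L),
      t.i ≫ g = s.i ∧ IsPullback g t.p s.p f ∧
        t.extCl = (Ext.mk₀ f).comp s.extCl (zero_add 1) := by
  let ι : N ⟶ pullback s.p f := pullback.lift s.i 0 (by simp)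
  have h1 : ι ≫ pullback.snd s.p f = 0 := pullback.lift_snd ..
  have h2 : ι ≫ pullback.fst s.p f = s.i := pullback.lift_fst ..
  have : Mono ι := mono_of_mono_fac h2
  have hc : IsLimit (KernelFork.ofι ι h1) := by
    refine KernelFork.IsLimit.ofι' ι h1 fun {Z} k hk => ?_
    have hk' : (k ≫ pullback.fst s.p f) ≫ s.p = 0 := by
      rw [Category.assoc, pullback.condition, reassoc_of% hk, zero_comp]
    refine ⟨s.ex.exact.lift (k ≫ pullback.fst s.p f) hk', ?_⟩
    apply pullback.hom_ext
    · rw [Category.assoc, h2]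
      exact s.ex.exact.lift_f _ _
    · rw [Category.assoc, h1, hk, comp_zero]
  let t : SES M' N (pullback s.p f) :=
    { i := ι, p := pullback.snd s.p f, w := h1
      ex := { exact := ShortComplex.exact_of_f_is_kernel _ hc
              mono_f := this
              epi_g := inferInstanceAs (Epi (pullback.snd s.p f)) } }
  refine ⟨_, t, pullback.fst s.p f, h2, IsPullback.of_hasPullback _ _, ?_⟩
  let F : ShortComplex.mk t.i t.p t.w ⟶ ShortComplex.mk s.i s.p s.w :=
    { τ₁ := 𝟙 N, τ₂ := pullback.fst s.p f, τ₃ := f, comm₁₂ := by simpa using h2.symm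
      comm₂₃ := pullback.condition }
  simpa [F, SES.extCl] using (ShortComplex.ShortExact.extClass_naturality t.ex s.ex F)

/-- In a pullback square with an epimorphism as one side, the kernels of the parallel morphisms
agree. -/
theorem SES.of_isPullback {M N L M' L' : FGModuleCat.{u} A} (s : SES M N L) {f : M' ⟶ M}
    {g : L' ⟶ L} {p : L' ⟶ M'} (h : IsPullback g p s.p f) : ∃ t : SES M' N L', t.p = p := by
  let ι : N ⟶ L' := h.lift s.i 0 (by simp)
  have h1 : ι ≫ p = 0 := h.lift_snd ..
  have h2 : ι ≫ g = s.i := h.lift_fst ..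
  have : Mono ι := mono_of_mono_fac h2
  have hc : IsLimit (KernelFork.ofι ι h1) := by
    refine KernelFork.IsLimit.ofι' ι h1 fun {Z} k hk => ?_
    have hk' : (k ≫ g) ≫ s.p = 0 := by
      rw [Category.assoc, h.w, reassoc_of% hk, zero_comp]
    refine ⟨s.ex.exact.lift (k ≫ g) hk', ?_⟩
    apply h.hom_ext
    · rw [Category.assoc, h2]
      exact s.ex.exact.lift_f _ _
    · rw [Category.assoc, h1, hk, comp_zero]
  have : Epi p := (MorphismProperty.epimorphisms _).of_isPullback h s.epi_p
  exact ⟨{ i := ι, p := p, w := h1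
           ex := { exact := ShortComplex.exact_of_f_is_kernel _ hc, mono_f := ‹_›, epi_g := this } },
    rfl⟩

/-! ### Finiteness and realization of `Ext¹` -/

theorem ext_one_surjective {M N K P : FGModuleCat.{u} A} (s : SES M K P) [Projective P] :
    Function.Surjective fun f : K ⟶ N => s.extCl.comp (Ext.mk₀ f) (add_zero 1) := by
  intro e
  have h0 : (Ext.mk₀ s.p).comp e (zero_add 1) = 0 := Ext.eq_zero_of_projective _
  obtain ⟨x, hx⟩ := Ext.contravariant_sequence_exact₃ s.ex N e h0 (add_zero 1)
  obtain ⟨f, rfl⟩ := (Ext.mk₀_bijective _ _).2 x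
  exact ⟨f, hx⟩

instance finite_ext_one (M N : FGModuleCat.{u} A) : Finite (Ext M N 1) := by
  obtain ⟨P, K, s, hP⟩ := exists_cover M
  exact Finite.of_surjective _ (ext_one_surjective (N := N) s)

noncomputable instance fintypeExtOne (M N : FGModuleCat.{u} A) : Fintype (Ext M N 1) :=
  Fintype.ofFinite _

theorem exists_ses_ext_eq {M N : FGModuleCat.{u} A} (e : Ext M N 1) :
    ∃ (L : FGModuleCat.{u} A) (s : SES M N L), s.extCl = e := by
  obtain ⟨P, K, s, hP⟩ := exists_cover M
  obtain ⟨f, rfl⟩ := ext_one_surjective s e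
  obtain ⟨L, t, -, -, -, ht⟩ := s.exists_pushout f
  exact ⟨L, t, ht⟩

/-- The middle term of an extension with a given class. -/
noncomputable def mid {M N : FGModuleCat.{u} A} (e : Ext M N 1) : FGModuleCat.{u} A :=
  (exists_ses_ext_eq e).choose

/-- A short exact sequence with a given class. -/
noncomputable def midSES {M N : FGModuleCat.{u} A} (e : Ext M N 1) : SES M N (mid e) :=
  (exists_ses_ext_eq e).choose_spec.choose

theorem midSES_ext {M N : FGModuleCat.{u} A} (e : Ext M N 1) : (midSES e).extCl = e :=
  (exists_ses_ext_eq e).choose_spec.choose_spec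

theorem SES.exists_iso_of_ext_eq {M N L L' : FGModuleCat.{u} A} (s : SES M N L) (s' : SES M N L')
    (h : s.extCl = s'.extCl) : ∃ φ : L ≅ L', s.i ≫ φ.hom = s'.i ∧ φ.hom ≫ s'.p = s.p := by
  have z : s.extCl.comp (Ext.mk₀ s'.i) (add_zero 1) = 0 := by
    rw [h]; exact s'.ex.extClass_comp
  obtain ⟨x, hx⟩ := Ext.contravariant_sequence_exact₁ s.ex L' (Ext.mk₀ s'.i) (add_zero 1) z
  obtain ⟨ψ, rfl⟩ := (Ext.mk₀_bijective _ _).2 x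
  have hψ : s.i ≫ ψ = s'.i := by
    apply (Ext.mk₀_bijective _ _).1
    simpa using hx
  have hk : s.i ≫ (ψ ≫ s'.p - s.p) = 0 := by
    simp [Preadditive.comp_sub, reassoc_of% hψ]
  let g : M ⟶ M := s.ex.exact.desc _ hk
  have hg : s.p ≫ g = ψ ≫ s'.p - s.p := s.ex.exact.g_desc _ hk
  let F : ShortComplex.mk s.i s.p s.w ⟶ ShortComplex.mk s'.i s'.p s'.w :=
    { τ₁ := 𝟙 N, τ₂ := ψ, τ₃ := 𝟙 M + g, comm₁₂ := by simp [hψ],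
      comm₂₃ := by simp [Preadditive.comp_add, hg] }
  have nat := ShortComplex.ShortExact.extClass_naturality s.ex s'.ex F
  have z2 : (Ext.mk₀ g).comp s'.ex.extClass (zero_add 1) = 0 := by
    have h' : s.ex.extClass = s'.ex.extClass := h
    simpa [F, Ext.mk₀_add, Ext.add_comp, h'] using nat
  obtain ⟨y, hy⟩ := Ext.covariant_sequence_exact₃ M s'.ex (Ext.mk₀ g) (zero_add 1) z2
  obtain ⟨r, rfl⟩ := (Ext.mk₀_bijective _ _).2 y
  have hr : r ≫ s'.p = g := by
    apply (Ext.mk₀_bijective _ _).1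
    simpa using hy
  let G : ShortComplex.mk s.i s.p s.w ⟶ ShortComplex.mk s'.i s'.p s'.w :=
    { τ₁ := 𝟙 N, τ₂ := ψ - s.p ≫ r, τ₃ := 𝟙 M,
      comm₁₂ := by simp [Preadditive.comp_sub, hψ],
      comm₂₃ := by simp [Preadditive.sub_comp, hr, hg] }
  have hiso : IsIso G.τ₂ := by
    have : IsIso G.τ₁ := inferInstanceAs (IsIso (𝟙 N))
    have : IsIso G.τ₃ := inferInstanceAs (IsIso (𝟙 M))
    exact ShortComplex.isIso₂_of_shortExact_of_isIso₁₃ G s.ex s'.ex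
  refine ⟨@asIso _ _ _ _ G.τ₂ hiso, ?_, ?_⟩
  · simpa [G] using G.comm₁₂.symm
  · simpa [G] using G.comm₂₃

/-- An extension by a vanishing `Ext¹` is split. -/
theorem SES.iso_biprod_of_subsingleton {M N L : FGModuleCat.{u} A} (s : SES M N L)
    [Subsingleton (Ext M N 1)] : Nonempty (L ≅ N ⊞ M) :=
  ⟨(s.exists_iso_of_ext_eq (SES.split N M) (Subsingleton.elim _ _)).choose⟩

/-! ### The Hall product as a sum over extension classes -/

theorem mem_extWithMiddle_iff {M N L : FGModuleCat.{u} A} (e : Ext M N 1) :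
    e ∈ extWithMiddle M N L ↔ Nonempty (mid e ≅ L) := by
  constructor
  · rintro ⟨i, p, w, h, he⟩
    have : (midSES e).extCl = SES.extCl ⟨i, p, w, h⟩ := by rw [midSES_ext]; exact he.symm
    exact ⟨((midSES e).exists_iso_of_ext_eq _ this).choose⟩
  · rintro ⟨φ⟩
    have hs : (ShortComplex.mk ((midSES e).i ≫ φ.hom) (φ.inv ≫ (midSES e).p) (by simp)).ShortExact :=
      ((midSES e).congrMid φ).ex
    refine ⟨_, _, _, hs, ?_⟩
    let F : ShortComplex.mk (midSES e).i (midSES e).p (midSES e).w ⟶ ShortComplex.mk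
        ((midSES e).i ≫ φ.hom) (φ.inv ≫ (midSES e).p) (by simp) :=
      { τ₁ := 𝟙 N, τ₂ := φ.hom, τ₃ := 𝟙 M, comm₁₂ := by simp, comm₂₃ := by simp }
    have := ShortComplex.ShortExact.extClass_naturality (midSES e).ex hs F
    refine Eq.trans ?_ (midSES_ext e)
    simpa [F, SES.extCl] using this.symm

section
variable (E : ObjectProperty (FGModuleCat.{u} A))

open Classical in
/-- The basis element `[M]` of the Hall algebra of `E` if `M` is in `E`, and `0` otherwise. -/
noncomputable def HallAlg.cl (M : FGModuleCat.{u} A) : HallAlg E :=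
  if h : E M then HallAlg.cls M h else 0

variable {E}

theorem HallAlg.cl_eq {M : FGModuleCat.{u} A} (h : E M) : HallAlg.cl E M = HallAlg.cls M h :=
  dif_pos h

theorem HallAlg.cls_congr {M N : FGModuleCat.{u} A} (hM : E M) (hN : E N) (e : M ≅ N) :
    HallAlg.cls M hM = HallAlg.cls N hN := by
  rw [HallAlg.cls, HallAlg.cls, IsoCl.mk_eq_iff.2 ⟨e⟩]

theorem HallAlg.cl_congr {M N : FGModuleCat.{u} A} (hM : E M) (hN : E N) (e : M ≅ N) :
    HallAlg.cl E M = HallAlg.cl E N := by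
  rw [HallAlg.cl_eq hM, HallAlg.cl_eq hN, HallAlg.cls_congr hM hN e]

theorem HallAlg.basis_eq_cl (x : IsoCl E) : HallAlg.basis x = HallAlg.cl E x.rep := by
  rw [HallAlg.cl_eq x.rep_mem, HallAlg.cls, IsoCl.mk_rep]

theorem HallAlg.hom_ext {V : Type*} [AddCommGroup V] [Module ℚ V] {f g : HallAlg E →ₗ[ℚ] V}
    (h : ∀ M, E M → f (HallAlg.cl E M) = g (HallAlg.cl E M)) : f = g :=
  HallAlg.basis.ext fun x => by rw [HallAlg.basis_eq_cl]; exact h _ x.rep_mem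

variable [E.IsClosedUnderExtensions] [E.ContainsZero]

theorem mid_mem {M N : FGModuleCat.{u} A} (hM : E M) (hN : E N) (e : Ext M N 1) : E (mid e) :=
  E.prop_X₂_of_shortExact (midSES e).ex hN hM

theorem HallAlg.one_eq {Z : FGModuleCat.{u} A} (hE : E Z) (hZ : IsZero Z) :
    (1 : HallAlg E) = HallAlg.cl E Z := by
  change HallAlg.basis IsoCl.zero = _
  rw [HallAlg.basis_eq_cl]
  exact HallAlg.cl_congr (IsoCl.rep_mem _) hE (IsoCl.zero_rep.iso hZ)

/-- The Hall product as a sum over `Ext¹`: the coefficients of the isomorphism classes are the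
sizes of the fibres of `mid`. -/
theorem HallAlg.cl_mul_cl {M N : FGModuleCat.{u} A} (hM : E M) (hN : E N) :
    HallAlg.cl E M * HallAlg.cl E N =
      (Nat.card (M ⟶ N) : ℚ)⁻¹ • ∑ e : Ext M N 1, HallAlg.cl E (mid e) := by
  classical
  rw [HallAlg.cl_eq hM, HallAlg.cl_eq hN]
  change HallAlg.mulMap (HallAlg.basis _) (HallAlg.basis _) = _
  rw [HallAlg.mulMap_basis]
  obtain ⟨a⟩ := IsoCl.rep_mk M hM
  obtain ⟨b⟩ := IsoCl.rep_mk N hN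
  apply HallAlg.basis.repr.injective
  ext z
  rw [HallAlg.ofFinsupp, LinearEquiv.apply_symm_apply, hallProd_apply,
    card_SES_congr a b (Iso.refl z.rep), ← hallCoeff_eq, hallCoeff, map_smul, Finsupp.smul_apply,
    map_sum, Finsupp.finsetSum_apply]
  have h (e : Ext M N 1) : HallAlg.basis.repr (HallAlg.cl E (mid e)) z =
      if e ∈ extWithMiddle M N z.rep then (1 : ℚ) else 0 := by
    rw [HallAlg.cl_eq (mid_mem hM hN e), HallAlg.cls, Module.Basis.repr_self,
      Finsupp.single_apply]
    congr 1
    rw [mem_extWithMiddle_iff, eq_iff_iff, ← IsoCl.mk_eq_iff (hM := mid_mem hM hN e)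
      (hN := z.rep_mem), IsoCl.mk_rep]
  simp_rw [h]
  rw [Finset.sum_ite, Finset.sum_const_zero, add_zero, Finset.sum_const, Nat.smul_one_eq_cast,
    smul_eq_mul, div_eq_inv_mul, ← Fintype.card_subtype, ← Nat.card_eq_fintype_card]

end

/-! ### The multiplicative Euler form -/

section Card
variable {A₁ A₂ A₃ A₄ A₅ A₆ : Type*} [AddCommGroup A₁] [AddCommGroup A₂] [AddCommGroup A₃]
  [AddCommGroup A₄] [AddCommGroup A₅] [AddCommGroup A₆]

theorem card_eq_ker_mul_range (f : A₁ →+ A₂) :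
    Nat.card A₁ = Nat.card f.ker * Nat.card f.range := by
  rw [← Nat.card_congr (QuotientAddGroup.quotientKerEquivRange f).toEquiv, mul_comm]
  exact f.ker.card_eq_card_quotient_mul_card_addSubgroup

theorem card_six_term {f₁ : A₁ →+ A₂} {f₂ : A₂ →+ A₃} {f₃ : A₃ →+ A₄} {f₄ : A₄ →+ A₅}
    {f₅ : A₅ →+ A₆} (h₁ : Function.Injective f₁) (h₁₂ : f₂.ker = f₁.range)
    (h₂₃ : f₃.ker = f₂.range) (h₃₄ : f₄.ker = f₃.range) (h₄₅ : f₅.ker = f₄.range)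
    (h₅ : Function.Surjective f₅) :
    Nat.card A₁ * Nat.card A₃ * Nat.card A₅ = Nat.card A₂ * Nat.card A₄ * Nat.card A₆ := by
  have e₁ : Nat.card A₁ = Nat.card f₁.range :=
    Nat.card_congr (AddMonoidHom.ofInjective h₁).toEquiv
  have e₆ : Nat.card A₆ = Nat.card f₅.range := by
    rw [AddMonoidHom.range_eq_top.2 h₅]
    exact (Nat.card_congr AddSubgroup.topEquiv.toEquiv).symm
  rw [card_eq_ker_mul_range f₂, card_eq_ker_mul_range f₃, card_eq_ker_mul_range f₄,
    card_eq_ker_mul_range f₅, h₁₂, h₂₃, h₃₄, h₄₅, e₁, e₆]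
  ring

end Card

theorem card_ext_zero (M N : FGModuleCat.{u} A) : Nat.card (Ext M N 0) = Nat.card (M ⟶ N) :=
  Nat.card_congr Ext.homEquiv₀

/-- The multiplicative Euler form `|Hom(M, N)| / |Ext¹(M, N)|`. -/
noncomputable def ef (M N : FGModuleCat.{u} A) : ℚ :=
  (Nat.card (M ⟶ N) : ℚ) / (Nat.card (Ext M N 1) : ℚ)

theorem card_hom_ne (M N : FGModuleCat.{u} A) : (Nat.card (M ⟶ N) : ℚ) ≠ 0 := by
  exact_mod_cast (card_hom_pos M N).ne'

theorem card_ext_ne (M N : FGModuleCat.{u} A) : (Nat.card (Ext M N 1) : ℚ) ≠ 0 := by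
  exact_mod_cast (Nat.card_pos (α := Ext M N 1)).ne'

theorem ef_ne (M N : FGModuleCat.{u} A) : ef M N ≠ 0 :=
  div_ne_zero (card_hom_ne M N) (card_ext_ne M N)

theorem ef_of_subsingleton (M N : FGModuleCat.{u} A) [Subsingleton (Ext M N 1)] :
    ef M N = Nat.card (M ⟶ N) := by
  rw [ef, Nat.card_of_subsingleton (0 : Ext M N 1), Nat.cast_one, div_one]

theorem ef_left_of_surjective {M N L : FGModuleCat.{u} A} (s : SES M N L) (X : FGModuleCat.{u} A)
    (hs : Function.Surjective ((Ext.mk₀ s.i).precomp X (zero_add 1))) :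
    ef L X = ef N X * ef M X := by
  have h := card_six_term (f₁ := (Ext.mk₀ s.p).precomp X (zero_add 0))
    (f₂ := (Ext.mk₀ s.i).precomp X (zero_add 0)) (f₃ := s.extCl.precomp X (add_zero 1))
    (f₄ := (Ext.mk₀ s.p).precomp X (zero_add 1)) (f₅ := (Ext.mk₀ s.i).precomp X (zero_add 1))
    ?_ ?_ ?_ ?_ ?_ hs
  · rw [card_ext_zero, card_ext_zero, card_ext_zero] at h
    rw [ef, ef, ef, div_mul_div_comm, div_eq_div_iff (card_ext_ne _ _)
      (mul_ne_zero (card_ext_ne _ _) (card_ext_ne _ _))]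
    exact_mod_cast (by linarith : Nat.card (L ⟶ X) * (Nat.card (Ext N X 1) * Nat.card (Ext M X 1)) =
      Nat.card (N ⟶ X) * Nat.card (M ⟶ X) * Nat.card (Ext L X 1))
  · exact Ext.precomp_mk₀_injective_of_epi X s.p
  · ext x
    constructor
    · intro hx
      obtain ⟨y, hy⟩ := Ext.contravariant_sequence_exact₂ s.ex X x hx
      exact ⟨y, hy⟩
    · rintro ⟨y, rfl⟩
      simp [AddMonoidHom.mem_ker]
  · ext x
    constructor
    · intro hx
      obtain ⟨y, hy⟩ := Ext.contravariant_sequence_exact₁ s.ex X x (add_zero 1) hx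
      exact ⟨y, hy⟩
    · rintro ⟨y, rfl⟩
      exact s.ex.extClass_comp_assoc y (h := add_zero 1)
  · ext x
    constructor
    · intro hx
      obtain ⟨y, hy⟩ := Ext.contravariant_sequence_exact₃ s.ex X x hx (add_zero 1)
      exact ⟨y, hy⟩
    · rintro ⟨y, rfl⟩
      exact s.ex.comp_extClass_assoc y (add_zero 1)
  · ext x
    constructor
    · intro hx
      obtain ⟨y, hy⟩ := Ext.contravariant_sequence_exact₂ s.ex X x hx
      exact ⟨y, hy⟩
    · rintro ⟨y, rfl⟩
      simp [AddMonoidHom.mem_ker]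

/-- The Euler form is multiplicative in the first argument as soon as `Ext²` vanishes. -/
theorem ef_left {M N L : FGModuleCat.{u} A} (s : SES M N L) (X : FGModuleCat.{u} A)
    [Subsingleton (Ext M X 2)] : ef L X = ef N X * ef M X :=
  ef_left_of_surjective s X fun x => by
    obtain ⟨y, hy⟩ := Ext.contravariant_sequence_exact₁ s.ex X x (n₁ := 2) rfl
      (Subsingleton.elim _ _)
    exact ⟨y, hy⟩

theorem ef_left_of_subsingleton {M N L : FGModuleCat.{u} A} (s : SES M N L)
    (X : FGModuleCat.{u} A) [Subsingleton (Ext N X 1)] : ef L X = ef N X * ef M X :=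
  ef_left_of_surjective s X fun _ => ⟨0, Subsingleton.elim _ _⟩

/-- The Euler form is multiplicative in the second argument as soon as `Ext²` vanishes. -/
theorem ef_right {M N L : FGModuleCat.{u} A} (s : SES M N L) (X : FGModuleCat.{u} A)
    [Subsingleton (Ext X N 2)] : ef X L = ef X N * ef X M := by
  have h := card_six_term (f₁ := (Ext.mk₀ s.i).postcomp X (add_zero 0))
    (f₂ := (Ext.mk₀ s.p).postcomp X (add_zero 0)) (f₃ := s.extCl.postcomp X (zero_add 1))
    (f₄ := (Ext.mk₀ s.i).postcomp X (add_zero 1)) (f₅ := (Ext.mk₀ s.p).postcomp X (add_zero 1))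
    ?_ ?_ ?_ ?_ ?_ ?_
  · rw [card_ext_zero, card_ext_zero, card_ext_zero] at h
    rw [ef, ef, ef, div_mul_div_comm, div_eq_div_iff (card_ext_ne _ _)
      (mul_ne_zero (card_ext_ne _ _) (card_ext_ne _ _))]
    exact_mod_cast (by linarith : Nat.card (X ⟶ L) * (Nat.card (Ext X N 1) * Nat.card (Ext X M 1)) =
      Nat.card (X ⟶ N) * Nat.card (X ⟶ M) * Nat.card (Ext X L 1))
  · exact Ext.postcomp_mk₀_injective_of_mono X s.i
  · ext x
    constructor
    · intro hx
      obtain ⟨y, hy⟩ := Ext.covariant_sequence_exact₂ X s.ex x hx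
      exact ⟨y, hy⟩
    · rintro ⟨y, rfl⟩
      simp [AddMonoidHom.mem_ker]
  · ext x
    constructor
    · intro hx
      obtain ⟨y, hy⟩ := Ext.covariant_sequence_exact₃ X s.ex x (zero_add 1) hx
      exact ⟨y, hy⟩
    · rintro ⟨y, rfl⟩
      simp [AddMonoidHom.mem_ker]
  · ext x
    constructor
    · intro hx
      obtain ⟨y, hy⟩ := Ext.covariant_sequence_exact₁ X s.ex x hx (zero_add 1)
      exact ⟨y, hy⟩
    · rintro ⟨y, rfl⟩
      simp [AddMonoidHom.mem_ker]
  · ext x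
    constructor
    · intro hx
      obtain ⟨y, hy⟩ := Ext.covariant_sequence_exact₂ X s.ex x hx
      exact ⟨y, hy⟩
    · rintro ⟨y, rfl⟩
      simp [AddMonoidHom.mem_ker]
  · intro x
    obtain ⟨y, hy⟩ := Ext.covariant_sequence_exact₃ X s.ex x (n₁ := 2) rfl
      (Subsingleton.elim _ _)
    exact ⟨y, hy⟩

theorem ef_congr_left {M M' : FGModuleCat.{u} A} (e : M ≅ M') (X : FGModuleCat.{u} A) :
    ef M X = ef M' X := by
  rw [ef, ef, Nat.card_congr (e.homCongr (Iso.refl X)), Nat.card_congr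
    (⟨fun x => (Ext.mk₀ e.inv).comp x (zero_add 1), fun x => (Ext.mk₀ e.hom).comp x (zero_add 1),
      fun x => by simp, fun x => by simp⟩ : Ext M X 1 ≃ Ext M' X 1)]

theorem ef_congr_right {M M' : FGModuleCat.{u} A} (e : M ≅ M') (X : FGModuleCat.{u} A) :
    ef X M = ef X M' := by
  rw [ef, ef, Nat.card_congr ((Iso.refl X).homCongr e), Nat.card_congr
    (⟨fun x => x.comp (Ext.mk₀ e.hom) (add_zero 1), fun x => x.comp (Ext.mk₀ e.inv) (add_zero 1),
      fun x => by simp, fun x => by simp⟩ : Ext X M 1 ≃ Ext X M' 1)]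


/-! ### Duality for modules over a ring of prime characteristic -/

section Dual
variable {R S : Type u} [Ring R] [Finite R] [Ring S] [Finite S] (p : ℕ) (e : S ≃+* Rᵐᵒᵖ)

/-- The `S`-module structure on the `ZMod p`-dual of an `R`-module, where `S` is identified with
the opposite ring of `R`. -/
abbrev dualModule (M : Type u) [AddCommGroup M] [Module R M] : Module S (M →+ ZMod p) where
  smul s f := f.comp (DistribSMul.toAddMonoidHom M (e s).unop)
  one_smul f := by ext m; change f ((e 1).unop • m) = f m; simp
  mul_smul s t f := by
    ext m; change f ((e (s * t)).unop • m) = f ((e t).unop • (e s).unop • m)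
    simp [mul_smul]
  smul_zero s := rfl
  smul_add s f g := rfl
  add_smul s t f := by
    ext m; change f ((e (s + t)).unop • m) = f ((e s).unop • m) + f ((e t).unop • m)
    simp [add_smul]
  zero_smul f := by ext m; change f ((e 0).unop • m) = 0; simp

variable [Fact p.Prime]

/-- The dual `Hom(M, ZMod p)` of an `R`-module, as a module over the opposite ring. It is a duality
on modules of characteristic `p`. -/
noncomputable def dual (M : FGModuleCat.{u} R) : FGModuleCat.{u} S :=
  letI := dualModule p e M
  haveI : Finite (M →+ ZMod p) := Finite.of_injective (fun f => (f : M → ZMod p))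
    DFunLike.coe_injective
  haveI : Module.Finite S (M →+ ZMod p) := Module.Finite.of_finite
  FGModuleCat.of S (M →+ ZMod p)

/-- An element of the dual, as a function. -/
def dual.coe {M : FGModuleCat.{u} R} (f : dual p e M) : M →+ ZMod p := f

/-- A function, as an element of the dual. -/
def dual.mk {M : FGModuleCat.{u} R} (f : M →+ ZMod p) : dual p e M := f

/-- The transpose of a morphism. -/
noncomputable def dualMap {M N : FGModuleCat.{u} R} (f : M ⟶ N) : dual p e N ⟶ dual p e M :=
  let l : dual p e N →ₗ[S] dual p e M :=
    { toFun := fun g => dual.mk p e ((dual.coe p e g).comp f.hom.hom.toAddMonoidHom)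
      map_add' := fun _ _ => rfl
      map_smul' := fun s g => by
        apply AddMonoidHom.ext
        intro m
        change dual.coe p e g ((e s).unop • f.hom.hom m) =
          dual.coe p e g (f.hom.hom ((e s).unop • m))
        rw [f.hom.hom.map_smul] }
  ObjectProperty.homMk (@ModuleCat.ofHom S _ (dual p e N) (dual p e M) _ _ _ _ l)

theorem dualMap_comp {M N L : FGModuleCat.{u} R} (f : M ⟶ N) (g : N ⟶ L) :
    dualMap p e (f ≫ g) = dualMap p e g ≫ dualMap p e f := rfl

theorem mono_dualMap {M N : FGModuleCat.{u} R} (f : M ⟶ N) [Epi f] : Mono (dualMap p e f) := by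
  rw [mono_iff_injective]
  intro g h hgh
  apply AddMonoidHom.ext
  intro n
  obtain ⟨m, rfl⟩ := (epi_iff_surjective f).1 inferInstance n
  exact DFunLike.congr_fun (F := M →+ ZMod p) hgh m

/-- Characters extend from subgroups: a group killed by `p` is a vector space over `ZMod p`. -/
theorem exists_extend_character {M N : Type*} [AddCommGroup M] [AddCommGroup N]
    (hN : ∀ n : N, p • n = 0) (f : M →+ N) (hf : Function.Injective f) (g : M →+ ZMod p) :
    ∃ h : N →+ ZMod p, h.comp f = g := by
  let := AddCommGroup.zmodModule hN
  let := AddCommGroup.zmodModule (n := p) (G := M) fun m => hf (by rw [map_nsmul, hN, map_zero])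
  obtain ⟨r, hr⟩ := (f.toZModLinearMap p).exists_leftInverse_of_injective
    (LinearMap.ker_eq_bot.2 hf)
  refine ⟨g.comp r.toAddMonoidHom, ?_⟩
  ext m
  exact congrArg g (LinearMap.congr_fun hr m)

theorem bijective_eval_character {V : Type*} [AddCommGroup V] [Finite V]
    (hV : ∀ v : V, p • v = 0) :
    Function.Bijective fun v : V => (AddMonoidHom.eval v : (V →+ ZMod p) →+ ZMod p) := by
  have inst : Module (ZMod p) V := AddCommGroup.zmodModule hV
  have : Module.Finite (ZMod p) V := Module.Finite.of_finite
  have hinj : Function.Injective fun v : V => (AddMonoidHom.eval v : (V →+ ZMod p) →+ ZMod p) := by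
    intro v w hvw
    have h0 : v - w = 0 := by
      refine (Module.forall_dual_apply_eq_zero_iff (ZMod p) (v - w)).1 fun f => ?_
      rw [map_sub, sub_eq_zero]
      exact DFunLike.congr_fun hvw f.toAddMonoidHom
    exact sub_eq_zero.1 h0
  refine ⟨hinj, fun g => ?_⟩
  let φ : Module.Dual (ZMod p) V →+ (V →+ ZMod p) := LinearMap.toAddMonoidHom'
  obtain ⟨v, hv⟩ := (Module.evalEquiv (ZMod p) V).surjective
    (AddMonoidHom.toZModLinearMap p (g.comp φ))
  refine ⟨v, ?_⟩
  ext f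
  exact LinearMap.congr_fun hv (AddMonoidHom.toZModLinearMap p f)

variable (hp : (p : R) = 0)
include hp

theorem char_nsmul {M : Type*} [AddCommGroup M] [Module R M] (m : M) : p • m = 0 := by
  rw [← Nat.cast_smul_eq_nsmul R, hp, zero_smul]

theorem epi_dualMap {M N : FGModuleCat.{u} R} (f : M ⟶ N) [Mono f] : Epi (dualMap p e f) := by
  rw [epi_iff_surjective]
  intro g
  exact exists_extend_character p (char_nsmul (R := R) p hp) f.hom.hom.toAddMonoidHom
    ((mono_iff_injective f).1 inferInstance) g

/-- The dual of a short exact sequence. -/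
theorem dualMap_shortExact {M N L : FGModuleCat.{u} R} (s : SES M N L) :
    Nonempty (SES (dual p e N) (dual p e M) (dual p e L)) := by
  have := mono_dualMap p e s.p
  have := epi_dualMap p e hp s.i
  have w : dualMap p e s.p ≫ dualMap p e s.i = 0 := by
    rw [← dualMap_comp, s.w]
    ext g
    apply AddMonoidHom.ext
    intro m
    exact map_zero (dual.coe p e g)
  refine ⟨⟨dualMap p e s.p, dualMap p e s.i, w, (shortExact_iff _).2
    ⟨(mono_iff_injective _).1 ‹_›, (epi_iff_surjective _).1 ‹_›, fun g => ⟨fun hg => ?_, ?_⟩⟩⟩⟩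
  · obtain ⟨-, h2, h3⟩ := (shortExact_iff _).1 s.ex
    have hg' (n : N) : dual.coe p e g (s.i.hom.hom n) = 0 :=
      DFunLike.congr_fun (F := N →+ ZMod p) hg n
    let q : L →+ M := s.p.hom.hom.toAddMonoidHom
    have hq : q.ker ≤ (dual.coe p e g).ker := by
      intro l hl
      obtain ⟨n, rfl⟩ := (h3 l).1 hl
      exact hg' n
    refine ⟨q.liftOfSurjective h2 ⟨dual.coe p e g, hq⟩, ?_⟩
    apply AddMonoidHom.ext
    intro l
    exact q.liftOfRightInverse_comp_apply _ (Function.rightInverse_surjInv h2) ⟨dual.coe p e g, hq⟩ l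
  · rintro ⟨g, rfl⟩
    exact congrArg (fun f => f.hom.hom g) w

variable {p e} {e' : R ≃+* Sᵐᵒᵖ} (he : ∀ r, (e (e' r).unop).unop = r)
include he

/-- A module is isomorphic to its double dual, naturally. -/
theorem exists_eval (M : FGModuleCat.{u} R) : ∃ φ : M ≅ dual p e' (dual p e M),
    ∀ (m : M) (f : dual p e M), dual.coe p e' (φ.hom.hom.hom m) f = dual.coe p e f m := by
  let ev : M →ₗ[R] dual p e' (dual p e M) :=
    { toFun := fun m => (AddMonoidHom.eval m : (M →+ ZMod p) →+ ZMod p)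
      map_add' := fun m n => by
        apply AddMonoidHom.ext
        intro f
        exact map_add (dual.coe p e f) m n
      map_smul' := fun r m => by
        apply AddMonoidHom.ext
        intro f
        change dual.coe p e f (r • m) = dual.coe p e f ((e (e' r).unop).unop • m)
        rw [he] }
  have hbij : Function.Bijective ev := bijective_eval_character p (char_nsmul (R := R) p hp)
  exact ⟨(LinearEquiv.ofBijective ev hbij).toFGModuleCatIso, fun m f => rfl⟩

theorem injective_dual (hp' : (p : S) = 0) (P : FGModuleCat.{u} R) [Projective P]
    (he' : ∀ s, (e' (e s).unop).unop = s) :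
    Injective (dual p e P) where
  factors {X Y} f g _ := by
    obtain ⟨φ, hφ⟩ := exists_eval hp he P
    obtain ⟨ψ, hψ⟩ := exists_eval hp' he' Y
    have := epi_dualMap p e' hp' g
    let l : P ⟶ dual p e' Y := Projective.factorThru (φ.hom ≫ dualMap p e' f) (dualMap p e' g)
    have hl : l ≫ dualMap p e' g = φ.hom ≫ dualMap p e' f := Projective.factorThru_comp _ _
    refine ⟨ψ.hom ≫ dualMap p e l, ?_⟩
    ext x
    apply AddMonoidHom.ext
    intro m
    change dual.coe p e (ψ.hom.hom.hom (g.hom.hom x)) (l.hom.hom m) = dual.coe p e (f.hom.hom x) m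
    rw [hψ, ← hφ]
    exact DFunLike.congr_fun (F := X →+ ZMod p) (congrArg (fun h => h.hom.hom m) hl) x

theorem projective_of_injective_dual (P : FGModuleCat.{u} R) [Injective (dual p e P)] :
    Projective P where
  factors {Y X} f g _ := by
    obtain ⟨φ, hφ⟩ := exists_eval hp he P
    obtain ⟨ψ, hψ⟩ := exists_eval hp he Y
    have := mono_dualMap p e g
    let l : dual p e Y ⟶ dual p e P := Injective.factorThru (dualMap p e f) (dualMap p e g)
    have hl : dualMap p e g ≫ l = dualMap p e f := Injective.comp_factorThru _ _
    refine ⟨φ.hom ≫ dualMap p e' l ≫ ψ.inv, ?_⟩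
    obtain ⟨χ, hχ⟩ := exists_eval hp he X
    have h1 : ψ.hom ≫ dualMap p e' (dualMap p e g) = g ≫ χ.hom := by
      ext y
      apply AddMonoidHom.ext
      intro h
      exact (hψ y (h.comp g.hom.hom.toAddMonoidHom)).trans (hχ (g.hom.hom y) h).symm
    have h2 : φ.hom ≫ dualMap p e' (dualMap p e f) = f ≫ χ.hom := by
      ext y
      apply AddMonoidHom.ext
      intro h
      exact (hφ y (h.comp f.hom.hom.toAddMonoidHom)).trans (hχ (f.hom.hom y) h).symm
    rw [← cancel_mono χ.hom, ← h2, ← hl, dualMap_comp, Category.assoc, Category.assoc,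
      Category.assoc, ← h1, Iso.inv_hom_id_assoc]

end Dual


/-! ### Homological algebra over a Gorenstein ring -/

theorem SES.exists_extend {M N L X : FGModuleCat.{u} A} (s : SES M N L)
    [Subsingleton (Ext M X 1)] (f : N ⟶ X) : ∃ g : L ⟶ X, s.i ≫ g = f := by
  obtain ⟨x, hx⟩ := Ext.contravariant_sequence_exact₁ s.ex X (Ext.mk₀ f) (add_zero 1)
    (Subsingleton.elim _ _)
  obtain ⟨g, rfl⟩ := (Ext.mk₀_bijective _ _).2 x
  refine ⟨g, (Ext.mk₀_bijective _ _).1 ?_⟩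
  simpa using hx

theorem subsingleton_ext_sub {M N L : FGModuleCat.{u} A} (s : SES M N L) (X : FGModuleCat.{u} A)
    {n m : ℕ} (hm : 1 + n = m) [Subsingleton (Ext L X n)] [Subsingleton (Ext M X m)] :
    Subsingleton (Ext N X n) := by
  refine subsingleton_of_forall_eq 0 fun x => ?_
  obtain ⟨y, rfl⟩ := Ext.contravariant_sequence_exact₁ s.ex X x hm (Subsingleton.elim _ _)
  rw [Subsingleton.elim y 0, Ext.comp_zero]

theorem subsingleton_ext_mid {M N L : FGModuleCat.{u} A} (s : SES M N L) (X : FGModuleCat.{u} A)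
    (n : ℕ) [Subsingleton (Ext N X n)] [Subsingleton (Ext M X n)] :
    Subsingleton (Ext L X n) := by
  refine subsingleton_of_forall_eq 0 fun x => ?_
  obtain ⟨y, rfl⟩ := Ext.contravariant_sequence_exact₂ s.ex X x (Subsingleton.elim _ _)
  rw [Subsingleton.elim y 0, Ext.comp_zero]

instance subsingleton_ext_projective (P X : FGModuleCat.{u} A) [Projective P] (n : ℕ) :
    Subsingleton (Ext P X (n + 1)) := Ext.subsingleton_of_projective _ _ _

/-- The consequences of being `1`-Gorenstein which drive the theory of Gorenstein projective
modules: projective modules have injective dimension at most `1`, and every module embeds into a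
module of projective dimension at most `1`. -/
class Gorenstein (A : Type u) [Ring A] [Finite A] : Prop where
  injDim : ∀ P : FGModuleCat.{u} A, Projective P → HasInjectiveDimensionLE P 1
  exists_embedding : ∀ M : FGModuleCat.{u} A,
    ∃ (K : FGModuleCat.{u} A) (f : M ⟶ K), Mono f ∧ projDimLEOne A K

theorem hasInjectiveDimensionLE_free (h : HasInjectiveDimensionLE (FGModuleCat.of A A) 1) (n : ℕ) :
    HasInjectiveDimensionLE (free A n) 1 := by
  have h := (hasInjectiveDimensionLT_iff _ _).1 h
  refine (hasInjectiveDimensionLT_iff _ _).2 ?_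
  intro i hi Y x
  let pr (j : Fin n) : free A n ⟶ FGModuleCat.of A A :=
    FGModuleCat.ofHom (LinearMap.proj (R := A) (φ := fun _ : Fin n => A) j)
  let inc (j : Fin n) : FGModuleCat.of A A ⟶ free A n :=
    FGModuleCat.ofHom (LinearMap.single A (fun _ : Fin n => A) j)
  have hid : 𝟙 (free A n) = ∑ j, pr j ≫ inc j := by
    refine ConcreteCategory.hom_ext _ _ fun v => ?_
    change v = (∑ j, pr j ≫ inc j).hom.hom v
    have : (∑ j, pr j ≫ inc j).hom.hom v = ∑ j, Pi.single j (v j) := by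
      let ev : (free A n ⟶ free A n) →+ (free A n) :=
        { toFun := fun f => f.hom.hom v, map_zero' := rfl, map_add' := fun _ _ => rfl }
      exact map_sum ev _ _
    rw [this]
    exact (Finset.univ_sum_single (M := fun _ : Fin n => A) v).symm
  rw [← x.comp_mk₀_id, hid, Ext.mk₀_sum, Ext.comp_sum]
  refine Finset.sum_eq_zero fun j _ => ?_
  rw [← Ext.mk₀_comp_mk₀, ← Ext.comp_assoc_of_third_deg_zero, h i hi (x.comp _ (add_zero i)),
    Ext.zero_comp]

theorem retract_free_of_projective (P : FGModuleCat.{u} A) [Projective P] :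
    ∃ n : ℕ, Nonempty (Retract P (free A n)) := by
  obtain ⟨n, f, hf⟩ := exists_free_epi P
  exact ⟨n, ⟨⟨Projective.factorThru (𝟙 P) f, f, Projective.factorThru_comp _ _⟩⟩⟩

/-- The dual of the module `A` has projective dimension at most one: the dual of its projective
cover is an injective coresolution of `A`, whose second term is injective by the bound on the
injective dimension. -/
theorem projDimLEOne_dual {p : ℕ} [Fact p.Prime] (hp : (p : A) = 0)
    (h : HasInjectiveDimensionLE (FGModuleCat.of Aᵐᵒᵖ A) 1) :
    projDimLEOne A (dual p (RingEquiv.opOp A) (FGModuleCat.of Aᵐᵒᵖ A)) := by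
  have hp' : (p : Aᵐᵒᵖ) = 0 := by rw [← MulOpposite.op_natCast, hp, MulOpposite.op_zero]
  let e : Aᵐᵒᵖ ≃+* Aᵐᵒᵖ := RingEquiv.refl _
  let e' : A ≃+* (Aᵐᵒᵖ)ᵐᵒᵖ := RingEquiv.opOp A
  let D := dual p e' (FGModuleCat.of Aᵐᵒᵖ A)
  obtain ⟨P, K, s, hP⟩ := exists_cover D
  obtain ⟨t⟩ := dualMap_shortExact p e hp s
  have h1 : HasInjectiveDimensionLT (dual p e D) 2 := by
    obtain ⟨φ, -⟩ := exists_eval (p := p) (e := e') (e' := e) hp' (fun _ => rfl)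
      (FGModuleCat.of Aᵐᵒᵖ A)
    exact hasInjectiveDimensionLT_of_iso φ 2
  have h2 : Injective (dual p e P) := injective_dual (e := e) (e' := e') hp (fun _ => rfl) hp' P
    fun _ => rfl
  have h3 : Injective (dual p e K) := by
    rw [injective_iff_hasInjectiveDimensionLT_one]
    exact t.ex.hasInjectiveDimensionLT_X₃ 1 (show HasInjectiveDimensionLT (dual p e P) 1 from
      inferInstance) h1
  have h4 : Projective K := projective_of_injective_dual (e := e) (e' := e') hp (fun _ => rfl) K
  exact s.ex.hasProjectiveDimensionLT_X₃ 1 (show HasProjectiveDimensionLT K 1 from inferInstance)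
    (show HasProjectiveDimensionLT P 2 from inferInstance)

/-- The product of `n` copies of a module. -/
noncomputable abbrev power (K : FGModuleCat.{u} A) (n : ℕ) : FGModuleCat.{u} A :=
  FGModuleCat.of A (Fin n → K)

theorem hasProjectiveDimensionLT_power (K : FGModuleCat.{u} A) (m : ℕ)
    (hK : HasProjectiveDimensionLT K m) (n : ℕ) : HasProjectiveDimensionLT (power K n) m := by
  rw [hasProjectiveDimensionLT_iff] at hK ⊢
  intro i hi Y x
  let pr (j : Fin n) : power K n ⟶ K :=
    FGModuleCat.ofHom (LinearMap.proj (R := A) (φ := fun _ : Fin n => K) j)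
  let inc (j : Fin n) : K ⟶ power K n :=
    FGModuleCat.ofHom (LinearMap.single A (fun _ : Fin n => K) j)
  have hid : 𝟙 (power K n) = ∑ j, pr j ≫ inc j := by
    refine ConcreteCategory.hom_ext _ _ fun v => ?_
    change v = (∑ j, pr j ≫ inc j).hom.hom v
    have : (∑ j, pr j ≫ inc j).hom.hom v = ∑ j, Pi.single j (v j) := by
      let ev : (power K n ⟶ power K n) →+ (power K n) :=
        { toFun := fun f => f.hom.hom v, map_zero' := rfl, map_add' := fun _ _ => rfl }
      exact map_sum ev _ _
    rw [this]
    exact (Finset.univ_sum_single (M := fun _ : Fin n => K) v).symm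
  rw [← x.mk₀_id_comp, hid, Ext.mk₀_sum, Ext.sum_comp]
  refine Finset.sum_eq_zero fun j _ => ?_
  rw [← Ext.mk₀_comp_mk₀_assoc, hK i hi ((Ext.mk₀ (inc j)).comp x (zero_add i)), Ext.comp_zero]

/-- A module embeds into a power of the dual of `A`, by its characters. -/
theorem exists_mono_power_dual {p : ℕ} [Fact p.Prime] (hp : (p : A) = 0) (M : FGModuleCat.{u} A) :
    ∃ (n : ℕ) (f : M ⟶ power (dual p (RingEquiv.opOp A) (FGModuleCat.of Aᵐᵒᵖ A)) n), Mono f := by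
  let e' : A ≃+* (Aᵐᵒᵖ)ᵐᵒᵖ := RingEquiv.opOp A
  let D := dual p e' (FGModuleCat.of Aᵐᵒᵖ A)
  have : Finite (M →+ ZMod p) := Finite.of_injective (fun f => (f : M → ZMod p))
    DFunLike.coe_injective
  obtain ⟨n, ⟨ι⟩⟩ := Finite.exists_equiv_fin (M →+ ZMod p)
  let c (j : Fin n) : M →ₗ[A] D :=
    { toFun := fun m => dual.mk p e' (M := FGModuleCat.of Aᵐᵒᵖ A)
        ((ι.symm j).comp ((LinearMap.toSpanSingleton A M m).toAddMonoidHom : A →+ M))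
      map_add' := fun m m' => by
        apply AddMonoidHom.ext
        intro a
        change ι.symm j (a • (m + m')) = ι.symm j (a • m) + ι.symm j (a • m')
        rw [smul_add, map_add]
      map_smul' := fun b m => by
        apply AddMonoidHom.ext
        intro a
        change ι.symm j (a • b • m) = ι.symm j ((a * b) • m)
        rw [mul_smul] }
  refine ⟨n, FGModuleCat.ofHom (LinearMap.pi c), (mono_iff_injective _).2 ?_⟩
  rw [injective_iff_map_eq_zero]
  intro m hm
  refine (bijective_eval_character p (char_nsmul (R := A) p hp)).1 ?_
  ext f
  have h1 : c (ι f) m = 0 := congrFun hm (ι f)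
  have h2 := DFunLike.congr_fun (F := A →+ ZMod p) h1 1
  change ι.symm (ι f) ((1 : A) • m) = 0 at h2
  rw [Equiv.symm_apply_apply, one_smul] at h2
  change f m = f 0
  rw [h2, map_zero]

/-- A finite `1`-Gorenstein algebra embeds every module into a power of the dual of `A`, which has
projective dimension at most one. -/
theorem gorenstein_of_isOneGorenstein (k : Type*) [Field k] [Finite k] [Algebra k A]
    (hA : IsOneGorenstein A) : Gorenstein A where
  injDim P _ := by
    obtain ⟨n, ⟨r⟩⟩ := retract_free_of_projective P
    have := hasInjectiveDimensionLE_free hA.1 n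
    exact r.hasInjectiveDimensionLT 2
  exists_embedding M := by
    obtain ⟨p, hc⟩ := CharP.exists k
    have : Fact p.Prime := ⟨CharP.char_is_prime k p⟩
    have hp : (p : A) = 0 := by
      rw [← map_natCast (algebraMap k A), CharP.cast_eq_zero, map_zero]
    obtain ⟨n, f, hf⟩ := exists_mono_power_dual hp M
    exact ⟨_, f, hf, hasProjectiveDimensionLT_power _ 2 (projDimLEOne_dual hp hA.2) n⟩

/-- The modules without extensions by projective modules. Over a Gorenstein ring, these are the
Gorenstein projective modules, see `gproj_iff`. -/
def ExtProj (G : FGModuleCat.{u} A) : Prop :=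
  ∀ Q : FGModuleCat.{u} A, Projective Q → Subsingleton (Ext G Q 1)

theorem ExtProj.of_projective (P : FGModuleCat.{u} A) [Projective P] : ExtProj P :=
  fun _ _ => inferInstance

theorem ExtProj.mid {M N L : FGModuleCat.{u} A} (s : SES M N L) (hN : ExtProj N) (hM : ExtProj M) :
    ExtProj L := fun Q hQ => by
  have := hN Q hQ
  have := hM Q hQ
  exact subsingleton_ext_mid s Q 1

theorem ExtProj.of_iso {M N : FGModuleCat.{u} A} (e : M ≅ N) (hM : ExtProj M) : ExtProj N :=
  fun Q hQ => by
    have := hM Q hQ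
    refine subsingleton_of_forall_eq 0 fun x => ?_
    rw [← x.mk₀_id_comp, ← e.inv_hom_id, ← Ext.mk₀_comp_mk₀_assoc,
      Subsingleton.elim ((Ext.mk₀ e.hom).comp x (zero_add 1)) 0, Ext.comp_zero]

theorem projDimLEOne_of_projective (P : FGModuleCat.{u} A) [Projective P] : projDimLEOne A P :=
  show HasProjectiveDimensionLT P 2 from inferInstance

theorem projDimLEOne_mid {M N L : FGModuleCat.{u} A} (s : SES M N L) (hN : projDimLEOne A N)
    (hM : projDimLEOne A M) : projDimLEOne A L :=
  s.ex.hasProjectiveDimensionLT_X₂ 2 hN hM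

theorem projDimLEOne.subsingleton_ext_two {K : FGModuleCat.{u} A} (hK : projDimLEOne A K)
    (X : FGModuleCat.{u} A) : Subsingleton (Ext K X 2) :=
  HasProjectiveDimensionLT.subsingleton (hX := hK) K 2 2 le_rfl X

/-- A projective resolution of length one. -/
theorem projDimLEOne.exists_resolution {K : FGModuleCat.{u} A} (hK : projDimLEOne A K) :
    ∃ (P₀ P₁ : FGModuleCat.{u} A) (_ : SES K P₁ P₀), Projective P₀ ∧ Projective P₁ := by
  obtain ⟨P₀, P₁, s, hP⟩ := exists_cover K
  refine ⟨P₀, P₁, s, hP, ?_⟩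
  rw [projective_iff_hasProjectiveDimensionLT_one]
  exact s.ex.hasProjectiveDimensionLT_X₁ 1 (show HasProjectiveDimensionLT P₀ 1 from inferInstance) hK

/-- A Gorenstein projective module of finite projective dimension is projective. -/
theorem projective_of_extProj {E : FGModuleCat.{u} A} (hE : projDimLEOne A E) (hE' : ExtProj E) :
    Projective E := by
  obtain ⟨P₀, P₁, s, hP₀, hP₁⟩ := hE.exists_resolution
  have := hE' P₁ hP₁
  obtain ⟨e⟩ := s.iso_biprod_of_subsingleton
  exact Retract.projective ⟨biprod.inr ≫ e.inv, e.hom ≫ biprod.snd, by simp⟩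

section Gorenstein
variable [Gorenstein A]

instance subsingleton_ext_two_projective (M P : FGModuleCat.{u} A) [Projective P] :
    Subsingleton (Ext M P 2) :=
  HasInjectiveDimensionLT.subsingleton (hX := Gorenstein.injDim P inferInstance) P 2 2 le_rfl M

theorem ExtProj.sub {M N L : FGModuleCat.{u} A} (s : SES M N L) (hL : ExtProj L) : ExtProj N :=
  fun Q hQ => by
    have := hL Q hQ
    have : Subsingleton (Ext M Q 2) := subsingleton_ext_two_projective M Q
    exact subsingleton_ext_sub s Q (m := 2) (n := 1) rfl

theorem ExtProj.of_mono {G L : FGModuleCat.{u} A} (f : G ⟶ L) [Mono f] (hL : ExtProj L) :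
    ExtProj G := hL.sub (SES.ofMono f)

/-- Every module `M` is the quotient of a Gorenstein projective module by a projective one, the
pullback of an embedding of `M` into a module `K` of finite projective dimension along a
projective cover of `K`. -/
theorem exists_gorenstein_resolution (M : FGModuleCat.{u} A) :
    ∃ (P G Q : FGModuleCat.{u} A) (_ : SES M P G) (f : G ⟶ Q),
      Projective P ∧ ExtProj G ∧ Projective Q ∧ Mono f := by
  obtain ⟨K, f, hf, hK⟩ := Gorenstein.exists_embedding M
  obtain ⟨P₀, P₁, s, hP₀, hP₁⟩ := hK.exists_resolution
  obtain ⟨G, t, g, -, h, -⟩ := s.exists_pullback f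
  have : Mono g := (MorphismProperty.monomorphisms _).of_isPullback h.flip hf
  exact ⟨P₁, G, P₀, t, g, hP₁, (ExtProj.of_projective P₀).of_mono g, hP₀, this⟩

/-- A Gorenstein projective module embeds into a projective module with Gorenstein projective
cokernel. -/
theorem ExtProj.exists_coresolution {G : FGModuleCat.{u} A} (hG : ExtProj G) :
    ∃ (P G' : FGModuleCat.{u} A) (_ : SES G' G P), Projective P ∧ ExtProj G' := by
  obtain ⟨P, H, Q, s, f, hP, hH, hQ, hf⟩ := exists_gorenstein_resolution G
  have := hG P hP
  obtain ⟨e⟩ := s.iso_biprod_of_subsingleton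
  -- The resolution of `G` splits, so that `G` is a submodule of the projective module `Q`.
  let j : G ⟶ Q := biprod.inr ≫ e.inv ≫ f
  have : Mono j := inferInstance
  obtain ⟨P', G', -, t, -, hP', hG', -⟩ := exists_gorenstein_resolution (cokernel j)
  -- `X` is an extension of `G'` by `G`, and of `Q` by the projective module `P'`.
  obtain ⟨X, r, g, -, h, -⟩ := (SES.ofMono j).exists_pullback t.p
  obtain ⟨r', -⟩ := t.of_isPullback h.flip
  obtain ⟨e'⟩ := r'.iso_biprod_of_subsingleton
  exact ⟨X, G', r, Projective.of_iso e'.symm inferInstance, hG'⟩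

/-- A relation that can be continued in both directions is realized by a sequence indexed by `ℤ`. -/
theorem exists_int_seq {α : Type*} (R : α → α → Prop) (h₁ : ∀ x, ∃ y, R x y) (h₂ : ∀ y, ∃ x, R x y)
    (x₀ : α) : ∃ s : ℤ → α, s 0 = x₀ ∧ ∀ n, R (s n) (s (n + 1)) := by
  choose f hf using h₁
  choose g hg using h₂
  refine ⟨fun n => match n with
    | Int.ofNat m => f^[m] x₀
    | Int.negSucc m => g^[m + 1] x₀, rfl, fun n => ?_⟩
  match n with
  | Int.ofNat m =>
    have : R (f^[m] x₀) (f^[m + 1] x₀) := by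
      rw [Function.iterate_succ_apply']
      exact hf _
    exact this
  | Int.negSucc 0 => exact hg x₀
  | Int.negSucc (m + 1) =>
    have : R (g^[m + 1 + 1] x₀) (g^[m + 1] x₀) := by
      rw [Function.iterate_succ_apply' g (m + 1)]
      exact hg _
    exact this

/-- Short exact sequences splice to exact sequences. -/
theorem exact_of_ses {M₁ M₂ M₃ P₁ P₂ P₃ N : FGModuleCat.{u} A} (s₁ : SES M₁ N P₁)
    (s₂ : SES M₂ M₁ P₂) (s₃ : SES M₃ M₂ P₃) (w : (s₁.p ≫ s₂.i) ≫ s₂.p ≫ s₃.i = 0) :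
    (ShortComplex.mk (s₁.p ≫ s₂.i) (s₂.p ≫ s₃.i) w).Exact := by
  let φ : ShortComplex.mk (s₁.p ≫ s₂.i) s₂.p (by simp) ⟶ ShortComplex.mk s₂.i s₂.p s₂.w :=
    { τ₁ := s₁.p, τ₂ := 𝟙 _, τ₃ := 𝟙 _ }
  let ψ : ShortComplex.mk (s₁.p ≫ s₂.i) s₂.p (by simp) ⟶
      ShortComplex.mk (s₁.p ≫ s₂.i) (s₂.p ≫ s₃.i) w :=
    { τ₁ := 𝟙 _, τ₂ := 𝟙 _, τ₃ := s₃.i }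
  have : Epi φ.τ₁ := s₁.epi_p
  have : IsIso φ.τ₂ := inferInstanceAs (IsIso (𝟙 _))
  have : Mono φ.τ₃ := inferInstanceAs (Mono (𝟙 _))
  have : Epi ψ.τ₁ := inferInstanceAs (Epi (𝟙 _))
  have : IsIso ψ.τ₂ := inferInstanceAs (IsIso (𝟙 _))
  have : Mono ψ.τ₃ := s₃.mono_i
  exact (ShortComplex.exact_iff_of_epi_of_isIso_of_mono ψ).1
    ((ShortComplex.exact_iff_of_epi_of_isIso_of_mono φ).2 s₂.ex.exact)

/-- Splicing coresolutions to the right and projective resolutions to the left gives a complete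
resolution; it stays exact under `Hom(-, A)` because its cocycles have no extensions by `A`. -/
theorem ExtProj.gproj {G : FGModuleCat.{u} A} (hG : ExtProj G) : gproj A G := by
  obtain ⟨M, hM₀, hM⟩ := exists_int_seq
    (fun x y : {G : FGModuleCat.{u} A // ExtProj G} =>
      ∃ P : FGModuleCat.{u} A, Projective P ∧ Nonempty (SES y.1 x.1 P))
    (fun x => by
      obtain ⟨P, G', s, hP, hG'⟩ := x.2.exists_coresolution
      exact ⟨⟨G', hG'⟩, P, hP, ⟨s⟩⟩)
    (fun y => by
      obtain ⟨P, K, s, hP⟩ := exists_cover y.1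
      exact ⟨⟨K, (ExtProj.of_projective P).sub s⟩, P, hP, ⟨s⟩⟩) ⟨G, hG⟩
  choose P hP hs using hM
  let s (n : ℤ) : SES (M (n + 1)).1 (M n).1 (P n) := (hs n).some
  have hd (n : ℤ) : ((s n).p ≫ (s (n + 1)).i) ≫ (s (n + 1)).p ≫ (s (n + 1 + 1)).i = 0 := by simp
  let C : CochainComplex (FGModuleCat.{u} A) ℤ :=
    CochainComplex.of P (fun n => (s n).p ≫ (s (n + 1)).i) hd
  have hC (n : ℤ) : C.d n (n + 1) = (s n).p ≫ (s (n + 1)).i :=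
    CochainComplex.of_d P (fun n => (s n).p ≫ (s (n + 1)).i) n
  refine ⟨C, ⟨hP, fun n => ?_, ?_⟩, ?_⟩
  · obtain ⟨m, rfl⟩ : ∃ m, n = m + 1 := ⟨n - 1, by ring⟩
    rw [HomologicalComplex.exactAt_iff' C m (m + 1) (m + 1 + 1) (by simp) (by simp)]
    have h := exact_of_ses (s m) (s (m + 1)) (s (m + 1 + 1)) (hd m)
    let e : ShortComplex.mk _ _ (hd m) ≅ HomologicalComplex.sc' C m (m + 1) (m + 1 + 1) :=
      ShortComplex.isoMk (Iso.refl (P m)) (Iso.refl (P (m + 1))) (Iso.refl (P (m + 1 + 1)))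
        (((Category.id_comp _).trans (hC m)).trans (Category.comp_id _).symm)
        (((Category.id_comp _).trans (hC (m + 1))).trans (Category.comp_id _).symm)
    exact (ShortComplex.exact_iff_of_iso e).1 h
  · rintro l m n rfl rfl f hf
    rw [hC, Category.assoc] at hf
    have hf' : (s (l + 1)).i ≫ f = 0 := by
      rw [← cancel_epi (s l).p, hf, comp_zero]
    have := (M (l + 1 + 1 + 1)).2 (FGModuleCat.of A A) (projective_of_module _)
    obtain ⟨g, hg⟩ := (s (l + 1 + 1)).exists_extend ((s (l + 1)).ex.exact.desc f hf')
    refine ⟨g, ?_⟩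
    rw [hC, Category.assoc, hg]
    exact (s (l + 1)).ex.exact.g_desc f hf'
  · have h0 : (s 0).i ≫ C.d 0 1 = 0 := by
      rw [show C.d 0 1 = _ from hC 0, (s 0).w_assoc]
    have hk : IsLimit (KernelFork.ofι (s 0).i h0) := by
      refine KernelFork.IsLimit.ofι' (s 0).i h0 fun {Z} k hk => ?_
      have hk' : k ≫ (s 0).p = 0 := by
        rw [← cancel_mono (s (0 + 1)).i, zero_comp, Category.assoc]
        rwa [show C.d 0 1 = _ from hC 0] at hk
      exact ⟨(s 0).ex.exact.lift k hk', (s 0).ex.exact.lift_f k hk'⟩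
    have e : (M 0).1 ≅ kernel (C.d 0 1) :=
      hk.conePointUniqueUpToIso (limit.isLimit _)
    rw [hM₀] at e
    exact ⟨e⟩

/-- Over a Gorenstein ring, the Gorenstein projective modules are the modules without extensions
by projective modules. -/
theorem gproj_iff {G : FGModuleCat.{u} A} : gproj A G ↔ ExtProj G := by
  refine ⟨?_, ExtProj.gproj⟩
  rintro ⟨P, hP, ⟨e⟩⟩
  have := hP.projective 0
  exact (ExtProj.of_mono (kernel.ι (P.d 0 1)) (ExtProj.of_projective (P.X 0))).of_iso e.symm

instance gproj_containsZero : (gproj A).ContainsZero where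
  exists_zero := by
    obtain ⟨Z, hZ⟩ := HasZeroObject.zero (C := FGModuleCat.{u} A)
    have : Projective Z := hZ.projective
    exact ⟨Z, hZ, gproj_iff.2 (ExtProj.of_projective Z)⟩

instance gproj_isClosedUnderExtensions : (gproj A).IsClosedUnderExtensions where
  prop_X₂_of_shortExact {S} hS h₁ h₃ := gproj_iff.2 <|
    ExtProj.mid ⟨S.f, S.g, S.zero, hS⟩ (gproj_iff.1 h₁) (gproj_iff.1 h₃)

theorem gproj_of_projective (P : FGModuleCat.{u} A) [Projective P] : gproj A P :=
  gproj_iff.2 (ExtProj.of_projective P)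

/-- The projective-injective objects of the category of Gorenstein projective modules are the
projective modules. -/
theorem projective_of_isExactProjective {P : FGModuleCat.{u} A} (hP : gproj A P)
    (h : IsExactProjective (gproj A) P) : Projective P := by
  obtain ⟨Q, K, s, hQ⟩ := exists_cover P
  obtain ⟨g, hg⟩ := h _ s.ex (gproj_iff.2 ((ExtProj.of_projective Q).sub s))
    (gproj_of_projective Q) hP (𝟙 P)
  exact Retract.projective ⟨g, s.p, hg⟩

theorem isExactProjective_of_projective (P : FGModuleCat.{u} A) [Projective P] :
    IsExactProjective (gproj A) P := fun S hS _ _ _ f => by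
  have := hS.epi_g
  exact ⟨Projective.factorThru f S.g, Projective.factorThru_comp _ _⟩

theorem isExactInjective_of_projective (P : FGModuleCat.{u} A) [Projective P] :
    IsExactInjective (gproj A) P := fun S hS _ _ h₃ f => by
  have := gproj_iff.1 h₃ P inferInstance
  exact SES.exists_extend ⟨S.f, S.g, S.zero, hS⟩ f

end Gorenstein


/-! ### Universal localizations -/

section Loc
variable {R B : Type*} [Ring R] [Algebra ℚ R] [Ring B] [Algebra ℚ B] {S : Set R}

/-- The universal property of `Loc S`. -/
noncomputable def Loc.lift (f : R →ₐ[ℚ] B) (hf : ∀ s ∈ S, IsUnit (f s)) : Loc S →ₐ[ℚ] B :=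
  RingQuot.liftAlgHom ℚ ⟨FreeAlgebra.lift ℚ (Sum.elim f fun s : S => Ring.inverse (f s)), by
    intro x y h
    induction h with
    | add a b => simp
    | mul a b => simp
    | scalar r => simp
    | mul_inv s => simpa using Ring.mul_inverse_cancel _ (hf s s.2)
    | inv_mul s => simpa using Ring.inverse_mul_cancel _ (hf s s.2)⟩

@[simp]
theorem Loc.lift_toLoc (f : R →ₐ[ℚ] B) (hf : ∀ s ∈ S, IsUnit (f s)) (a : R) :
    Loc.lift f hf (toLoc S a) = f a := by
  change RingQuot.liftAlgHom ℚ _ (RingQuot.mkAlgHom ℚ _ _) = _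
  rw [RingQuot.liftAlgHom_mkAlgHom_apply, FreeAlgebra.lift_ι_apply, Sum.elim_inl]

theorem Loc.hom_ext {f g : Loc S →ₐ[ℚ] B} (h : ∀ a, f (toLoc S a) = g (toLoc S a)) : f = g := by
  apply RingQuot.ringQuot_ext'
  apply FreeAlgebra.hom_ext
  ext x
  obtain a | s := x
  · exact h a
  · let y : Loc S := RingQuot.mkAlgHom ℚ (LocRel S) (FreeAlgebra.ι ℚ (Sum.inr s))
    have h1 : y * toLoc S s = 1 := by
      have := RingQuot.mkAlgHom_rel ℚ (LocRel.inv_mul s)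
      rwa [map_mul, map_one] at this
    have h2 : toLoc S s * y = 1 := by
      have := RingQuot.mkAlgHom_rel ℚ (LocRel.mul_inv s)
      rwa [map_mul, map_one] at this
    change f y = g y
    refine left_inv_eq_right_inv (a := f (toLoc S s)) ?_ ?_
    · rw [← map_mul, h1, map_one]
    · rw [h s, ← map_mul, h2, map_one]

end Loc

/-! ### Hall products with vanishing extensions -/

/-- A composition of two epimorphisms has kernel an extension of their kernels. -/
theorem SES.exists_comp {M N L Q G : FGModuleCat.{u} A} (s : SES M N L) (t : SES L Q G) :
    ∃ (E : FGModuleCat.{u} A) (_ : SES N Q E), Nonempty (SES M E G) := by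
  have : Epi (t.p ≫ s.p) := inferInstance
  let E := kernel (t.p ≫ s.p)
  have hk : (kernel.ι (t.p ≫ s.p) ≫ t.p) ≫ s.p = 0 := by
    rw [Category.assoc, kernel.condition]
  let l : E ⟶ N := s.ex.exact.lift (kernel.ι (t.p ≫ s.p) ≫ t.p) hk
  have hl : l ≫ s.i = kernel.ι (t.p ≫ s.p) ≫ t.p := s.ex.exact.lift_f _ hk
  have hp : IsPullback (kernel.ι (t.p ≫ s.p)) l t.p s.i := by
    refine ⟨⟨hl.symm⟩, ⟨PullbackCone.IsLimit.mk _ (fun c => kernel.lift _ c.fst ?_) (fun c => ?_)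
      (fun c => ?_) (fun c m hm _ => ?_)⟩⟩
    · rw [← Category.assoc, c.condition, Category.assoc, s.w, comp_zero]
    · simp
    · rw [← cancel_mono s.i, Category.assoc, hl, kernel.lift_ι_assoc, c.condition]
    · rw [← cancel_mono (kernel.ι (t.p ≫ s.p)), hm, kernel.lift_ι]
  obtain ⟨a, -⟩ := t.of_isPullback hp
  exact ⟨E, a, ⟨SES.ofEpi (t.p ≫ s.p)⟩⟩

/-- Averages over the target of a surjective homomorphism can be computed on its source, all fibres
having the same size. -/
theorem sum_comp_surjective {α β V : Type*} [AddCommGroup α] [AddCommGroup β] [Fintype α]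
    [Fintype β] [AddCommGroup V] [Module ℚ V] (f : α →+ β) (hf : Function.Surjective f)
    (F : β → V) :
    (Nat.card β : ℚ)⁻¹ • ∑ b, F b = (Nat.card α : ℚ)⁻¹ • ∑ a, F (f a) := by
  classical
  have h1 : ∑ a, F (f a) = ∑ b, (Nat.card f.ker : ℚ) • F b := by
    rw [← Finset.sum_fiberwise Finset.univ f]
    refine Finset.sum_congr rfl fun b _ => ?_
    rw [Finset.sum_congr rfl fun a ha => by rw [(Finset.mem_filter.1 ha).2], Finset.sum_const,
      ← Nat.cast_smul_eq_nsmul ℚ]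
    congr 2
    obtain ⟨a₀, rfl⟩ := hf b
    rw [← Fintype.card_subtype, ← Nat.card_eq_fintype_card]
    exact Nat.card_congr
      { toFun := fun x => ⟨x.1 - a₀, by rw [AddMonoidHom.mem_ker, map_sub, x.2, sub_self]⟩
        invFun := fun x => ⟨x.1 + a₀, by rw [map_add, AddMonoidHom.mem_ker.1 x.2, zero_add]⟩
        left_inv := fun x => by simp
        right_inv := fun x => by simp }
  have h2 : (Nat.card α : ℚ) = Nat.card f.ker * Nat.card β := by
    rw [card_eq_ker_mul_range f, AddMonoidHom.range_eq_top.2 hf]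
    push_cast
    congr 2
    exact Nat.card_congr AddSubgroup.topEquiv.toEquiv
  have h3 : (Nat.card f.ker : ℚ) ≠ 0 := by exact_mod_cast Nat.card_pos.ne'
  rw [h1, ← Finset.smul_sum, smul_smul, h2, mul_inv, mul_comm (_)⁻¹, mul_assoc,
    inv_mul_cancel₀ h3, mul_one]

section Split
variable {E : ObjectProperty (FGModuleCat.{u} A)} [E.IsClosedUnderExtensions] [E.ContainsZero]

/-- When all extensions split, the Hall product is a multiple of the class of the direct sum. -/
theorem HallAlg.cl_biprod {M N : FGModuleCat.{u} A} (hM : E M) (hN : E N)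
    [Subsingleton (Ext M N 1)] :
    HallAlg.cl E (N ⊞ M) = ef M N • (HallAlg.cl E M * HallAlg.cl E N) := by
  have e (x : Ext M N 1) : HallAlg.cl E (mid x) = HallAlg.cl E (N ⊞ M) := by
    obtain ⟨φ⟩ := (midSES x).iso_biprod_of_subsingleton
    exact HallAlg.cl_congr (mid_mem hM hN x) ((E.prop_X₂_of_shortExact (SES.split N M).ex hN hM)) φ
  rw [HallAlg.cl_mul_cl hM hN, Finset.sum_congr rfl fun x _ => e x, Finset.sum_const,
    Finset.card_univ, ← Nat.card_eq_fintype_card, Nat.card_of_subsingleton (0 : Ext M N 1), one_smul,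
    ef_of_subsingleton, smul_smul, mul_inv_cancel₀ (card_hom_ne M N), one_smul]

end Split

/-! ### The map from the modified to the semi-derived Hall algebra -/

section SemiDerived
variable [Gorenstein A]

/-- The class of a Gorenstein projective module in the semi-derived Hall algebra. -/
noncomputable def gcl (G : FGModuleCat.{u} A) : SemiDerivedHall (gproj A) :=
  toLoc (projInjClasses (gproj A)) (HallAlg.cl (gproj A) G)

theorem gcl_congr {G G' : FGModuleCat.{u} A} (hG : ExtProj G) (e : G ≅ G') : gcl G = gcl G' := by
  rw [gcl, gcl, HallAlg.cl_congr (gproj_iff.2 hG) (gproj_iff.2 (hG.of_iso e)) e]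

theorem isUnit_gcl (P : FGModuleCat.{u} A) [Projective P] : IsUnit (gcl P) := by
  refine isUnit_toLoc _ ⟨P, gproj_of_projective P, isExactProjective_of_projective P,
    isExactInjective_of_projective P, ?_⟩
  rw [HallAlg.cl_eq]

theorem gcl_mul {G G' : FGModuleCat.{u} A} (hG : ExtProj G) (hG' : ExtProj G') :
    gcl G * gcl G' = (Nat.card (G ⟶ G') : ℚ)⁻¹ • ∑ e : Ext G G' 1, gcl (mid e) := by
  rw [gcl, gcl, ← map_mul, HallAlg.cl_mul_cl (gproj_iff.2 hG) (gproj_iff.2 hG'), map_smul, map_sum]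
  rfl

theorem gcl_mid {G G' L : FGModuleCat.{u} A} (s : SES G G' L) (hG : ExtProj G) (hG' : ExtProj G')
    [Subsingleton (Ext G G' 1)] : gcl L = ef G G' • (gcl G * gcl G') := by
  obtain ⟨e⟩ := s.iso_biprod_of_subsingleton
  rw [gcl_congr (hG'.mid s hG) e, gcl, HallAlg.cl_biprod (gproj_iff.2 hG) (gproj_iff.2 hG'),
    map_smul, map_mul]
  rfl

theorem gcl_zero {Z : FGModuleCat.{u} A} (hZ : IsZero Z) : gcl Z = 1 := by
  have : Projective Z := hZ.projective
  rw [gcl, ← HallAlg.one_eq (gproj_of_projective Z) hZ, map_one]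

/-- The class of a module `M` in the semi-derived Hall algebra of the Gorenstein projective
modules, `⟨M, P⟩⁻¹ [G] [P]⁻¹` for a chosen resolution `0 → P → G → M → 0`. -/
noncomputable def resCl (M : FGModuleCat.{u} A) : SemiDerivedHall (gproj A) :=
  (ef M (exists_gorenstein_resolution M).choose)⁻¹ •
    (gcl (exists_gorenstein_resolution M).choose_spec.choose *
      Ring.inverse (gcl (exists_gorenstein_resolution M).choose))

/-- The pullback of two resolutions is an extension of `G'` by `P` and of `G` by `P'`, and both
extensions split. -/
theorem gcl_mul_comm_of_resolutions {M P G P' G' : FGModuleCat.{u} A} (s : SES M P G)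
    (s' : SES M P' G') [Projective P] [Projective P'] (hG : ExtProj G) (hG' : ExtProj G') :
    (ef G' P) • (gcl G' * gcl P) = (ef G P') • (gcl G * gcl P') := by
  obtain ⟨X, t, g, -, h, -⟩ := s.exists_pullback s'.p
  obtain ⟨t', -⟩ := s'.of_isPullback h.flip
  have := hG P' inferInstance
  have := hG' P inferInstance
  rw [← gcl_mid t hG' (.of_projective P), ← gcl_mid t' hG (.of_projective P')]

theorem gcl_mul_comm_projective (P P' : FGModuleCat.{u} A) [Projective P] [Projective P'] :
    ef P P' • (gcl P * gcl P') = ef P' P • (gcl P' * gcl P) := by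
  rw [← gcl_mid (SES.split P' P) (.of_projective P) (.of_projective P'),
    ← gcl_mid (SES.split P P') (.of_projective P') (.of_projective P)]
  exact gcl_congr (.of_projective _) (biprod.braiding _ _)

theorem exists_resCl_eq (M : FGModuleCat.{u} A) :
    ∃ (P G : FGModuleCat.{u} A) (_ : SES M P G), Projective P ∧ ExtProj G ∧
      resCl M = (ef M P)⁻¹ • (gcl G * Ring.inverse (gcl P)) := by
  obtain ⟨s, f, hP, hG, -⟩ := (exists_gorenstein_resolution M).choose_spec.choose_spec.choose_spec
  exact ⟨_, _, s, hP, hG, rfl⟩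

/-- The class `resCl M` can be computed with any resolution. -/
theorem resCl_mul {M P G : FGModuleCat.{u} A} (s : SES M P G) [Projective P] (hG : ExtProj G) :
    resCl M * gcl P = (ef M P)⁻¹ • gcl G := by
  obtain ⟨P', G', s', hP', hG', e⟩ := exists_resCl_eq M
  rw [e]
  have h1 := gcl_mul_comm_of_resolutions s s' hG hG'
  have h2 := gcl_mul_comm_projective P P'
  have e1 : ef G' P = ef P' P * ef M P := ef_left s' P
  have e2 : ef G P' = ef P P' * ef M P' := ef_left s P'
  have n1 := ef_ne P P'
  have n2 := ef_ne P' P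
  have n3 := ef_ne M P
  have n4 := ef_ne M P'
  have h3 : gcl P * gcl P' = ((ef P P')⁻¹ * ef P' P) • (gcl P' * gcl P) := by
    rw [mul_smul, ← h2, smul_smul, inv_mul_cancel₀ n1, one_smul]
  have h4 : gcl G' * gcl P = ((ef P' P * ef M P)⁻¹ * (ef P P' * ef M P')) • (gcl G * gcl P') := by
    rw [mul_smul, ← e2, ← h1, smul_smul, ← e1, inv_mul_cancel₀ (ef_ne _ _), one_smul]
  rw [← (isUnit_gcl P').mul_left_inj, mul_assoc, h3, smul_mul_assoc, mul_smul_comm, mul_assoc,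
    ← mul_assoc (Ring.inverse _), Ring.inverse_mul_cancel _ (isUnit_gcl P'), one_mul, h4, smul_smul,
    smul_smul, smul_mul_assoc]
  congr 1
  field_simp

theorem resCl_eq_gcl {G : FGModuleCat.{u} A} (hG : ExtProj G) : resCl G = gcl G := by
  obtain ⟨Z, hZ⟩ := HasZeroObject.zero (C := FGModuleCat.{u} A)
  have : Projective Z := hZ.projective
  have e : Z ⊞ G ≅ G := by
    refine ⟨biprod.snd, biprod.inr, ?_, by simp⟩
    exact biprod.hom_ext' _ _ (hZ.eq_of_src _ _) (by simp)
  have h := resCl_mul ((SES.split Z G).congrMid e) hG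
  have := hG Z inferInstance
  have : Subsingleton (G ⟶ Z) := ⟨hZ.eq_of_tgt⟩
  rw [gcl_zero hZ, mul_one, ef_of_subsingleton, Nat.card_of_subsingleton (0 : G ⟶ Z), Nat.cast_one,
    inv_one, one_smul] at h
  exact h

theorem resCl_congr {M N : FGModuleCat.{u} A} (e : M ≅ N) : resCl M = resCl N := by
  obtain ⟨P, G, Q, s, f, hP, hG, -⟩ := exists_gorenstein_resolution M
  rw [← (isUnit_gcl P).mul_left_inj, resCl_mul s hG, resCl_mul (s.congrRight e) hG,
    ef_congr_left e]

/-- Extensions by a module of finite projective dimension multiply, up to the Euler form. -/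
theorem resCl_mid {M K L : FGModuleCat.{u} A} (s : SES M K L) (hK : projDimLEOne A K) :
    resCl L = ef M K • (resCl M * resCl K) := by
  obtain ⟨Q, G, -, t, -, hQ, hG, -⟩ := exists_gorenstein_resolution L
  obtain ⟨E, a, ⟨b⟩⟩ := s.exists_comp t
  -- The kernel `E` of `G → M` is Gorenstein projective and of finite projective dimension.
  have : Projective E :=
    projective_of_extProj (projDimLEOne_mid a (projDimLEOne_of_projective Q) hK) (hG.sub b)
  have hE : ExtProj E := .of_projective E
  rw [← (isUnit_gcl Q).mul_left_inj, smul_mul_assoc, mul_assoc, resCl_mul t hG, resCl_mul a hE,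
    mul_smul_comm, resCl_mul b hG, smul_smul, smul_smul, ef_right a M, ef_left s Q]
  congr 1
  have := ef_ne M Q
  have := ef_ne M K
  have := ef_ne K Q
  field_simp

theorem isUnit_rat_smul {B : Type*} [Ring B] [Algebra ℚ B] {c : ℚ} (hc : c ≠ 0) {x : B}
    (hx : IsUnit x) : IsUnit (c • x) := by
  rw [Algebra.smul_def]
  exact (hc.isUnit.map (algebraMap ℚ B)).mul hx

theorem isUnit_resCl {K : FGModuleCat.{u} A} (hK : projDimLEOne A K) : IsUnit (resCl K) := by
  obtain ⟨P₀, P₁, s, hP₀, hP₁⟩ := hK.exists_resolution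
  have h := resCl_mul s (.of_projective P₀)
  have h' : resCl K = (ef K P₁)⁻¹ • (gcl P₀ * Ring.inverse (gcl P₁)) := by
    rw [← (isUnit_gcl P₁).mul_left_inj, h, smul_mul_assoc, mul_assoc,
      Ring.inverse_mul_cancel _ (isUnit_gcl P₁), mul_one]
  rw [h']
  exact isUnit_rat_smul (inv_ne_zero (ef_ne _ _)) ((isUnit_gcl P₀).mul (isUnit_gcl P₁).ringInverse)

/-- The kernel of a morphism of extensions of `M` is the kernel of its restriction `G ⟶ N`. -/
theorem SES.of_epi {M N L G X P : FGModuleCat.{u} A} (t : SES M N L) (s : SES M G X)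
    (r : SES N P G) {g : X ⟶ L} (h₁ : s.i ≫ g = r.p ≫ t.i) (h₂ : g ≫ t.p = s.p) :
    Nonempty (SES L P X) := by
  have w : (r.i ≫ s.i) ≫ g = 0 := by rw [Category.assoc, h₁, r.w_assoc]
  refine ⟨⟨r.i ≫ s.i, g, w, (shortExact_iff _).2 ⟨?_, ?_, ?_⟩⟩⟩
  · exact (mono_iff_injective (r.i ≫ s.i)).1 inferInstance
  all_goals
    obtain ⟨t1, t2, t3⟩ := (shortExact_iff _).1 t.ex
    obtain ⟨s1, s2, s3⟩ := (shortExact_iff _).1 s.ex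
    obtain ⟨r1, r2, r3⟩ := (shortExact_iff _).1 r.ex
    have h₁' (x : G) : g.hom.hom (s.i.hom.hom x) = t.i.hom.hom (r.p.hom.hom x) :=
      ConcreteCategory.congr_hom h₁ x
    have h₂' (x : X) : t.p.hom.hom (g.hom.hom x) = s.p.hom.hom x := ConcreteCategory.congr_hom h₂ x
  · intro y
    obtain ⟨x, hx⟩ := s2 (t.p.hom.hom y)
    obtain ⟨n, hn⟩ := (t3 (y - g.hom.hom x)).1 (by
      change t.p.hom.hom (y - g.hom.hom x) = 0
      rw [map_sub, h₂', sub_eq_zero]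
      exact hx.symm)
    obtain ⟨z, rfl⟩ := r2 n
    refine ⟨x + s.i.hom.hom z, ?_⟩
    change g.hom.hom (x + s.i.hom.hom z) = y
    rw [map_add, h₁']
    rw [show t.i.hom.hom (r.p.hom.hom z) = _ from hn, add_sub_cancel]
  · intro x
    constructor
    · intro hx
      obtain ⟨y, hy⟩ := (s3 x).1 (by
        change s.p.hom.hom x = 0
        rw [← h₂', show g.hom.hom x = 0 from hx, map_zero])
      obtain ⟨z, hz⟩ := (r3 y).1 (t1 (by
        change t.i.hom.hom (r.p.hom.hom y) = t.i.hom.hom 0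
        rw [← h₁', show s.i.hom.hom y = x from hy, map_zero]
        exact hx))
      refine ⟨z, ?_⟩
      change s.i.hom.hom (r.i.hom.hom z) = x
      rw [show r.i.hom.hom z = y from hz]
      exact hy
    · rintro ⟨z, rfl⟩
      exact ConcreteCategory.congr_hom w z

/-- Multiplicativity of `resCl` with a Gorenstein projective module on the left: an extension of
`G'` by `N` lifts to one by the resolution of `N`, which is a resolution of the extension. -/
theorem resCl_mul_of_extProj {G' : FGModuleCat.{u} A} (hG' : ExtProj G') (N : FGModuleCat.{u} A) :
    resCl G' * resCl N = (Nat.card (G' ⟶ N) : ℚ)⁻¹ • ∑ e : Ext G' N 1, resCl (mid e) := by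
  obtain ⟨P, G, -, s, -, hP, hG, -⟩ := exists_gorenstein_resolution N
  have := hG' P hP
  let f : Ext G' G 1 →+ Ext G' N 1 := (Ext.mk₀ s.p).postcomp G' (add_zero 1)
  have hf : Function.Surjective f := fun x => by
    obtain ⟨y, hy⟩ := Ext.covariant_sequence_exact₃ G' s.ex x (n₁ := 2) rfl
      (Subsingleton.elim _ _)
    exact ⟨y, hy⟩
  have hmid (x : Ext G' G 1) : (ef N P * ef G' P) • (resCl (mid (f x)) * gcl P) = gcl (mid x) := by
    obtain ⟨L, t, g, h1, h2, h3⟩ := (midSES x).exists_pushout s.p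
    obtain ⟨φ, -⟩ := t.exists_iso_of_ext_eq (midSES (f x))
      (by rw [h3, midSES_ext, midSES_ext]; rfl)
    obtain ⟨r⟩ := t.of_epi (midSES x) s h1 h2
    rw [resCl_mul (r.congrRight φ) (hG.mid (midSES x) hG'), ef_left (midSES (f x)) P, smul_smul,
      mul_inv_cancel₀ (mul_ne_zero (ef_ne _ _) (ef_ne _ _)), one_smul]
  have hc : ef G' G = ef G' P * ef G' N := ef_right s G'
  have hs := sum_comp_surjective f hf (fun e => resCl (mid e) * gcl P)
  have c1 := ef_ne N P
  have c2 := ef_ne G' P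
  have c3 := card_hom_ne G' N
  have c4 := card_hom_ne G' G
  have c5 := card_ext_ne G' N
  have c6 := card_ext_ne G' G
  have hs' : ∑ e : Ext G' N 1, resCl (mid e) * gcl P = ((Nat.card (Ext G' N 1) : ℚ) *
      (Nat.card (Ext G' G 1) : ℚ)⁻¹ * (ef N P * ef G' P)⁻¹) • ∑ x : Ext G' G 1, gcl (mid x) := by
    rw [mul_assoc, mul_smul, mul_smul, Finset.smul_sum,
      Finset.sum_congr rfl fun x _ => (by
        rw [← hmid x, smul_smul, inv_mul_cancel₀ (mul_ne_zero c1 c2), one_smul] :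
        (ef N P * ef G' P)⁻¹ • gcl (mid x) = resCl (mid (f x)) * gcl P), ← hs, smul_smul,
      mul_inv_cancel₀ c5, one_smul]
  rw [← (isUnit_gcl P).mul_left_inj, mul_assoc, resCl_mul s hG, resCl_eq_gcl hG', mul_smul_comm,
    gcl_mul hG' hG, smul_smul, smul_mul_assoc, Finset.sum_mul, hs', smul_smul]
  congr 1
  rw [ef.eq_def G' G, ef.eq_def G' N] at hc
  field_simp at hc ⊢
  linear_combination (-1) * hc

/-- Multiplicativity of `resCl`: along a resolution `0 → P → G → M → 0`, extensions of `G` are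
pulled back from extensions of `M`, and differ from these by the projective module `P`. -/
theorem resCl_mul_resCl (M N : FGModuleCat.{u} A) :
    resCl M * resCl N = (Nat.card (M ⟶ N) : ℚ)⁻¹ • ∑ e : Ext M N 1, resCl (mid e) := by
  obtain ⟨P, G, -, s, -, hP, hG, -⟩ := exists_gorenstein_resolution M
  let f : Ext M N 1 →+ Ext G N 1 := (Ext.mk₀ s.p).precomp N (zero_add 1)
  have hf : Function.Surjective f := fun x => by
    obtain ⟨y, hy⟩ := Ext.contravariant_sequence_exact₂ s.ex N x (Subsingleton.elim _ _)
    exact ⟨y, hy⟩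
  have hmid (x : Ext M N 1) :
      (ef N P * ef M P) • (resCl (mid x) * gcl P) = resCl (mid (f x)) := by
    obtain ⟨L, t, g, h1, h2, h3⟩ := (midSES x).exists_pullback s.p
    obtain ⟨φ, -⟩ := t.exists_iso_of_ext_eq (midSES (f x))
      (by rw [h3, midSES_ext, midSES_ext]; rfl)
    obtain ⟨r, -⟩ := s.of_isPullback h2.flip
    rw [resCl_mid (r.congrMid φ) (projDimLEOne_of_projective P), resCl_eq_gcl (.of_projective P),
      ef_left (midSES x) P]
  -- The class of the projective module `P` commutes with the others up to a factor.
  have hPN : gcl P * resCl N = (ef N P * (ef P N)⁻¹) • (resCl N * gcl P) := by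
    have e (x : Ext P N 1) : resCl (mid x) = ef N P • (resCl N * gcl P) := by
      obtain ⟨φ⟩ := (midSES x).iso_biprod_of_subsingleton
      rw [resCl_congr (φ ≪≫ biprod.braiding _ _),
        resCl_mid (SES.split P N) (projDimLEOne_of_projective P),
        resCl_eq_gcl (.of_projective P)]
    have h := resCl_mul_of_extProj (.of_projective P) N
    rw [Finset.sum_congr rfl fun x _ => e x, Finset.sum_const, Finset.card_univ,
      ← Nat.card_eq_fintype_card, Nat.card_of_subsingleton (0 : Ext P N 1), one_smul,
      ← ef_of_subsingleton, smul_smul, resCl_eq_gcl (.of_projective P)] at h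
    rw [h, mul_comm (ef P N)⁻¹]
  have hc : ef G N = ef P N * ef M N := ef_left_of_subsingleton s N
  have hs := sum_comp_surjective f hf (fun e => resCl (mid e))
  have c1 := ef_ne N P
  have c2 := ef_ne M P
  have c3 := card_hom_ne M N
  have c4 := card_hom_ne G N
  have c5 := card_ext_ne M N
  have c6 := card_ext_ne G N
  have c7 := ef_ne P N
  have hs' : ∑ e : Ext M N 1, resCl (mid e) * gcl P = ((Nat.card (Ext M N 1) : ℚ) *
      (Nat.card (Ext G N 1) : ℚ)⁻¹ * (ef N P * ef M P)⁻¹) • ∑ x : Ext G N 1, resCl (mid x) := by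
    rw [mul_right_comm, mul_smul, hs, Finset.sum_congr rfl fun x _ => (hmid x).symm,
      ← Finset.smul_sum, smul_smul, smul_smul, mul_assoc]
    rw [show (Nat.card (Ext M N 1) : ℚ) * (ef N P * ef M P)⁻¹ * ((Nat.card (Ext M N 1) : ℚ)⁻¹ *
      (ef N P * ef M P)) = 1 by field_simp, one_smul]
  have hMP : resCl M * gcl P = (ef M P)⁻¹ • resCl G := by rw [resCl_mul s hG, resCl_eq_gcl hG]
  have key : resCl M * resCl N * gcl P =
      ((ef P N * (ef N P)⁻¹) * (ef M P)⁻¹) • (resCl G * resCl N) := by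
    have h' : resCl N * gcl P = (ef P N * (ef N P)⁻¹) • (gcl P * resCl N) := by
      rw [hPN, smul_smul, show ef P N * (ef N P)⁻¹ * (ef N P * (ef P N)⁻¹) = 1 by field_simp,
        one_smul]
    rw [mul_assoc, h', mul_smul_comm, ← mul_assoc, hMP, smul_mul_assoc, smul_smul]
  rw [← (isUnit_gcl P).mul_left_inj, key, resCl_mul_of_extProj hG, smul_smul, smul_mul_assoc,
    Finset.sum_mul, hs', smul_smul]
  congr 1
  rw [ef.eq_def G N, ef.eq_def M N] at hc
  field_simp at hc ⊢
  linear_combination (-1) * hc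

end SemiDerived

/-! ### The modified Hall algebra -/

theorem HallQuot.cls_mul_cls (M N : FGModuleCat.{u} A) : HallQuot.cls M * HallQuot.cls N =
    (Nat.card (M ⟶ N) : ℚ)⁻¹ • ∑ e : Ext M N 1, HallQuot.cls (mid e) := by
  have h := HallAlg.cl_mul_cl (E := (⊤ : ObjectProperty (FGModuleCat.{u} A))) (M := M) (N := N)
    trivial trivial
  have h' := congrArg (RingQuot.mkAlgHom ℚ (ModRel (A := A))) h
  rw [map_mul, map_smul, map_sum] at h'
  simp only [HallAlg.cl_eq (E := (⊤ : ObjectProperty (FGModuleCat.{u} A))) trivial] at h'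
  exact h'

theorem HallQuot.cls_congr {M N : FGModuleCat.{u} A} (e : M ≅ N) :
    HallQuot.cls M = HallQuot.cls N := by
  rw [HallQuot.cls, HallAlg.cls_congr _ trivial e]
  rfl

theorem HallQuot.cls_zero {Z : FGModuleCat.{u} A} (hZ : IsZero Z) : HallQuot.cls Z = 1 := by
  rw [HallQuot.cls, ← HallAlg.cl_eq, ← HallAlg.one_eq trivial hZ, map_one]

theorem HallQuot.cls_eq_biprod {M K L : FGModuleCat.{u} A} (s : SES M K L)
    (hK : projDimLEOne A K) : HallQuot.cls L = HallQuot.cls (K ⊞ M) :=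
  RingQuot.mkAlgHom_rel ℚ (ModRel.mk _ s.ex hK)

/-- Extensions by a module of finite projective dimension multiply, up to the Euler form. -/
theorem HallQuot.cls_mid {M K L : FGModuleCat.{u} A} (s : SES M K L) (hK : projDimLEOne A K) :
    HallQuot.cls L = ef M K • (HallQuot.cls M * HallQuot.cls K) := by
  rw [HallQuot.cls_mul_cls, Finset.sum_congr rfl fun e _ =>
    (HallQuot.cls_eq_biprod (midSES e) hK).trans (HallQuot.cls_eq_biprod s hK).symm,
    Finset.sum_const, Finset.card_univ, ← Nat.card_eq_fintype_card, ← Nat.cast_smul_eq_nsmul ℚ,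
    smul_smul, smul_smul, mul_assoc, ef]
  have := card_ext_ne M K
  have := card_hom_ne M K
  rw [show (Nat.card (M ⟶ K) : ℚ) / Nat.card (Ext M K 1) * ((Nat.card (M ⟶ K) : ℚ)⁻¹ *
    Nat.card (Ext M K 1)) = 1 by field_simp, one_smul]

theorem HallQuot.linearMap_ext {V : Type*} [AddCommGroup V] [Module ℚ V]
    {f g : HallQuot A →ₗ[ℚ] V} (h : ∀ M, f (HallQuot.cls M) = g (HallQuot.cls M)) : f = g := by
  have h' : f ∘ₗ (RingQuot.mkAlgHom ℚ ModRel).toLinearMap =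
      g ∘ₗ (RingQuot.mkAlgHom ℚ (ModRel (A := A))).toLinearMap := by
    refine HallAlg.hom_ext fun M hM => ?_
    rw [HallAlg.cl_eq hM]
    exact h M
  ext x
  obtain ⟨y, rfl⟩ := RingQuot.mkAlgHom_surjective ℚ (ModRel (A := A)) x
  exact LinearMap.congr_fun h' y

namespace ModifiedHall

theorem cls_congr {M N : FGModuleCat.{u} A} (e : M ≅ N) :
    ModifiedHall.cls M = ModifiedHall.cls N := by
  rw [ModifiedHall.cls, HallQuot.cls_congr e, ModifiedHall.cls]

theorem cls_zero {Z : FGModuleCat.{u} A} (hZ : IsZero Z) : ModifiedHall.cls Z = 1 := by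
  rw [ModifiedHall.cls, HallQuot.cls_zero hZ, map_one]

theorem cls_mul_cls (M N : FGModuleCat.{u} A) : ModifiedHall.cls M * ModifiedHall.cls N =
    (Nat.card (M ⟶ N) : ℚ)⁻¹ • ∑ e : Ext M N 1, ModifiedHall.cls (mid e) := by
  rw [ModifiedHall.cls, ModifiedHall.cls, ← map_mul, HallQuot.cls_mul_cls, map_smul, map_sum]
  rfl

theorem isUnit_cls {K : FGModuleCat.{u} A} (hK : projDimLEOne A K) :
    IsUnit (ModifiedHall.cls K) :=
  isUnit_toLoc _ ⟨1, K, one_ne_zero, hK, (one_smul _ _).symm⟩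

theorem cls_mid {M K L : FGModuleCat.{u} A} (s : SES M K L) (hK : projDimLEOne A K) :
    ModifiedHall.cls L = ef M K • (ModifiedHall.cls M * ModifiedHall.cls K) := by
  rw [ModifiedHall.cls, HallQuot.cls_mid s hK, map_smul, map_mul]
  rfl

/-- The relations of the algebra concern submodules of finite projective dimension; after inverting
the classes of projective modules they hold for quotients as well. The pullback of the extension
along a resolution `0 → P₁ → P₀ → K → 0` splits, and has `L` as its quotient by `P₁`. -/
theorem cls_eq_biprod [Gorenstein A] {K M L : FGModuleCat.{u} A} (s : SES K M L)
    (hK : projDimLEOne A K) : ModifiedHall.cls L = ModifiedHall.cls (M ⊞ K) := by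
  obtain ⟨P₀, P₁, r, hP₀, hP₁⟩ := hK.exists_resolution
  have h {L : FGModuleCat.{u} A} (s : SES K M L) :
      ModifiedHall.cls L * ModifiedHall.cls P₁ =
        (ef M P₁ * ef K P₁)⁻¹ • ModifiedHall.cls (M ⊞ P₀) := by
    obtain ⟨X, t, g, -, h, -⟩ := s.exists_pullback r.p
    obtain ⟨t', -⟩ := r.of_isPullback h.flip
    obtain ⟨φ⟩ := t.iso_biprod_of_subsingleton
    rw [← cls_congr φ, cls_mid t' (projDimLEOne_of_projective P₁), ← ef_left s P₁, smul_smul,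
      inv_mul_cancel₀ (ef_ne _ _), one_smul]
  rw [← (isUnit_cls (projDimLEOne_of_projective P₁)).mul_left_inj, h s, h (SES.split M K)]

theorem cls_mid' [Gorenstein A] {K M L : FGModuleCat.{u} A} (s : SES K M L)
    (hK : projDimLEOne A K) :
    ModifiedHall.cls L = ef K M • (ModifiedHall.cls K * ModifiedHall.cls M) := by
  rw [cls_mul_cls, Finset.sum_congr rfl fun e _ =>
    (cls_eq_biprod (midSES e) hK).trans (cls_eq_biprod s hK).symm,
    Finset.sum_const, Finset.card_univ, ← Nat.card_eq_fintype_card, ← Nat.cast_smul_eq_nsmul ℚ,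
    smul_smul, smul_smul, mul_assoc, ef]
  have := card_ext_ne K M
  have := card_hom_ne K M
  rw [show (Nat.card (K ⟶ M) : ℚ) / Nat.card (Ext K M 1) * ((Nat.card (K ⟶ M) : ℚ)⁻¹ *
    Nat.card (Ext K M 1)) = 1 by field_simp, one_smul]

/-- The classes of modules of finite projective dimension commute with the classes of modules, up
to scalars. -/
theorem cls_comm [Gorenstein A] {K : FGModuleCat.{u} A} (hK : projDimLEOne A K)
    (M : FGModuleCat.{u} A) : ef K M • (ModifiedHall.cls K * ModifiedHall.cls M) =
      ef M K • (ModifiedHall.cls M * ModifiedHall.cls K) := by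
  rw [← cls_mid' (SES.split M K) hK, ← cls_mid (SES.split K M) hK]
  exact cls_congr (biprod.braiding _ _)

end ModifiedHall

/-! ### The isomorphism of the two algebras -/

section Iso
variable [Gorenstein A]

/-- The map to the semi-derived Hall algebra on the Hall algebra of all modules. -/
noncomputable def hallToSemiDerived (A : Type u) [Ring A] [Finite A] [Gorenstein A] :
    HallMod A →ₐ[ℚ] SemiDerivedHall (gproj A) :=
  let f : HallMod A →ₗ[ℚ] SemiDerivedHall (gproj A) :=
    HallAlg.basis.constr ℚ fun x => resCl x.rep
  have hf (M : FGModuleCat.{u} A) : f (HallAlg.cls M trivial) = resCl M := by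
    obtain ⟨e⟩ := IsoCl.rep_mk (E := (⊤ : ObjectProperty (FGModuleCat.{u} A))) M trivial
    rw [HallAlg.cls, Module.Basis.constr_basis, resCl_congr e]
  AlgHom.ofLinearMap f
    (by
      obtain ⟨Z, hZ⟩ := HasZeroObject.zero (C := FGModuleCat.{u} A)
      have : Projective Z := hZ.projective
      rw [HallAlg.one_eq trivial hZ, HallAlg.cl_eq trivial, hf, resCl_eq_gcl (.of_projective Z),
        gcl_zero hZ])
    (by
      have h : (LinearMap.mul ℚ (HallMod A)).compr₂ f =
          (LinearMap.mul ℚ (SemiDerivedHall (gproj A))).compl₁₂ f f := by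
        refine HallAlg.hom_ext fun M _ => HallAlg.hom_ext fun N _ => ?_
        simp only [LinearMap.compr₂_apply, LinearMap.compl₁₂_apply, LinearMap.mul_apply']
        rw [HallAlg.cl_mul_cl trivial trivial, map_smul, map_sum]
        simp only [HallAlg.cl_eq (E := (⊤ : ObjectProperty (FGModuleCat.{u} A))) trivial, hf]
        rw [resCl_mul_resCl]
      exact fun x y => LinearMap.congr_fun₂ h x y)

theorem hallToSemiDerived_cls (M : FGModuleCat.{u} A) :
    hallToSemiDerived A (HallAlg.cls M trivial) = resCl M := by
  obtain ⟨e⟩ := IsoCl.rep_mk (E := (⊤ : ObjectProperty (FGModuleCat.{u} A))) M trivial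
  refine (Module.Basis.constr_basis HallAlg.basis ℚ _ _).trans (resCl_congr e)

/-- The map to the semi-derived Hall algebra on the quotient of the Hall algebra. -/
noncomputable def hallQuotToSemiDerived (A : Type u) [Ring A] [Finite A] [Gorenstein A] :
    HallQuot A →ₐ[ℚ] SemiDerivedHall (gproj A) :=
  RingQuot.liftAlgHom ℚ ⟨hallToSemiDerived A, by
    rintro _ _ ⟨S, hS, hK⟩
    let s : SES S.X₃ S.X₁ S.X₂ := ⟨S.f, S.g, S.zero, hS⟩
    rw [hallToSemiDerived_cls, hallToSemiDerived_cls, resCl_mid s hK,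
      resCl_mid (SES.split S.X₁ S.X₃) hK]⟩

theorem hallQuotToSemiDerived_cls (M : FGModuleCat.{u} A) :
    hallQuotToSemiDerived A (HallQuot.cls M) = resCl M :=
  (RingQuot.liftAlgHom_mkAlgHom_apply ..).trans (hallToSemiDerived_cls M)

/-- The map from the modified to the semi-derived Hall algebra. -/
noncomputable def toSemiDerived (A : Type u) [Ring A] [Finite A] [Gorenstein A] :
    ModifiedHall A →ₐ[ℚ] SemiDerivedHall (gproj A) :=
  Loc.lift (hallQuotToSemiDerived A) (by
    rintro _ ⟨a, K, ha, hK, rfl⟩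
    rw [map_smul, hallQuotToSemiDerived_cls]
    exact isUnit_rat_smul ha (isUnit_resCl hK))

theorem toSemiDerived_cls (M : FGModuleCat.{u} A) :
    toSemiDerived A (ModifiedHall.cls M) = resCl M :=
  (Loc.lift_toLoc ..).trans (hallQuotToSemiDerived_cls M)

/-- The map from the Hall algebra of the Gorenstein projective modules to the modified Hall
algebra. -/
noncomputable def gprojToModified (A : Type u) [Ring A] [Finite A] [Gorenstein A] :
    HallAlg (gproj A) →ₐ[ℚ] ModifiedHall A :=
  let f : HallAlg (gproj A) →ₗ[ℚ] ModifiedHall A :=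
    HallAlg.basis.constr ℚ fun x => ModifiedHall.cls x.rep
  have hf (M : FGModuleCat.{u} A) (hM : gproj A M) :
      f (HallAlg.cls M hM) = ModifiedHall.cls M := by
    obtain ⟨e⟩ := IsoCl.rep_mk M hM
    rw [HallAlg.cls, Module.Basis.constr_basis, ModifiedHall.cls_congr e]
  AlgHom.ofLinearMap f
    (by
      obtain ⟨Z, hZ⟩ := HasZeroObject.zero (C := FGModuleCat.{u} A)
      have : Projective Z := hZ.projective
      rw [HallAlg.one_eq (gproj_of_projective Z) hZ, HallAlg.cl_eq (gproj_of_projective Z), hf,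
        ModifiedHall.cls_zero hZ])
    (by
      have h : (LinearMap.mul ℚ (HallAlg (gproj A))).compr₂ f =
          (LinearMap.mul ℚ (ModifiedHall A)).compl₁₂ f f := by
        refine HallAlg.hom_ext fun M hM => HallAlg.hom_ext fun N hN => ?_
        simp only [LinearMap.compr₂_apply, LinearMap.compl₁₂_apply, LinearMap.mul_apply']
        rw [HallAlg.cl_mul_cl hM hN, map_smul, map_sum, HallAlg.cl_eq hM, HallAlg.cl_eq hN, hf, hf,
          ModifiedHall.cls_mul_cls]
        congr 1
        refine Finset.sum_congr rfl fun e _ => ?_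
        rw [HallAlg.cl_eq (mid_mem hM hN e), hf]
      exact fun x y => LinearMap.congr_fun₂ h x y)

theorem gprojToModified_cl {G : FGModuleCat.{u} A} (hG : gproj A G) :
    gprojToModified A (HallAlg.cl (gproj A) G) = ModifiedHall.cls G := by
  obtain ⟨e⟩ := IsoCl.rep_mk G hG
  rw [HallAlg.cl_eq hG]
  exact (Module.Basis.constr_basis HallAlg.basis ℚ _ _).trans (ModifiedHall.cls_congr e)

/-- The map from the semi-derived to the modified Hall algebra. -/
noncomputable def ofSemiDerived (A : Type u) [Ring A] [Finite A] [Gorenstein A] :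
    SemiDerivedHall (gproj A) →ₐ[ℚ] ModifiedHall A :=
  Loc.lift (gprojToModified A) (by
    rintro _ ⟨P, hP, hP₁, hP₂, rfl⟩
    have := projective_of_isExactProjective hP hP₁
    rw [← HallAlg.cl_eq, gprojToModified_cl hP]
    exact ModifiedHall.isUnit_cls (projDimLEOne_of_projective P))

theorem ofSemiDerived_gcl {G : FGModuleCat.{u} A} (hG : ExtProj G) :
    ofSemiDerived A (gcl G) = ModifiedHall.cls G :=
  (Loc.lift_toLoc ..).trans (gprojToModified_cl (gproj_iff.2 hG))

/-- The class of `M` in the modified Hall algebra is determined by a resolution by Gorenstein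
projective modules. -/
theorem ModifiedHall.cls_mul_of_resolution {M P G : FGModuleCat.{u} A} (s : SES M P G)
    [Projective P] : ModifiedHall.cls M * ModifiedHall.cls P = (ef M P)⁻¹ • ModifiedHall.cls G := by
  rw [ModifiedHall.cls_mid s (projDimLEOne_of_projective P), smul_smul,
    inv_mul_cancel₀ (ef_ne _ _), one_smul]

theorem ofSemiDerived_resCl (M : FGModuleCat.{u} A) :
    ofSemiDerived A (resCl M) = ModifiedHall.cls M := by
  obtain ⟨P, G, -, s, -, hP, hG, -⟩ := exists_gorenstein_resolution M
  rw [← (ModifiedHall.isUnit_cls (projDimLEOne_of_projective P)).mul_left_inj,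
    ModifiedHall.cls_mul_of_resolution s, ← ofSemiDerived_gcl (.of_projective P), ← map_mul,
    resCl_mul s hG, map_smul, ofSemiDerived_gcl hG]

/-- The modified Hall algebra is isomorphic to the semi-derived Hall algebra of the Gorenstein
projective modules. -/
noncomputable def modifiedEquivSemiDerived (A : Type u) [Ring A] [Finite A] [Gorenstein A] :
    ModifiedHall A ≃ₐ[ℚ] SemiDerivedHall (gproj A) :=
  AlgEquiv.ofAlgHom (toSemiDerived A) (ofSemiDerived A)
    (Loc.hom_ext fun a => by
      have h : ((toSemiDerived A).comp (ofSemiDerived A)).toLinearMap ∘ₗ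
          (toLoc (projInjClasses (gproj A))).toLinearMap =
          (toLoc (projInjClasses (gproj A))).toLinearMap := by
        refine HallAlg.hom_ext fun G hG => ?_
        change toSemiDerived A (ofSemiDerived A (gcl G)) = gcl G
        rw [ofSemiDerived_gcl (gproj_iff.1 hG), toSemiDerived_cls, resCl_eq_gcl (gproj_iff.1 hG)]
      exact LinearMap.congr_fun h a)
    (Loc.hom_ext fun a => by
      have h : ((ofSemiDerived A).comp (toSemiDerived A)).toLinearMap ∘ₗ
          (toLoc (invertedSet A)).toLinearMap = (toLoc (invertedSet A)).toLinearMap := by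
        refine HallQuot.linearMap_ext fun M => ?_
        change ofSemiDerived A (toSemiDerived A (ModifiedHall.cls M)) = ModifiedHall.cls M
        rw [toSemiDerived_cls, ofSemiDerived_resCl]
      exact LinearMap.congr_fun h a)

end Iso

/-! ### Perfect complexes -/

open DerivedCategory ZeroObject in
/-- There are no morphisms from a bounded complex of projective modules in degrees `≥ a` to a
complex in degrees `< a`. -/
theorem hom_eq_zero_of_projective (K : CochainComplex (FGModuleCat.{u} A) ℤ) (a b : ℤ)
    [K.IsStrictlyGE a] [K.IsStrictlyLE b] [∀ n, Projective (K.X n)]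
    (Y : DerivedCategory (FGModuleCat.{u} A)) (m : ℤ) (hm : m < a) [Y.IsLE m] (f : Q.obj K ⟶ Y) :
    f = 0 := by
  obtain ⟨L, hL, ⟨e⟩⟩ := Y.exists_iso_Q_obj_of_isLE m
  have := CochainComplex.isKProjective_of_projective K b
  obtain ⟨g, hg⟩ := (CochainComplex.IsKProjective.Qh_map_bijective K
    ((HomotopyCategory.quotient _ _).obj L)).2
      ((quotientCompQhIso _).hom.app K ≫ (f ≫ e.hom) ≫ (quotientCompQhIso _).inv.app L)
  obtain ⟨g', rfl⟩ := (HomotopyCategory.quotient _ _).map_surjective g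
  have hg' : g' = 0 := by
    refine HomologicalComplex.hom_ext _ _ fun n => ?_
    by_cases hn : n < a
    · exact (K.isZero_of_isStrictlyGE a n hn).eq_of_src _ _
    · exact (L.isZero_of_isStrictlyLE m n (by lia)).eq_of_tgt _ _
  rw [hg', Functor.map_zero, Functor.map_zero] at hg
  rw [← cancel_mono e.hom, ← cancel_epi ((quotientCompQhIso _).hom.app K),
    ← cancel_mono ((quotientCompQhIso _).inv.app L), Category.assoc, ← hg]
  simp

/-- A perfect complex has no morphisms to complexes in sufficiently negative degrees. -/
theorem perfect.exists_hom_eq_zero {Z : BoundedDerived A} (hZ : perfect A Z) :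
    ∃ a : ℤ, ∀ (Y : DerivedCategory (FGModuleCat.{u} A)) (m : ℤ), m < a → Y.IsLE m →
      ∀ f : Z.obj ⟶ Y, f = 0 := by
  obtain ⟨K, a, b, _, _, _, ⟨e⟩⟩ := hZ
  refine ⟨a, fun Y m hm _ f => ?_⟩
  rw [← cancel_epi e.inv, comp_zero]
  exact hom_eq_zero_of_projective K a b Y m hm _

instance perfect_isStableUnderShift : (perfect A).IsStableUnderShift ℤ where
  isStableUnderShiftBy n :=
    { le_shift := by
        rintro X ⟨K, a, b, _, _, hK, ⟨e⟩⟩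
        exact ⟨K⟦n⟧, a - n, b - n, K.isStrictlyGE_shift a n _ (by lia),
          K.isStrictlyLE_shift b n _ (by lia), fun m => hK (m + n),
          ⟨(DerivedCategory.TStructure.t.bounded.ι.commShiftIso n).app X ≪≫
            (shiftFunctor _ n).mapIso e ≪≫ (DerivedCategory.Q.commShiftIso n).symm.app K⟩⟩ }

theorem projective_single_X (P : FGModuleCat.{u} A) [Projective P] (m n : ℤ) :
    Projective (((HomologicalComplex.single (FGModuleCat.{u} A) (ComplexShape.up ℤ) m).obj P).X n) := by
  by_cases h : n = m
  · subst h
    exact Projective.of_iso (HomologicalComplex.singleObjXSelf _ n P).symm inferInstance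
  · exact (HomologicalComplex.isZero_single_obj_X _ m P n h).projective

/-- A module, as a complex concentrated in degree `n`. -/
noncomputable def stalkAt (n : ℤ) (M : FGModuleCat.{u} A) : BoundedDerived A :=
  ⟨(DerivedCategory.singleFunctor _ n).obj M, ⟨⟨n, inferInstance⟩, ⟨n, inferInstance⟩⟩⟩

theorem perfect_stalkAt (n : ℤ) (P : FGModuleCat.{u} A) [Projective P] :
    perfect A (stalkAt n P) :=
  ⟨(HomologicalComplex.single _ _ n).obj P, n, n, inferInstance, inferInstance,
    projective_single_X P n, ⟨Iso.refl _⟩⟩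

theorem perfect_stalk (P : FGModuleCat.{u} A) [Projective P] : perfect A (stalk P) :=
  perfect_stalkAt 0 P

/-! ### Isomorphisms in the singularity category -/

/-- Isomorphy in the singularity category. -/
def SgIso (X Y : BoundedDerived A) : Prop :=
  Nonempty ((perfect A).trW.Q.obj X ≅ (perfect A).trW.Q.obj Y)

theorem SgIso.symm {X Y : BoundedDerived A} : SgIso X Y → SgIso Y X := fun ⟨e⟩ => ⟨e.symm⟩

theorem SgIso.trans {X Y Z : BoundedDerived A} : SgIso X Y → SgIso Y Z → SgIso X Z :=
  fun ⟨e⟩ ⟨e'⟩ => ⟨e ≪≫ e'⟩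

theorem SgIso.of_iso {X Y : BoundedDerived A} (e : X ≅ Y) : SgIso X Y :=
  ⟨(perfect A).trW.Q.mapIso e⟩

theorem SgIso.of_trW {X Y : BoundedDerived A} {f : X ⟶ Y} (hf : (perfect A).trW f) : SgIso X Y :=
  ⟨Localization.isoOfHom (perfect A).trW.Q (perfect A).trW f hf⟩

theorem sgClass_eq_iff {M N : FGModuleCat.{u} A} : sgClass M = sgClass N ↔
    SgIso (stalk M) (stalk N) := Quotient.eq (r := isIsomorphicSetoid (SingularityCategory A))

/-- A short exact sequence of modules gives a distinguished triangle in the bounded derived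
category. -/
theorem exists_stalk_triangle {M N L : FGModuleCat.{u} A} (s : SES M N L) :
    ∃ (f : stalk N ⟶ stalk L) (g : stalk L ⟶ stalk M) (h : stalk M ⟶ (stalk N)⟦(1 : ℤ)⟧),
      Pretriangulated.Triangle.mk f g h ∈ distTriang (BoundedDerived A) := by
  let P := (DerivedCategory.TStructure.t (C := FGModuleCat.{u} A)).bounded
  refine ⟨P.fullyFaithfulι.preimage ((DerivedCategory.singleFunctor _ 0).map s.i),
    P.fullyFaithfulι.preimage ((DerivedCategory.singleFunctor _ 0).map s.p),
    P.fullyFaithfulι.preimage (s.ex.singleδ ≫ (P.ι.commShiftIso (1 : ℤ)).inv.app (stalk N)), ?_⟩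
  refine Pretriangulated.isomorphic_distinguished _ s.ex.singleTriangle_distinguished _
    (Pretriangulated.Triangle.isoMk _ _ (Iso.refl _) (Iso.refl _) (Iso.refl _) ?_ ?_ ?_)
  · exact (Category.comp_id _).trans (Category.id_comp _).symm
  · exact (Category.comp_id _).trans (Category.id_comp _).symm
  · let δ : P.ι.obj (stalk M) ⟶ (P.ι ⋙ shiftFunctor _ (1 : ℤ)).obj (stalk N) := s.ex.singleδ
    have h : ((δ ≫ (P.ι.commShiftIso (1 : ℤ)).inv.app (stalk N)) ≫
      (P.ι.commShiftIso (1 : ℤ)).hom.app (stalk N)) ≫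
        (shiftFunctor _ (1 : ℤ)).map (𝟙 (P.ι.obj (stalk N))) = 𝟙 _ ≫ δ := by simp
    exact h

/-- The quotient by a projective submodule does not change the object of the singularity
category. -/
theorem SgIso.of_ses {M P L : FGModuleCat.{u} A} (s : SES M P L) [Projective P] (n : ℤ) :
    SgIso ((stalk L)⟦n⟧) ((stalk M)⟦n⟧) := by
  obtain ⟨f, g, h, H⟩ := exists_stalk_triangle s
  exact SgIso.of_trW ((ObjectProperty.trW.mk' _ H (perfect_stalk P)).shift n)

/-- The syzygy is the inverse shift in the singularity category. -/
theorem SgIso.of_ses_shift {M N P : FGModuleCat.{u} A} (s : SES M N P) [Projective P] (n : ℤ) :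
    SgIso ((stalk M)⟦n⟧) ((stalk N)⟦n + 1⟧) := by
  obtain ⟨f, g, h, H⟩ := exists_stalk_triangle s
  have h1 := ObjectProperty.trW.mk' (perfect A) (Pretriangulated.rot_of_distTriang _ H)
    (perfect_stalk P)
  exact (SgIso.of_trW (h1.shift n)).trans
    (SgIso.of_iso ((shiftFunctorAdd' (BoundedDerived A) 1 n (n + 1) (by lia)).symm.app (stalk N)))

theorem sgClass_eq_of_ses {M P L : FGModuleCat.{u} A} (s : SES M P L) [Projective P] :
    sgClass L = sgClass M := by
  have z (X : BoundedDerived A) : SgIso (X⟦(0 : ℤ)⟧) X :=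
    SgIso.of_iso ((shiftFunctorZero (BoundedDerived A) ℤ).app X)
  exact sgClass_eq_iff.2 (((z _).symm.trans (SgIso.of_ses s 0)).trans (z _))

theorem sgClass_congr {M N : FGModuleCat.{u} A} (e : M ≅ N) : sgClass M = sgClass N := by
  let P := (DerivedCategory.TStructure.t (C := FGModuleCat.{u} A)).bounded
  exact sgClass_eq_iff.2 (SgIso.of_iso (P.fullyFaithfulι.preimageIso
    ((DerivedCategory.singleFunctor _ 0).mapIso e)))

/-- Every shift of a module is isomorphic to a module in the singularity category. -/
theorem exists_sgIso_shift [Gorenstein A] (n : ℤ) :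
    ∀ M : FGModuleCat.{u} A, ∃ N : FGModuleCat.{u} A, SgIso ((stalk M)⟦n⟧) (stalk N) := by
  induction n using Int.induction_on with
  | zero => exact fun M => ⟨M, SgIso.of_iso ((shiftFunctorZero (BoundedDerived A) ℤ).app _)⟩
  | succ n ih =>
    intro M
    obtain ⟨P, G, -, s, -, hP, hG, -⟩ := exists_gorenstein_resolution M
    -- `M` is isomorphic to `G`, and the shift of `G` to its cosyzygy `G'`.
    obtain ⟨P', G', s', hP', hG'⟩ := hG.exists_coresolution
    obtain ⟨N, hN⟩ := ih G'
    exact ⟨N, ((SgIso.of_ses s (n + 1)).symm.trans (SgIso.of_ses_shift s' n).symm).trans hN⟩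
  | pred n ih =>
    intro M
    obtain ⟨P, K, s, hP⟩ := exists_cover M
    obtain ⟨N, hN⟩ := ih K
    have := SgIso.of_ses_shift s (-n - 1)
    rw [sub_add_cancel] at this
    exact ⟨N, this.trans hN⟩

open HomologicalComplex in
/-- The top cohomology of a bounded complex is covered by a morphism from a shifted free module. -/
theorem exists_epi_homology (X : DerivedCategory (FGModuleCat.{u} A)) (b : ℤ) [X.IsLE b] :
    ∃ (P : FGModuleCat.{u} A) (_ : Projective P)
      (f : (DerivedCategory.singleFunctor _ b).obj P ⟶ X),
      Epi ((DerivedCategory.homologyFunctor _ b).map f) := by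
  obtain ⟨K, hK, ⟨e⟩⟩ := X.exists_iso_Q_obj_of_isLE b
  obtain ⟨n, φ, hφ⟩ := exists_free_epi (K.X b)
  have h0 : K.d b (b + 1) = 0 := (K.isZero_of_isStrictlyLE b (b + 1)).eq_of_tgt _ _
  let ψ : (single (FGModuleCat.{u} A) (ComplexShape.up ℤ) b).obj (free A n) ⟶ K :=
    mkHomFromSingle φ (by rintro k rfl; rw [h0, comp_zero])
  have h1 : Epi (ψ.f b) := by
    rw [mkHomFromSingle_f]
    infer_instance
  have : IsIso (K.iCycles b) := K.isIso_iCycles b (b + 1) (by simp) h0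
  have : IsIso (((single (FGModuleCat.{u} A) (ComplexShape.up ℤ) b).obj (free A n)).iCycles b) :=
    isIso_iCycles _ b (b + 1) (by simp) (by simp)
  have h2 : Epi (cyclesMap ψ b) := by
    have : cyclesMap ψ b = iCycles _ b ≫ ψ.f b ≫ inv (K.iCycles b) := by
      rw [← cancel_mono (K.iCycles b)]
      simp
    rw [this]
    infer_instance
  have h3 : Epi (homologyMap ψ b) := by
    refine epi_of_epi_fac (f := homologyπ _ b) (h := cyclesMap ψ b ≫ homologyπ _ b) ?_
    simp
  have h4 : Epi ((DerivedCategory.homologyFunctor _ b).map (DerivedCategory.Q.map ψ)) := by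
    have nat := (DerivedCategory.homologyFunctorFactors (FGModuleCat.{u} A) b).hom.naturality ψ
    have h5 : Epi ((DerivedCategory.Q ⋙ DerivedCategory.homologyFunctor _ b).map ψ ≫
        (DerivedCategory.homologyFunctorFactors (FGModuleCat.{u} A) b).hom.app K) := by
      rw [nat]
      have : Epi ((homologyFunctor (FGModuleCat.{u} A) (ComplexShape.up ℤ) b).map ψ) := h3
      infer_instance
    have h6 : (DerivedCategory.Q ⋙ DerivedCategory.homologyFunctor _ b).map ψ =
        ((DerivedCategory.Q ⋙ DerivedCategory.homologyFunctor _ b).map ψ ≫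
        (DerivedCategory.homologyFunctorFactors (FGModuleCat.{u} A) b).hom.app K) ≫
        (DerivedCategory.homologyFunctorFactors (FGModuleCat.{u} A) b).inv.app K := by simp
    have h7 : Epi ((DerivedCategory.Q ⋙ DerivedCategory.homologyFunctor _ b).map ψ) := by
      rw [h6]
      infer_instance
    exact h7
  let g : (DerivedCategory.singleFunctor _ b).obj (free A n) ⟶ DerivedCategory.Q.obj K :=
    DerivedCategory.Q.map ψ
  refine ⟨free A n, inferInstance, g ≫ e.inv, ?_⟩
  have h8 : Epi ((DerivedCategory.homologyFunctor _ b).map g) := h4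
  rw [Functor.map_comp]
  infer_instance

/-- Every bounded complex is isomorphic to a shifted module in the singularity category: its top
cohomology is killed by the cone of a morphism from a shifted projective module. -/
theorem exists_sgIso_stalkAt (X : BoundedDerived A) : ∃ (n : ℤ) (M : FGModuleCat.{u} A),
    SgIso X (stalkAt n M) := by
  let P := (DerivedCategory.TStructure.t (C := FGModuleCat.{u} A)).bounded
  have key (n : ℕ) : ∀ (a : ℤ) (X : BoundedDerived A), X.obj.IsGE a → X.obj.IsLE (a + n) →
      ∃ (n : ℤ) (M : FGModuleCat.{u} A), SgIso X (stalkAt n M) := by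
    induction n with
    | zero =>
      intro a X _ hX
      have : X.obj.IsLE a := by simpa using hX
      obtain ⟨M, ⟨e⟩⟩ := X.obj.exists_iso_singleFunctor_obj_of_isGE_of_isLE a
      exact ⟨a, M, SgIso.of_iso (P.fullyFaithfulι.preimageIso e)⟩
    | succ n ih =>
      intro a X hX hX'
      obtain ⟨b, hb⟩ : ∃ b, b = a + ((n + 1 : ℕ) : ℤ) := ⟨_, rfl⟩
      rw [← hb] at hX'
      obtain ⟨F, hF, f, hf⟩ := exists_epi_homology X.obj b
      let f' : stalkAt b F ⟶ X := P.fullyFaithfulι.preimage f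
      obtain ⟨Y, g, h, H⟩ := Pretriangulated.distinguished_cocone_triangle f'
      have H' := P.ι.map_distinguished _ H
      have hs (i : ℤ) (hi : i ≠ b) :
          IsZero ((DerivedCategory.homologyFunctor _ i).obj (stalkAt b F).obj) := by
        obtain hi | hi := lt_or_gt_of_ne hi
        · exact DerivedCategory.isZero_of_isGE
            ((DerivedCategory.singleFunctor (FGModuleCat.{u} A) b).obj F) b i hi
        · exact DerivedCategory.isZero_of_isLE
            ((DerivedCategory.singleFunctor (FGModuleCat.{u} A) b).obj F) b i hi
      have hY (i : ℤ) (h1 : IsZero ((DerivedCategory.homologyFunctor _ i).obj X.obj) ∨ i = b)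
          (h2 : i + 1 ≠ b) : IsZero ((DerivedCategory.homologyFunctor _ i).obj Y.obj) := by
        refine (DerivedCategory.HomologySequence.exact₃ _ H' i (i + 1)).isZero_of_both_zeros ?_ ?_
        · obtain h1 | rfl := h1
          · exact h1.eq_of_src _ _
          · refine (DerivedCategory.HomologySequence.epi_homologyMap_mor₁_iff _ H' _).1 ?_
            exact hf
        · exact (hs (i + 1) h2).eq_of_tgt _ _
      have hge : Y.obj.IsGE a := by
        rw [DerivedCategory.isGE_iff]
        exact fun i hi => hY i (Or.inl (X.obj.isZero_of_isGE a i hi)) (by lia)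
      have hle : Y.obj.IsLE (a + n) := by
        rw [DerivedCategory.isLE_iff]
        intro i hi
        refine hY i ?_ (by lia)
        by_cases h : i = b
        · exact Or.inr h
        · exact Or.inl (X.obj.isZero_of_isLE b i (by lia))
      obtain ⟨m, M, hM⟩ := ih a Y hge hle
      exact ⟨m, M, (SgIso.of_trW (ObjectProperty.trW.mk' _ H (perfect_stalkAt b F))).trans hM⟩
  obtain ⟨⟨a, ha⟩, ⟨b, hb⟩⟩ := X.property
  refine key (b - a).toNat a X ha ?_
  exact DerivedCategory.TStructure.t.isLE_of_le X.obj b _ (by lia)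

/-- Every object of the singularity category is isomorphic to a module. -/
theorem exists_sgClass_eq [Gorenstein A] (x : SgClass A) :
    ∃ M : FGModuleCat.{u} A, sgClass M = x := by
  obtain ⟨Y, rfl⟩ := Quotient.exists_rep (s := isIsomorphicSetoid (SingularityCategory A)) x
  let X := (perfect A).trW.Q.objPreimage Y
  obtain ⟨n, M, hM⟩ := exists_sgIso_stalkAt X
  let P := (DerivedCategory.TStructure.t (C := FGModuleCat.{u} A)).bounded
  have e : SgIso (stalkAt n M) ((stalk M)⟦-n⟧) := by
    refine SgIso.of_iso (P.fullyFaithfulι.preimageIso ?_)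
    exact (((DerivedCategory.singleFunctors (FGModuleCat.{u} A)).shiftIso (-n) n 0
      (by simp)).symm.app M) ≪≫ (P.ι.commShiftIso (-n)).symm.app (stalk M)
  obtain ⟨N, hN⟩ := exists_sgIso_shift (-n) M
  obtain ⟨φ⟩ := (hM.trans e).trans hN
  exact ⟨N, Quotient.sound (s := isIsomorphicSetoid (SingularityCategory A))
    ⟨φ.symm ≪≫ (perfect A).trW.Q.objObjPreimageIso Y⟩⟩

/-! ### Isomorphic objects of the singularity category -/

section Germ
universe v' u'
variable {C : Type u'} [Category.{v'} C]

/-- Two sequences of morphisms are identified if they agree from some index on. -/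
def eventuallyEq (C : Type u') [Category.{v'} C] : HomRel (ℕ → C) :=
  fun _ _ f g => ∃ m, ∀ n, m ≤ n → f n = g n

instance : Congruence (eventuallyEq C) where
  equivalence := ⟨fun _ => ⟨0, fun _ _ => rfl⟩,
    fun ⟨m, hm⟩ => ⟨m, fun n hn => (hm n hn).symm⟩,
    fun ⟨m, hm⟩ ⟨m', hm'⟩ => ⟨max m m', fun n hn =>
      (hm n (le_of_max_le_left hn)).trans (hm' n (le_of_max_le_right hn))⟩⟩
  comp_left f _ _ := fun ⟨m, hm⟩ => ⟨m, fun n hn => by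
    change f n ≫ _ = f n ≫ _
    rw [hm n hn]⟩
  comp_right g := fun ⟨m, hm⟩ => ⟨m, fun n hn => by
    change _ ≫ g n = _ ≫ g n
    rw [hm n hn]⟩

/-- A sequence of morphisms which are eventually invertible is invertible up to `eventuallyEq`. -/
theorem isIso_of_eventually [HasZeroMorphisms C] {X Y : ℕ → C} (f : X ⟶ Y) (m : ℕ)
    (hf : ∀ n, m ≤ n → IsIso (f n)) : IsIso ((Quotient.functor (eventuallyEq C)).map f) := by
  classical
  let g : Y ⟶ X := fun n => if h : IsIso (f n) then inv (f n) else 0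
  have hg (n : ℕ) (h : IsIso (f n)) : g n = inv (f n) := dif_pos h
  refine ⟨(Quotient.functor (eventuallyEq C)).map g, ?_, ?_⟩
  · rw [← Functor.map_comp, ← CategoryTheory.Functor.map_id]
    refine CategoryTheory.Quotient.sound _ ⟨m, fun n hn => ?_⟩
    have := hf n hn
    change f n ≫ g n = 𝟙 _
    rw [hg n this, IsIso.hom_inv_id]
  · rw [← Functor.map_comp, ← CategoryTheory.Functor.map_id]
    refine CategoryTheory.Quotient.sound _ ⟨m, fun n hn => ?_⟩
    have := hf n hn
    change g n ≫ f n = 𝟙 _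
    rw [hg n this, IsIso.inv_hom_id]

theorem exists_inverse_of_iso {X Y : ℕ → C} (e : (Quotient.functor (eventuallyEq C)).obj X ≅
    (Quotient.functor (eventuallyEq C)).obj Y) :
    ∃ m, ∀ n, m ≤ n → Nonempty (X n ≅ Y n) := by
  obtain ⟨f, hf⟩ := (Quotient.functor (eventuallyEq C)).map_surjective e.hom
  obtain ⟨g, hg⟩ := (Quotient.functor (eventuallyEq C)).map_surjective e.inv
  have h1 : (Quotient.functor (eventuallyEq C)).map (f ≫ g) =
      (Quotient.functor (eventuallyEq C)).map (𝟙 X) := by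
    rw [Functor.map_comp, hf, hg, e.hom_inv_id, CategoryTheory.Functor.map_id]
  have h2 : (Quotient.functor (eventuallyEq C)).map (g ≫ f) =
      (Quotient.functor (eventuallyEq C)).map (𝟙 Y) := by
    rw [Functor.map_comp, hf, hg, e.inv_hom_id, CategoryTheory.Functor.map_id]
  obtain ⟨m₁, h1⟩ := (Quotient.functor_map_eq_iff _ _ _).1 h1
  obtain ⟨m₂, h2⟩ := (Quotient.functor_map_eq_iff _ _ _).1 h2
  exact ⟨max m₁ m₂, fun n hn => ⟨⟨f n, g n, h1 n (le_of_max_le_left hn),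
    h2 n (le_of_max_le_right hn)⟩⟩⟩

end Germ

/-- The sequence of functors `N ↦ Hom(X, N[n])` on modules, for an object `X` of the bounded
derived category. -/
noncomputable def shiftedHoms (A : Type u) [Ring A] [Finite A] :
    (BoundedDerived A)ᵒᵖ ⥤ (ℕ → (FGModuleCat.{u} A ⥤ AddCommGrpCat.{u + 1})) :=
  Functor.pi' fun n => (DerivedCategory.TStructure.t (C := FGModuleCat.{u} A)).bounded.ι.op ⋙
    preadditiveCoyoneda ⋙ (Functor.whiskeringLeft _ _ _).obj
      (DerivedCategory.singleFunctor _ 0 ⋙ shiftFunctor _ (n : ℤ))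

/-- Eventually, the functors `N ↦ Hom(X, N[n])` do not see perfect complexes. -/
theorem isIso_shiftedHoms {X Y : BoundedDerived A} {f : X ⟶ Y} (hf : (perfect A).trW f) :
    IsIso ((Quotient.functor (eventuallyEq _)).map ((shiftedHoms A).map f.op)) := by
  obtain ⟨Z, g, h, H, hZ⟩ := hf
  obtain ⟨a, ha⟩ := hZ.exists_hom_eq_zero
  obtain ⟨a', ha'⟩ := ((perfect A).le_shift (-1) _ hZ).exists_hom_eq_zero
  let P := (DerivedCategory.TStructure.t (C := FGModuleCat.{u} A)).bounded
  have H' := P.ι.map_distinguished _ H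
  have H'' := P.ι.map_distinguished _ (Pretriangulated.inv_rot_of_distTriang _ H)
  refine isIso_of_eventually _ (max (1 - a) (1 - a')).toNat fun n hn => ?_
  have hN (N : FGModuleCat.{u} A) :
      (((DerivedCategory.singleFunctor (FGModuleCat.{u} A) 0).obj N)⟦(n : ℤ)⟧).IsLE (-n) :=
    DerivedCategory.TStructure.t.isLE_shift _ 0 n (-n) (by lia)
  rw [NatTrans.isIso_iff_isIso_app]
  intro N
  rw [ConcreteCategory.isIso_iff_bijective]
  constructor
  · refine (injective_iff_map_eq_zero
      (((shiftedHoms A).map f.op n).app N).hom).2 fun x hx => ?_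
    obtain ⟨y, rfl⟩ := Pretriangulated.Triangle.yoneda_exact₂ _ H' x hx
    rw [ha _ _ (by lia) (hN N) y]
    exact comp_zero
  · intro x
    obtain ⟨y, hy⟩ := Pretriangulated.Triangle.yoneda_exact₂ _ H'' x
      (ha' _ _ (by lia) (hN N) _)
    exact ⟨y, hy.symm⟩

/-- Isomorphic objects of the singularity category have the same `Ext` groups in large degrees,
naturally. -/
theorem exists_ext_equiv {M M' : FGModuleCat.{u} A} (h : sgClass M = sgClass M') :
    ∃ m, ∀ n, m ≤ n → ∃ (e : ∀ N, Ext M N n ≃ Ext M' N n),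
      ∀ {N N' : FGModuleCat.{u} A} (f : N ⟶ N') (x : Ext M N n),
        e N' (x.comp (Ext.mk₀ f) (add_zero n)) = (e N x).comp (Ext.mk₀ f) (add_zero n) := by
  obtain ⟨φ⟩ := sgClass_eq_iff.1 h
  let F : BoundedDerived A ⥤ (CategoryTheory.Quotient (eventuallyEq
      (FGModuleCat.{u} A ⥤ AddCommGrpCat.{u + 1})))ᵒᵖ :=
    (shiftedHoms A ⋙ Quotient.functor (eventuallyEq _)).rightOp
  have hF : (perfect A).trW.IsInvertedBy F := fun X Y f hf => by
    have := isIso_shiftedHoms hf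
    exact inferInstanceAs (IsIso ((Quotient.functor (eventuallyEq _)).map
      ((shiftedHoms A).map f.op)).op)
  let G := Localization.lift F hF (perfect A).trW.Q
  let ι : (perfect A).trW.Q ⋙ G ≅ F := Localization.fac F hF (perfect A).trW.Q
  let ψ : F.obj (stalk M) ≅ F.obj (stalk M') :=
    (ι.symm.app _ ≪≫ G.mapIso φ) ≪≫ ι.app _
  obtain ⟨m, hm⟩ := exists_inverse_of_iso ψ.unop.symm
  refine ⟨m, fun n hn => ?_⟩
  obtain ⟨e⟩ := hm n hn
  let ε (M N : FGModuleCat.{u} A) : Ext M N n ≃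
      (((shiftedHoms A).obj (Opposite.op (stalk M)) n).obj N : Type (u + 1)) :=
    Ext.homEquiv (X := M) (Y := N) (n := n)
  have hε {M N N' : FGModuleCat.{u} A} (f : N ⟶ N') (x : Ext M N n) :
      ε M N' (x.comp (Ext.mk₀ f) (add_zero n)) =
        ((shiftedHoms A).obj (Opposite.op (stalk M)) n).map f (ε M N x) := by
    refine (Ext.comp_hom x (Ext.mk₀ f) (add_zero n)).trans ?_
    rw [Ext.mk₀_hom, ShiftedHom.comp_mk₀]
    rfl
  refine ⟨fun N => (ε M N).trans ((e.app N).addCommGroupIsoToAddEquiv.toEquiv.trans (ε M' N).symm),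
    fun {N N'} f x => (ε M' N').injective ?_⟩
  rw [hε]
  simp only [Equiv.trans_apply, Equiv.apply_symm_apply]
  rw [hε]
  exact ConcreteCategory.congr_hom (e.hom.naturality f) (ε M N x)

/-! ### Stable isomorphisms -/

/-- A class `e` in `Extⁿ(M, K)` for which `Extⁿ(M, N)` is the quotient of `Hom(K, N)` by the
morphisms factoring through a fixed embedding `i` of `K` into a projective module. Such a class
exists for the `n`-th syzygy `K` of `M`. -/
def IsSyzygyClass {M K : FGModuleCat.{u} A} {n : ℕ} (e : Ext M K n) : Prop :=
  (∀ (N : FGModuleCat.{u} A) (x : Ext M N n), ∃ f : K ⟶ N, x = e.comp (Ext.mk₀ f) (add_zero n)) ∧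
    ∃ (P : FGModuleCat.{u} A) (_ : Projective P) (i : K ⟶ P),
      ∀ (N : FGModuleCat.{u} A) (f : K ⟶ N), e.comp (Ext.mk₀ f) (add_zero n) = 0 →
        ∃ g : P ⟶ N, f = i ≫ g

theorem SES.isSyzygyClass {M K P : FGModuleCat.{u} A} (s : SES M K P) [Projective P] :
    IsSyzygyClass s.extCl := by
  refine ⟨fun N x => ?_, P, inferInstance, s.i, fun N f hf => ?_⟩
  · obtain ⟨y, hy⟩ := Ext.contravariant_sequence_exact₃ s.ex N x (Subsingleton.elim _ _) (add_zero 1)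
    obtain ⟨f, rfl⟩ := (Ext.mk₀_bijective _ _).2 y
    exact ⟨f, hy.symm⟩
  · obtain ⟨x, hx⟩ := Ext.contravariant_sequence_exact₁ s.ex N (Ext.mk₀ f) (add_zero 1) hf
    obtain ⟨g, rfl⟩ := (Ext.mk₀_bijective _ _).2 x
    refine ⟨g, (Ext.mk₀_bijective _ _).1 ?_⟩
    simpa using hx.symm

/-- Dimension shifting: `Extⁿ⁺¹` of the syzygy `K` is `Extⁿ⁺²` of `M`. -/
theorem IsSyzygyClass.succ {M K L P : FGModuleCat.{u} A} (s : SES M K P) [Projective P] {n : ℕ}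
    {e : Ext K L (n + 1)} (he : IsSyzygyClass e) :
    IsSyzygyClass (s.extCl.comp e (show 1 + (n + 1) = n + 2 by lia)) := by
  obtain ⟨h1, Q, hQ, i, h2⟩ := he
  refine ⟨fun N x => ?_, Q, hQ, i, fun N f hf => h2 N f ?_⟩
  · obtain ⟨y, rfl⟩ := Ext.contravariant_sequence_exact₃ s.ex N x (Subsingleton.elim _ _)
      (show 1 + (n + 1) = n + 2 by lia)
    obtain ⟨f, rfl⟩ := h1 N y
    exact ⟨f, (Ext.comp_assoc_of_third_deg_zero ..).symm⟩
  · rw [Ext.comp_assoc_of_third_deg_zero] at hf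
    obtain ⟨y, hy⟩ := Ext.contravariant_sequence_exact₁ s.ex N _ (show 1 + (n + 1) = n + 2 by lia) hf
    rw [← hy, Subsingleton.elim y 0, Ext.comp_zero]

/-- `f ≫ g` is the identity up to a morphism factoring through a projective module. -/
def StableRetract {K K' : FGModuleCat.{u} A} (f : K ⟶ K') (g : K' ⟶ K) : Prop :=
  ∃ (P : FGModuleCat.{u} A) (_ : Projective P) (i : K ⟶ P) (h : P ⟶ K), 𝟙 K = f ≫ g + i ≫ h

/-- Two modules are stably isomorphic if they become isomorphic after adding projective modules. -/
def StablyIso (M N : FGModuleCat.{u} A) : Prop :=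
  ∃ (P Q : FGModuleCat.{u} A), Projective P ∧ Projective Q ∧ Nonempty (M ⊞ P ≅ N ⊞ Q)

/-- Inverse isomorphisms in the stable category give a stable isomorphism:
`(g, i) : K ⟶ K' ⊞ P` is a split monomorphism with projective cokernel. -/
theorem StableRetract.stablyIso {K K' : FGModuleCat.{u} A} {f : K ⟶ K'} {g : K' ⟶ K}
    (hf : StableRetract f g) (hg : StableRetract g f) : StablyIso K K' := by
  obtain ⟨P, hP, i, h, e⟩ := hf
  obtain ⟨P', hP', i', h', e'⟩ := hg
  let a : K ⟶ K' ⊞ P := biprod.lift f i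
  let b : K' ⊞ P ⟶ K := biprod.desc g h
  have hab : a ≫ b = 𝟙 K := by rw [biprod.lift_desc, e]
  have : Mono a := mono_of_mono_fac hab
  let s := SES.ofMono a
  let sp : (ShortComplex.mk s.i s.p s.w).Splitting :=
    ShortComplex.Splitting.ofExactOfRetraction _ s.ex.exact b hab s.epi_p
  let σ : cokernel a ⟶ K' ⊞ P := sp.s
  have h1 : σ ≫ s.p = 𝟙 _ := sp.s_g
  have h2 : σ ≫ b = 0 := sp.s_r
  have h3 : σ ≫ biprod.fst ≫ g = -(σ ≫ biprod.snd ≫ h) := by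
    have h4 : b = biprod.fst ≫ g + biprod.snd ≫ h := biprod.desc_eq
    rw [h4, Preadditive.comp_add] at h2
    exact eq_neg_of_add_eq_zero_left h2
  refine ⟨cokernel a, P, ?_, hP, ⟨sp.isoBinaryBiproduct.symm⟩⟩
  let x : cokernel a ⟶ P ⊞ P' := biprod.lift (σ ≫ biprod.snd) (σ ≫ biprod.fst ≫ i')
  let y : P ⊞ P' ⟶ cokernel a :=
    biprod.desc (biprod.inr ≫ s.p - h ≫ f ≫ biprod.inl ≫ s.p) (h' ≫ biprod.inl ≫ s.p)
  refine Retract.projective (Y := P ⊞ P') ⟨x, y, ?_⟩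
  have h5 : σ ≫ biprod.fst ≫ biprod.inl ≫ s.p + σ ≫ biprod.snd ≫ biprod.inr ≫ s.p = 𝟙 _ := by
    rw [← h1]
    conv_rhs => rw [← Category.id_comp s.p, ← biprod.total]
    simp only [Preadditive.add_comp, Preadditive.comp_add, Category.assoc]
  have h6 : σ ≫ biprod.fst ≫ biprod.inl ≫ s.p =
      -(σ ≫ biprod.snd ≫ h ≫ f ≫ biprod.inl ≫ s.p) +
        σ ≫ biprod.fst ≫ i' ≫ h' ≫ biprod.inl ≫ s.p := by
    have h7 := congrArg (fun z => (z ≫ f) ≫ biprod.inl ≫ s.p) h3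
    simp only [Category.assoc, Preadditive.neg_comp] at h7
    rw [← h7]
    conv_lhs => rw [← Category.id_comp (biprod.inl ≫ s.p), e']
    simp only [Preadditive.add_comp, Preadditive.comp_add, Category.assoc]
  rw [biprod.lift_desc, ← h5, h6]
  simp only [Preadditive.comp_sub, Category.assoc]
  abel

theorem StableRetract.of_comp_eq {M K K' : FGModuleCat.{u} A} {n : ℕ} {e : Ext M K n}
    (he : IsSyzygyClass e) (f : K ⟶ K') (g : K' ⟶ K)
    (h : e.comp (Ext.mk₀ (f ≫ g)) (add_zero n) = e) : StableRetract f g := by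
  obtain ⟨-, P, hP, i, h2⟩ := he
  have h0 : e.comp (Ext.mk₀ (𝟙 K - f ≫ g)) (add_zero n) = 0 := by
    rw [sub_eq_add_neg, Ext.mk₀_add, Ext.mk₀_neg, Ext.comp_add, Ext.comp_neg, h,
      Ext.comp_mk₀_id, add_neg_cancel]
  obtain ⟨l, hl⟩ := h2 _ _ h0
  exact ⟨P, hP, i, l, by rw [← hl]; abel⟩

/-- A natural isomorphism of `Ext` functors comes from a stable isomorphism of syzygies. -/
theorem exists_stableRetract_of_equiv {M M' K K' : FGModuleCat.{u} A} {n : ℕ} {e : Ext M K n}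
    {e' : Ext M' K' n} (he : IsSyzygyClass e) (he' : IsSyzygyClass e')
    (θ : ∀ N, Ext M N n ≃ Ext M' N n) (hθ : ∀ {N N' : FGModuleCat.{u} A} (f : N ⟶ N')
      (x : Ext M N n), θ N' (x.comp (Ext.mk₀ f) (add_zero n)) =
        (θ N x).comp (Ext.mk₀ f) (add_zero n)) :
    ∃ (f : K ⟶ K') (g : K' ⟶ K), StableRetract f g ∧ StableRetract g f := by
  obtain ⟨g, hg⟩ := he'.1 K (θ K e)
  obtain ⟨f, hf⟩ := he.1 K' ((θ K').symm e')
  refine ⟨f, g, .of_comp_eq he f g ((θ K).injective ?_), .of_comp_eq he' g f ?_⟩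
  · rw [← Ext.mk₀_comp_mk₀, ← Ext.comp_assoc_of_third_deg_zero, ← hf, hθ, Equiv.apply_symm_apply, hg]
  · rw [← Ext.mk₀_comp_mk₀, ← Ext.comp_assoc_of_third_deg_zero, ← hg, ← hθ, ← hf,
      Equiv.apply_symm_apply]

/-- A stable retraction of syzygies of Gorenstein projective modules descends to these modules: the
factorization through a projective module extends from `K` to `P`. -/
theorem StableRetract.of_ses {G K P G' K' P' : FGModuleCat.{u} A} (s : SES G K P)
    (s' : SES G' K' P') (hG : ExtProj G) {f : K ⟶ K'} {g : K' ⟶ K} (h : StableRetract f g)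
    {α : P ⟶ P'} (hα : s.i ≫ α = f ≫ s'.i) {β : P' ⟶ P} (hβ : s'.i ≫ β = g ≫ s.i)
    {F : G ⟶ G'} (hF : s.p ≫ F = α ≫ s'.p) {F' : G' ⟶ G} (hF' : s'.p ≫ F' = β ≫ s.p)
    [Projective P] : StableRetract F F' := by
  obtain ⟨Q, hQ, i, l, e⟩ := h
  have := hG Q hQ
  obtain ⟨j, hj⟩ := s.exists_extend i
  have h0 : s.i ≫ (𝟙 P - α ≫ β - j ≫ l ≫ s.i) = 0 := by
    rw [Preadditive.comp_sub, Preadditive.comp_sub, reassoc_of% hα, hβ, reassoc_of% hj,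
      Category.comp_id]
    have h1 := congrArg (fun z => z ≫ s.i) e
    simp only [Category.id_comp, Preadditive.add_comp, Category.assoc] at h1
    rw [sub_sub, ← h1, sub_self]
  let w : G ⟶ P := s.ex.exact.desc _ h0
  have hw : s.p ≫ w = 𝟙 P - α ≫ β - j ≫ l ≫ s.i := s.ex.exact.g_desc _ h0
  refine ⟨P, inferInstance, w, s.p, ?_⟩
  rw [← cancel_epi s.p, Preadditive.comp_add, reassoc_of% hF, hF', reassoc_of% hw]
  simp [Preadditive.sub_comp]

/-- Gorenstein projective modules with stably isomorphic syzygies are stably isomorphic. -/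
theorem exists_stableRetract_of_ses {G K P G' K' P' : FGModuleCat.{u} A} (s : SES G K P)
    (s' : SES G' K' P') [Projective P] [Projective P'] (hG : ExtProj G) (hG' : ExtProj G')
    (h : ∃ (f : K ⟶ K') (g : K' ⟶ K), StableRetract f g ∧ StableRetract g f) :
    ∃ (f : G ⟶ G') (g : G' ⟶ G), StableRetract f g ∧ StableRetract g f := by
  obtain ⟨f, g, hf, hg⟩ := h
  have := hG P' inferInstance
  have := hG' P inferInstance
  obtain ⟨α, hα⟩ := s.exists_extend (f ≫ s'.i)
  obtain ⟨β, hβ⟩ := s'.exists_extend (g ≫ s.i)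
  have h1 : s.i ≫ α ≫ s'.p = 0 := by rw [reassoc_of% hα, s'.w, comp_zero]
  have h2 : s'.i ≫ β ≫ s.p = 0 := by rw [reassoc_of% hβ, s.w, comp_zero]
  have hF := s.ex.exact.g_desc _ h1
  have hF' := s'.ex.exact.g_desc _ h2
  exact ⟨s.ex.exact.desc _ h1, s'.ex.exact.desc _ h2, .of_ses s s' hG hf hα hβ hF hF',
    .of_ses s' s hG' hg hβ hα hF' hF⟩

/-- `K` is an `n`-th syzygy of `M`. -/
inductive IsSyzygy : ℕ → FGModuleCat.{u} A → FGModuleCat.{u} A → Prop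
  | zero (M) : IsSyzygy 0 M M
  | succ {n M L K P} (s : SES M L P) (hP : Projective P) (h : IsSyzygy n L K) :
      IsSyzygy (n + 1) M K

theorem exists_isSyzygy (n : ℕ) (M : FGModuleCat.{u} A) : ∃ K, IsSyzygy n M K := by
  induction n generalizing M with
  | zero => exact ⟨M, .zero M⟩
  | succ n ih =>
    obtain ⟨P, L, s, hP⟩ := exists_cover M
    obtain ⟨K, hK⟩ := ih L
    exact ⟨K, .succ s hP hK⟩

theorem IsSyzygy.exists_class {n : ℕ} {M K : FGModuleCat.{u} A} (h : IsSyzygy (n + 1) M K) :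
    ∃ e : Ext M K (n + 1), IsSyzygyClass e := by
  induction n generalizing M with
  | zero =>
    obtain _ | ⟨s, hP, ⟨⟩⟩ := h
    exact ⟨_, s.isSyzygyClass⟩
  | succ n ih =>
    obtain _ | ⟨s, hP, h⟩ := h
    obtain ⟨e, he⟩ := ih h
    exact ⟨_, IsSyzygyClass.succ s he⟩

theorem IsSyzygy.exists_stableRetract [Gorenstein A] {n : ℕ} {G G' K K' : FGModuleCat.{u} A}
    (h : IsSyzygy n G K) (h' : IsSyzygy n G' K') (hG : ExtProj G) (hG' : ExtProj G')
    (hK : ∃ (f : K ⟶ K') (g : K' ⟶ K), StableRetract f g ∧ StableRetract g f) :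
    ∃ (f : G ⟶ G') (g : G' ⟶ G), StableRetract f g ∧ StableRetract g f := by
  induction n generalizing G G' with
  | zero =>
    obtain ⟨⟩ := h
    obtain ⟨⟩ := h'
    exact hK
  | succ n ih =>
    obtain _ | ⟨s, hP, h⟩ := h
    obtain _ | ⟨s', hP', h'⟩ := h'
    exact exists_stableRetract_of_ses s s' hG hG'
      (ih h h' ((ExtProj.of_projective _).sub s) ((ExtProj.of_projective _).sub s'))

/-- Gorenstein projective modules which are isomorphic in the singularity category are stably
isomorphic. -/
theorem stablyIso_of_sgClass_eq [Gorenstein A] {G G' : FGModuleCat.{u} A} (hG : ExtProj G)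
    (hG' : ExtProj G') (h : sgClass G = sgClass G') : StablyIso G G' := by
  obtain ⟨m, hm⟩ := exists_ext_equiv h
  obtain ⟨θ, hθ⟩ := hm (m + 1) (by lia)
  obtain ⟨K, hK⟩ := exists_isSyzygy (m + 1) G
  obtain ⟨K', hK'⟩ := exists_isSyzygy (m + 1) G'
  obtain ⟨e, he⟩ := hK.exists_class
  obtain ⟨e', he'⟩ := hK'.exists_class
  obtain ⟨f, g, hf, hg⟩ := hK.exists_stableRetract hK' hG hG'
    (exists_stableRetract_of_equiv he he' θ hθ)
  exact hf.stablyIso hg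

/-! ### Cancellation of direct summands -/

/-- The homomorphisms with kernel `K` are the monomorphisms out of the quotient by `K`. -/
theorem card_hom_eq_sum (X M : FGModuleCat.{u} A) : ∃ _ : Fintype (Submodule A X),
    Nat.card (X ⟶ M) = ∑ K : Submodule A X,
      Nat.card {f : FGModuleCat.of A (X ⧸ K) ⟶ M // Function.Injective f.hom.hom} := by
  have : Finite (Submodule A X) := Finite.of_injective _ SetLike.coe_injective
  let _ := Fintype.ofFinite (Submodule A X)
  refine ⟨inferInstance, ?_⟩
  rw [← Nat.card_congr (Equiv.sigmaFiberEquiv fun f : X ⟶ M => LinearMap.ker f.hom.hom),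
    Nat.card_sigma]
  refine Finset.sum_congr rfl fun K _ => Nat.card_congr (Equiv.ofBijective
    (fun f => ⟨FGModuleCat.ofHom (K.liftQ f.1.hom.hom f.2.ge), ?_⟩) ⟨?_, ?_⟩)
  · exact LinearMap.ker_eq_bot.1 (Submodule.ker_liftQ_eq_bot _ _ _ f.2.le)
  · rintro ⟨f, hf⟩ ⟨g, hg⟩ h
    have h' := congrArg (fun x => x.1.hom.hom) h
    refine Subtype.ext ?_
    ext x
    exact LinearMap.congr_fun h' (Submodule.Quotient.mk x)
  · rintro ⟨f, hf⟩
    refine ⟨⟨FGModuleCat.ofHom (f.hom.hom ∘ₗ K.mkQ), ?_⟩, ?_⟩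
    · change LinearMap.ker (f.hom.hom ∘ₗ K.mkQ) = K
      rw [LinearMap.ker_comp, LinearMap.ker_eq_bot.2 hf, Submodule.comap_bot, Submodule.ker_mkQ]
    · refine Subtype.ext ?_
      refine ConcreteCategory.hom_ext _ _ fun y => ?_
      obtain ⟨y, rfl⟩ := Submodule.mkQ_surjective K y
      rfl

/-- The numbers of homomorphisms determine the numbers of monomorphisms, by induction on the source:
sort the homomorphisms by their kernels. -/
theorem card_mono_eq {M N : FGModuleCat.{u} A}
    (h : ∀ X : FGModuleCat.{u} A, Nat.card (X ⟶ M) = Nat.card (X ⟶ N)) (X : FGModuleCat.{u} A) :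
    Nat.card {f : X ⟶ M // Function.Injective f.hom.hom} =
      Nat.card {f : X ⟶ N // Function.Injective f.hom.hom} := by
  classical
  induction hn : Nat.card X using Nat.strong_induction_on generalizing X with
  | _ n ih =>
    obtain ⟨i, hM⟩ := card_hom_eq_sum X M
    obtain ⟨i', hN⟩ := card_hom_eq_sum X N
    obtain rfl : i = i' := Subsingleton.elim _ _
    have e := h X
    rw [hM, hN, ← Finset.add_sum_erase _ _ (Finset.mem_univ ⊥),
      ← Finset.add_sum_erase (a := ⊥) _ _ (Finset.mem_univ ⊥)] at e
    rw [Finset.sum_congr rfl (g := fun K : Submodule A X =>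
      Nat.card {f : FGModuleCat.of A (X ⧸ K) ⟶ N // Function.Injective f.hom.hom})] at e
    · have key (Y : FGModuleCat.{u} A) :
          Nat.card {f : FGModuleCat.of A (X ⧸ (⊥ : Submodule A X)) ⟶ Y //
            Function.Injective f.hom.hom} = Nat.card {f : X ⟶ Y // Function.Injective f.hom.hom} := by
        let ε : FGModuleCat.of A (X ⧸ (⊥ : Submodule A X)) ≅ X :=
          (Submodule.quotEquivOfEqBot (⊥ : Submodule A X) rfl).toFGModuleCatIso
        refine Nat.card_congr (Equiv.subtypeEquiv (ε.homCongr (Iso.refl Y)) fun f => ?_)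
        rw [← mono_iff_injective, ← mono_iff_injective, Iso.homCongr_apply]
        constructor
        · intro _; exact inferInstance
        · intro h
          have : f = ε.hom ≫ (ε.inv ≫ f ≫ (Iso.refl Y).hom) := by simp
          rw [this]; exact mono_comp _ _
      rw [← key, ← key]
      exact Nat.add_right_cancel e
    · intro K hK
      refine ih _ ?_ _ rfl
      have hK' : K ≠ ⊥ := Finset.ne_of_mem_erase hK
      have h1 := K.card_eq_card_quotient_mul_card
      have h2 : 1 < Nat.card K := by
        have := (Submodule.nontrivial_iff_ne_bot).2 hK'
        exact Finite.one_lt_card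
      have h3 : 0 < Nat.card (X ⧸ K) :=
        have : Finite (X ⧸ K) := Finite.of_surjective _ (Submodule.mkQ_surjective K)
        Nat.card_pos
      change Nat.card (X ⧸ K) < n
      rw [← hn, h1]
      nlinarith

/-- Finite modules are determined by the numbers of homomorphisms into them: these numbers
determine the numbers of monomorphisms, and finite modules embedding into each other are
isomorphic. -/
theorem iso_of_card_hom_eq {M N : FGModuleCat.{u} A}
    (h : ∀ X : FGModuleCat.{u} A, Nat.card (X ⟶ M) = Nat.card (X ⟶ N)) : Nonempty (M ≅ N) := by
  have key {M N : FGModuleCat.{u} A} (h : ∀ X : FGModuleCat.{u} A,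
      Nat.card (X ⟶ M) = Nat.card (X ⟶ N)) : ∃ f : M ⟶ N, Function.Injective f.hom.hom := by
    have : Nonempty {f : M ⟶ M // Function.Injective f.hom.hom} :=
      ⟨𝟙 M, fun _ _ h => h⟩
    have hpos : 0 < Nat.card {f : M ⟶ M // Function.Injective f.hom.hom} := Nat.card_pos
    rw [card_mono_eq h] at hpos
    obtain ⟨⟨f⟩, -⟩ := Nat.card_pos_iff.1 hpos
    exact ⟨f.1, f.2⟩
  obtain ⟨f, hf⟩ := key h
  obtain ⟨g, hg⟩ := key fun X => (h X).symm
  have hb : Function.Bijective f.hom.hom :=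
    (Nat.bijective_iff_injective_and_card _).2 ⟨hf, le_antisymm
      (Nat.card_le_card_of_injective _ hf) (Nat.card_le_card_of_injective _ hg)⟩
  exact ⟨(LinearEquiv.ofBijective f.hom.hom hb).toFGModuleCatIso⟩

theorem card_hom_biprod (X M N : FGModuleCat.{u} A) :
    Nat.card (X ⟶ M ⊞ N) = Nat.card (X ⟶ M) * Nat.card (X ⟶ N) := by
  rw [← Nat.card_prod]
  exact Nat.card_congr
    { toFun := fun f => (f ≫ biprod.fst, f ≫ biprod.snd), invFun := fun p => biprod.lift p.1 p.2,
      left_inv := fun f => by apply biprod.hom_ext <;> simp, right_inv := fun p => by simp }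

theorem card_biprod_hom (X M N : FGModuleCat.{u} A) :
    Nat.card (M ⊞ N ⟶ X) = Nat.card (M ⟶ X) * Nat.card (N ⟶ X) := by
  rw [← Nat.card_prod]
  exact Nat.card_congr
    { toFun := fun f => (biprod.inl ≫ f, biprod.inr ≫ f), invFun := fun p => biprod.desc p.1 p.2,
      left_inv := fun f => by apply biprod.hom_ext' <;> simp, right_inv := fun p => by simp }

theorem biprod_cancel_left {M N P : FGModuleCat.{u} A} (e : P ⊞ M ≅ P ⊞ N) : Nonempty (M ≅ N) := by
  refine iso_of_card_hom_eq fun X => ?_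
  have h := Nat.card_congr ((Iso.refl X).homCongr e)
  rw [card_hom_biprod, card_hom_biprod] at h
  exact Nat.eq_of_mul_eq_mul_left (card_hom_pos X P) h

theorem biprod_cancel_right {M N P : FGModuleCat.{u} A} (e : M ⊞ P ≅ N ⊞ P) :
    Nonempty (M ≅ N) :=
  biprod_cancel_left (biprod.braiding P M ≪≫ e ≪≫ biprod.braiding N P)

/-! ### The Hall algebra of the Gorenstein projective modules embeds into its localization -/

theorem linearIndependent_smul {ι κ W : Type*} [AddCommMonoid W] [Module ℚ W] {v : κ → W}
    (hv : LinearIndependent ℚ v) {σ : ι → κ} (hσ : Function.Injective σ) (c : ι → ℚ)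
    (hc : ∀ i, c i ≠ 0) : LinearIndependent ℚ fun i => c i • v (σ i) :=
  letI : AddCommGroup W := Module.addCommMonoidToAddCommGroup ℚ
  (hv.comp σ hσ).units_smul fun i => Units.mk0 (c i) (hc i)

/-- A linear map sending a basis to nonzero multiples of distinct linearly independent vectors is
injective. -/
theorem injective_of_basis {ι κ V W : Type*} [AddCommMonoid V] [Module ℚ V] [AddCommMonoid W]
    [Module ℚ W] (b : Module.Basis ι ℚ V) {v : κ → W} (hv : LinearIndependent ℚ v) (f : V →ₗ[ℚ] W)
    (c : ι → ℚ) (hc : ∀ i, c i ≠ 0) {σ : ι → κ} (hσ : Function.Injective σ)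
    (hf : ∀ i, f (b i) = c i • v (σ i)) : Function.Injective f := by
  have h1 : LinearIndependent ℚ (f ∘ b) := by
    rw [show f ∘ b = _ from funext hf]
    exact linearIndependent_smul hv hσ c hc
  intro x y h
  rw [← b.linearCombination_repr x, ← b.linearCombination_repr y, Finsupp.apply_linearCombination,
    Finsupp.apply_linearCombination] at h
  exact b.repr.injective (h1 h)

section
variable [Gorenstein A]

theorem HallAlg.cl_mul_projective {G P : FGModuleCat.{u} A} (hG : ExtProj G) [Projective P] :
    HallAlg.cl (gproj A) G * HallAlg.cl (gproj A) P =
      (ef G P)⁻¹ • HallAlg.cl (gproj A) (P ⊞ G) := by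
  have := hG P inferInstance
  rw [HallAlg.cl_biprod (gproj_iff.2 hG) (gproj_of_projective P), smul_smul,
    inv_mul_cancel₀ (ef_ne _ _), one_smul]

theorem HallAlg.projective_mul_cl {G P : FGModuleCat.{u} A} (hG : ExtProj G) [Projective P] :
    HallAlg.cl (gproj A) P * HallAlg.cl (gproj A) G =
      (ef P G)⁻¹ • HallAlg.cl (gproj A) (G ⊞ P) := by
  rw [HallAlg.cl_biprod (gproj_of_projective P) (gproj_iff.2 hG), smul_smul,
    inv_mul_cancel₀ (ef_ne _ _), one_smul]

theorem HallAlg.mul_projective_injective (P : FGModuleCat.{u} A) [Projective P] :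
    Function.Injective fun x : HallAlg (gproj A) => x * HallAlg.cl (gproj A) P := by
  have hmem (x : IsoCl (gproj A)) : gproj A (P ⊞ x.rep) := gproj_iff.2
    (ExtProj.mid (SES.split P x.rep) (.of_projective P) (gproj_iff.1 x.rep_mem))
  refine injective_of_basis HallAlg.basis HallAlg.basis.linearIndependent
    (LinearMap.mulRight ℚ (HallAlg.cl (gproj A) P)) (fun x => (ef x.rep P)⁻¹)
    (fun x => inv_ne_zero (ef_ne _ _)) (σ := fun x => IsoCl.mk (P ⊞ x.rep) (hmem x)) ?_ ?_
  · intro x y h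
    obtain ⟨e⟩ := IsoCl.mk_eq_iff.1 h
    obtain ⟨e'⟩ := biprod_cancel_left e
    exact IsoCl.eq_of_iso e'
  · intro x
    rw [LinearMap.mulRight_apply, HallAlg.basis_eq_cl,
      HallAlg.cl_mul_projective (gproj_iff.1 x.rep_mem), HallAlg.cl_eq (hmem x)]
    rfl

theorem HallAlg.projective_mul_injective (P : FGModuleCat.{u} A) [Projective P] :
    Function.Injective fun x : HallAlg (gproj A) => HallAlg.cl (gproj A) P * x := by
  have hmem (x : IsoCl (gproj A)) : gproj A (x.rep ⊞ P) := gproj_iff.2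
    (ExtProj.mid (SES.split x.rep P) (gproj_iff.1 x.rep_mem) (.of_projective P))
  refine injective_of_basis HallAlg.basis HallAlg.basis.linearIndependent
    (LinearMap.mulLeft ℚ (HallAlg.cl (gproj A) P)) (fun x => (ef P x.rep)⁻¹)
    (fun x => inv_ne_zero (ef_ne _ _)) (σ := fun x => IsoCl.mk (x.rep ⊞ P) (hmem x)) ?_ ?_
  · intro x y h
    obtain ⟨e⟩ := IsoCl.mk_eq_iff.1 h
    obtain ⟨e'⟩ := biprod_cancel_right e
    exact IsoCl.eq_of_iso e'
  · intro x
    rw [LinearMap.mulLeft_apply, HallAlg.basis_eq_cl,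
      HallAlg.projective_mul_cl (gproj_iff.1 x.rep_mem), HallAlg.cl_eq (hmem x)]
    rfl

/-- The class of a projective module is normal in the Hall algebra. -/
theorem HallAlg.exists_projective_mul_eq (P : FGModuleCat.{u} A) [Projective P]
    (x : HallAlg (gproj A)) :
    ∃ y, HallAlg.cl (gproj A) P * x = y * HallAlg.cl (gproj A) P := by
  let φ : HallAlg (gproj A) →ₗ[ℚ] HallAlg (gproj A) := HallAlg.basis.constr ℚ fun z =>
    ((ef P z.rep)⁻¹ * ef z.rep P) • HallAlg.basis z
  refine ⟨φ x, ?_⟩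
  have : LinearMap.mulLeft ℚ (HallAlg.cl (gproj A) P) =
      LinearMap.mulRight ℚ (HallAlg.cl (gproj A) P) ∘ₗ φ := by
    refine HallAlg.basis.ext fun z => ?_
    have hz := gproj_iff.1 z.rep_mem
    have hmem : gproj A (P ⊞ z.rep) := gproj_iff.2
      (ExtProj.mid (SES.split P z.rep) (.of_projective P) hz)
    have hmem' : gproj A (z.rep ⊞ P) := gproj_iff.2
      (ExtProj.mid (SES.split z.rep P) hz (.of_projective P))
    rw [LinearMap.comp_apply, Module.Basis.constr_basis, map_smul, LinearMap.mulLeft_apply,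
      LinearMap.mulRight_apply, HallAlg.basis_eq_cl, HallAlg.projective_mul_cl hz,
      HallAlg.cl_mul_projective hz, smul_smul, mul_assoc, mul_inv_cancel₀ (ef_ne _ _), mul_one,
      HallAlg.cl_congr hmem' hmem (biprod.braiding _ _)]
  exact LinearMap.congr_fun this x

/-- The nonzero multiples of the classes of projective modules. -/
def projectiveClasses (A : Type u) [Ring A] [Finite A] [Gorenstein A] :
    Submonoid (HallAlg (gproj A)) where
  carrier := {x | ∃ (c : ℚ) (P : FGModuleCat.{u} A), c ≠ 0 ∧ Projective P ∧
    x = c • HallAlg.cl (gproj A) P}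
  mul_mem' := by
    rintro _ _ ⟨c, P, hc, hP, rfl⟩ ⟨d, Q, hd, hQ, rfl⟩
    refine ⟨c * d * (ef P Q)⁻¹, Q ⊞ P, mul_ne_zero (mul_ne_zero hc hd) (inv_ne_zero (ef_ne _ _)),
      inferInstance, ?_⟩
    rw [smul_mul_smul_comm, HallAlg.cl_mul_projective (.of_projective P), smul_smul]
  one_mem' := by
    obtain ⟨Z, hZ⟩ := HasZeroObject.zero (C := FGModuleCat.{u} A)
    have : Projective Z := hZ.projective
    exact ⟨1, Z, one_ne_zero, inferInstance,
      by rw [one_smul, HallAlg.one_eq (gproj_of_projective Z) hZ]⟩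

theorem mul_projectiveClasses_injective (s : projectiveClasses A) :
    Function.Injective fun x : HallAlg (gproj A) => x * s := by
  obtain ⟨_, c, P, hc, hP, rfl⟩ := s
  intro x y h
  simp only [mul_smul_comm] at h
  exact HallAlg.mul_projective_injective P (smul_right_injective _ hc h)

theorem exists_projectiveClasses_mul_eq (s : projectiveClasses A) (x : HallAlg (gproj A)) :
    ∃ y, (s : HallAlg (gproj A)) * x = y * s := by
  obtain ⟨_, c, P, hc, hP, rfl⟩ := s
  obtain ⟨y, hy⟩ := HallAlg.exists_projective_mul_eq P x
  exact ⟨y, by rw [smul_mul_assoc, hy, mul_smul_comm]⟩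

noncomputable instance : OreLocalization.OreSet (projectiveClasses A) where
  ore_right_cancel r₁ r₂ s h := ⟨1, by rw [mul_projectiveClasses_injective s h]⟩
  oreNum r s := (exists_projectiveClasses_mul_eq s r).choose
  oreDenom _ s := s
  ore_eq r s := (exists_projectiveClasses_mul_eq s r).choose_spec

/-- The Hall algebra of the Gorenstein projective modules embeds into its universal localization, as
it embeds into its Ore localization. -/
theorem toLoc_gproj_injective : Function.Injective (toLoc (projInjClasses (gproj A))) := by
  let j : HallAlg (gproj A) →ₐ[ℚ] OreLocalization (projectiveClasses A) (HallAlg (gproj A)) :=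
    { OreLocalization.numeratorRingHom with commutes' := fun r => rfl }
  have hj : ∀ s ∈ projInjClasses (gproj A), IsUnit (j s) := by
    rintro _ ⟨P, hP, h1, -, rfl⟩
    have := projective_of_isExactProjective hP h1
    exact OreLocalization.numerator_isUnit (⟨HallAlg.cls P hP, 1, P, one_ne_zero, this,
      by rw [one_smul, HallAlg.cl_eq hP]⟩ : projectiveClasses A)
  have hinj : Function.Injective j := by
    refine OreLocalization.numeratorHom_inj fun s hs => ?_
    rw [mem_nonZeroDivisorsLeft_iff]
    obtain ⟨c, P, hc, hP, rfl⟩ := hs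
    intro x hx
    rw [smul_mul_assoc, smul_eq_zero_iff_right hc] at hx
    exact HallAlg.projective_mul_injective P (hx.trans (mul_zero _).symm)
  intro x y h
  apply hinj
  rw [← Loc.lift_toLoc j hj, ← Loc.lift_toLoc j hj, h]

/-- The composition with the map to the semi-derived Hall algebra is the localization map. -/
theorem gprojToModified_injective : Function.Injective (gprojToModified A) := by
  have : (toSemiDerived A).comp (gprojToModified A) = toLoc (projInjClasses (gproj A)) := by
    refine AlgHom.toLinearMap_injective (HallAlg.hom_ext fun G hG => ?_)
    change toSemiDerived A (gprojToModified A _) = _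
    rw [gprojToModified_cl hG, toSemiDerived_cls, resCl_eq_gcl (gproj_iff.1 hG)]
    rfl
  refine Function.Injective.of_comp (f := toSemiDerived A) ?_
  rw [← AlgHom.coe_comp, this]
  exact toLoc_gproj_injective

end

/-! ### Grothendieck groups -/

section
variable {E : ObjectProperty (FGModuleCat.{u} A)}

/-- Additive functions on objects extend to the Grothendieck group. -/
noncomputable def K0.lift {B : Type*} [AddCommGroup B] (f : FGModuleCat.{u} A → B)
    (hf : ∀ {M N L : FGModuleCat.{u} A}, SES M N L → E M → E N → E L → f L = f N + f M) :
    K0 E →+ B :=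
  QuotientAddGroup.lift _ (FreeAbelianGroup.lift fun x : IsoCl E => f x.rep) <| by
    rw [AddSubgroup.closure_le]
    rintro _ ⟨S, hS, h₁, h₂, h₃, rfl⟩
    obtain ⟨e₁⟩ := IsoCl.rep_mk S.X₁ h₁
    obtain ⟨e₂⟩ := IsoCl.rep_mk S.X₂ h₂
    obtain ⟨e₃⟩ := IsoCl.rep_mk S.X₃ h₃
    have s : SES S.X₃ S.X₁ S.X₂ := ⟨S.f, S.g, S.zero, hS⟩
    simp only [SetLike.mem_coe, AddMonoidHom.mem_ker, map_sub, map_add,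
      FreeAbelianGroup.lift_apply_of]
    rw [hf (((s.congrLeft e₁.symm).congrRight e₃.symm).congrMid e₂.symm) (IsoCl.rep_mem _)
      (IsoCl.rep_mem _) (IsoCl.rep_mem _), sub_self]

theorem K0.cls_mid {M N L : FGModuleCat.{u} A} (s : SES M N L) (hM : E M) (hN : E N) (hL : E L) :
    K0.cls L hL = K0.cls N hN + K0.cls M hM := by
  rw [← sub_eq_zero]
  exact (QuotientAddGroup.eq_zero_iff _).2 (AddSubgroup.subset_closure
    ⟨ShortComplex.mk s.i s.p s.w, s.ex, hN, hL, hM, rfl⟩)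

theorem K0.cls_congr {M N : FGModuleCat.{u} A} (e : M ≅ N) (hM : E M) (hN : E N) :
    K0.cls M hM = K0.cls N hN := by
  rw [K0.cls, K0.cls, IsoCl.mk_eq_iff.2 ⟨e⟩]

theorem K0.lift_cls {B : Type*} [AddCommGroup B] (f : FGModuleCat.{u} A → B)
    (hf : ∀ {M N L : FGModuleCat.{u} A}, SES M N L → E M → E N → E L → f L = f N + f M)
    (hf' : ∀ {M N : FGModuleCat.{u} A}, (M ≅ N) → f M = f N) {M : FGModuleCat.{u} A} (hM : E M) :
    K0.lift f hf (K0.cls M hM) = f M := by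
  change FreeAbelianGroup.lift (fun x : IsoCl E => f x.rep) (FreeAbelianGroup.of _) = _
  rw [FreeAbelianGroup.lift_apply_of]
  exact hf' (IsoCl.rep_mk M hM).some

theorem K0.induction {p : K0 E → Prop} (h0 : p 0) (hcls : ∀ M hM, p (K0.cls M hM))
    (hneg : ∀ x, p x → p (-x)) (hadd : ∀ x y, p x → p y → p (x + y)) (x : K0 E) : p x := by
  obtain ⟨x, rfl⟩ := QuotientAddGroup.mk_surjective x
  induction x using FreeAbelianGroup.induction_on with
  | zero => exact h0
  | of x => rw [← x.mk_rep]; exact hcls _ _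
  | neg x h => exact hneg _ h
  | add x y hx hy => exact hadd _ _ hx hy

end

theorem K0.span_eq_top {E : ObjectProperty (FGModuleCat.{u} A)} {t : Set (K0 E)}
    (h : ∀ M hM, K0.cls M hM ∈ Submodule.span ℤ t) : ⊤ ≤ Submodule.span ℤ t :=
  fun x _ => K0.induction (zero_mem _) h (fun _ hx => neg_mem hx) (fun _ _ hx hy => add_mem hx hy) x

theorem K0.cls_zero {E : ObjectProperty (FGModuleCat.{u} A)} {Z : FGModuleCat.{u} A}
    (hZ : IsZero Z) (hE : E Z) : K0.cls Z hE = 0 := by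
  have h := K0.cls_mid ((SES.split Z Z).congrMid (IsZero.iso ((biprod_isZero_iff Z Z).2 ⟨hZ, hZ⟩) hZ))
    hE hE hE
  simpa using h

/-! ### Simple modules and their projective covers -/

theorem card_lt_of_mono {M N : FGModuleCat.{u} A} (f : M ⟶ N) [Mono f] (hf : ¬ IsIso f) :
    Nat.card M < Nat.card N := by
  have hi := (mono_iff_injective f).1 inferInstance
  refine lt_of_le_of_ne (Nat.card_le_card_of_injective _ hi) fun h => hf ?_
  have := (epi_iff_surjective f).2 ((Nat.bijective_iff_injective_and_card _).2 ⟨hi, h⟩).2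
  exact isIso_of_mono_of_epi f

theorem isIso_of_epi_of_card_le {M N : FGModuleCat.{u} A} (f : M ⟶ N) [Epi f]
    (h : Nat.card M ≤ Nat.card N) : IsIso f := by
  have hs := (epi_iff_surjective f).1 inferInstance
  have := (mono_iff_injective f).2 ((Nat.bijective_iff_surjective_and_card _).2
    ⟨hs, le_antisymm h (Nat.card_le_card_of_surjective _ hs)⟩).1
  exact isIso_of_mono_of_epi f

theorem SES.card_lt {M N L : FGModuleCat.{u} A} (s : SES M N L) (hM : ¬ IsZero M) :
    Nat.card N < Nat.card L := by
  refine card_lt_of_mono s.i fun h => hM ?_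
  have : s.p = 0 := by rw [← cancel_epi s.i, s.w, comp_zero]
  exact IsZero.of_epi_eq_zero s.p this

/-- A nonzero module has a simple quotient. -/
theorem exists_simple_quotient {M : FGModuleCat.{u} A} (hM : ¬ IsZero M) :
    ∃ (S : FGModuleCat.{u} A) (f : M ⟶ S), Simple S ∧ Epi f := by
  have hex : ∃ n, ∃ (S : FGModuleCat.{u} A) (f : M ⟶ S), ¬ IsZero S ∧ Epi f ∧ Nat.card S = n :=
    ⟨_, M, 𝟙 M, hM, inferInstance, rfl⟩
  classical
  obtain ⟨S, f, hS, hf, hn⟩ := Nat.find_spec hex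
  refine ⟨S, f, ⟨fun {Y} g _ => ⟨fun h h0 => hS ?_, fun h => ?_⟩⟩, hf⟩
  · exact IsZero.of_epi_eq_zero g h0
  · by_contra hg
    have s := SES.ofMono g
    have hY : ¬ IsZero Y := fun hY => h (hY.eq_of_src _ _)
    have hlt : Nat.card (cokernel g : FGModuleCat.{u} A) < Nat.card S := by
      have h1 := card_middle s
      have h2 : 1 < Nat.card Y := by
        by_contra h2
        have : Nat.card Y = 1 := le_antisymm (not_lt.1 h2) Nat.card_pos
        have := (Nat.card_eq_one_iff_unique.1 this).1
        refine h (ConcreteCategory.hom_ext _ _ fun y => ?_)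
        rw [Subsingleton.elim y 0, map_zero, map_zero]
      have h3 : 0 < Nat.card (cokernel g : FGModuleCat.{u} A) := Nat.card_pos
      rw [h1]
      nlinarith
    refine Nat.find_min hex (hn ▸ hlt) ⟨_, f ≫ cokernel.π g, fun h0 => hg ?_, epi_comp _ _, rfl⟩
    have : Epi g := Preadditive.epi_of_isZero_cokernel g h0
    exact isIso_of_mono_of_epi g

/-- `π : P ⟶ S` is a projective cover of the simple module `S`, in the form of a minimality
condition on `P`. -/
structure IsCover {P S : FGModuleCat.{u} A} (π : P ⟶ S) : Prop where
  projective : Projective P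
  simple : Simple S
  epi : Epi π
  card_le : ∀ (Q : FGModuleCat.{u} A) (f : Q ⟶ S), Projective Q → Epi f → Nat.card P ≤ Nat.card Q

theorem exists_isCover (S : FGModuleCat.{u} A) [Simple S] :
    ∃ (P : FGModuleCat.{u} A) (π : P ⟶ S), IsCover π := by
  have hex : ∃ n, ∃ (P : FGModuleCat.{u} A) (f : P ⟶ S), Projective P ∧ Epi f ∧ Nat.card P = n := by
    obtain ⟨n, f, hf⟩ := exists_free_epi S
    exact ⟨_, _, f, inferInstance, hf, rfl⟩
  classical
  obtain ⟨P, f, hP, hf, hn⟩ := Nat.find_spec hex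
  refine ⟨P, f, hP, inferInstance, hf, fun Q g hQ hg => ?_⟩
  rw [hn]
  exact Nat.find_min' hex ⟨Q, g, hQ, hg, rfl⟩

/-- By Fitting's lemma, an endomorphism of a projective cover of `S` over `S` is invertible. -/
theorem IsCover.isIso {P S : FGModuleCat.{u} A} {π : P ⟶ S} (h : IsCover π) (e : P ⟶ P)
    (he : e ≫ π = π) : IsIso e := by
  have := h.projective
  have := h.epi
  obtain ⟨n, hn1, hn⟩ := ((LinearMap.eventually_isCompl_ker_pow_range_pow e.hom.hom).and
    (Filter.eventually_ge_atTop 1)).exists.imp fun n h => And.symm h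
  let r : P ⟶ FGModuleCat.of A (LinearMap.range (e.hom.hom ^ n)) :=
    FGModuleCat.ofHom (LinearMap.rangeRestrict (e.hom.hom ^ n))
  let ρ : FGModuleCat.of A (LinearMap.range (e.hom.hom ^ n)) ⟶ P :=
    FGModuleCat.ofHom (LinearMap.range (e.hom.hom ^ n)).subtype
  let pr : P ⟶ FGModuleCat.of A (LinearMap.range (e.hom.hom ^ n)) :=
    FGModuleCat.ofHom (Submodule.projectionOnto _ _ hn.symm)
  have hret : ρ ≫ pr = 𝟙 _ := by
    refine ConcreteCategory.hom_ext _ _ fun x => ?_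
    exact Submodule.projectionOnto_apply_left hn.symm x
  have hproj : Projective (FGModuleCat.of A (LinearMap.range (e.hom.hom ^ n))) :=
    Retract.projective ⟨ρ, pr, hret⟩
  have hpow (m : ℕ) (x : P) : π.hom.hom ((e.hom.hom ^ m) x) = π.hom.hom x := by
    induction m with
    | zero => rfl
    | succ m ih =>
      rw [pow_succ', Module.End.mul_apply, ← ih]
      exact congrArg (fun f => f.hom.hom ((e.hom.hom ^ m) x)) he
  have hr : r ≫ ρ ≫ π = π := ConcreteCategory.hom_ext _ _ fun x => hpow n x
  have hepi : Epi (ρ ≫ π) := epi_of_epi_fac hr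
  have hle := h.card_le _ (ρ ≫ π) hproj hepi
  have htop : LinearMap.range (e.hom.hom ^ n) = ⊤ := by
    rw [← Submodule.range_subtype (LinearMap.range (e.hom.hom ^ n)), LinearMap.range_eq_top]
    exact ((Nat.bijective_iff_injective_and_card _).2 ⟨Subtype.coe_injective,
      le_antisymm (Nat.card_le_card_of_injective _ Subtype.coe_injective) hle⟩).2
  have : Epi e := by
    rw [epi_iff_surjective]
    intro y
    obtain ⟨x, hx⟩ := LinearMap.range_eq_top.1 htop y
    obtain ⟨m, rfl⟩ := Nat.exists_eq_add_of_le' hn1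
    rw [pow_succ', Module.End.mul_apply] at hx
    exact ⟨_, hx⟩
  exact isIso_of_epi_of_card_le e le_rfl

/-- A projective cover of `S` has no nonzero morphisms to other simple modules: the kernel of such a
morphism would still map onto `S`, and then its inclusion into the cover would be surjective. -/
theorem IsCover.hom_eq_zero {P S S' : FGModuleCat.{u} A} {π : P ⟶ S} (h : IsCover π) [Simple S']
    (hS : IsEmpty (S ≅ S')) (f : P ⟶ S') : f = 0 := by
  have := h.projective
  have := h.simple
  have := h.epi
  by_contra hf
  have : Epi f := epi_of_nonzero_to_simple hf
  by_cases h0 : kernel.ι f ≫ π = 0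
  · have hd := (SES.ofEpi f).ex.exact.g_desc π h0
    set d := (SES.ofEpi f).ex.exact.desc π h0
    have hd0 : d ≠ 0 := fun h0 => Simple.not_isZero S (IsZero.of_epi_eq_zero π (by
      rw [← hd, h0, comp_zero]))
    have := isIso_of_hom_simple hd0
    exact hS.false (asIso d).symm
  · have : Epi (kernel.ι f ≫ π) := epi_of_nonzero_to_simple h0
    have hl := Projective.factorThru_comp π (kernel.ι f ≫ π)
    set l := Projective.factorThru π (kernel.ι f ≫ π)
    have := h.isIso (l ≫ kernel.ι f) (by rw [Category.assoc, hl])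
    refine hf ?_
    rw [← cancel_epi (l ≫ kernel.ι f), comp_zero, Category.assoc, kernel.condition, comp_zero]

/-- A projective module with the quotient `S` contains the projective cover of `S` as a direct
summand. -/
theorem IsCover.exists_iso {P S Q : FGModuleCat.{u} A} {π : P ⟶ S} (h : IsCover π) [Projective Q]
    (f : Q ⟶ S) [Epi f] : ∃ R : FGModuleCat.{u} A, Projective R ∧ Nonempty (Q ≅ P ⊞ R) := by
  have := h.projective
  have := h.epi
  have h1 := Projective.factorThru_comp π f
  have h2 := Projective.factorThru_comp f π
  set a := Projective.factorThru π f
  set b := Projective.factorThru f π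
  have hi := h.isIso (a ≫ b) (by rw [Category.assoc, h2, h1])
  have : Epi b := epi_of_epi_fac (rfl : a ≫ b = a ≫ b)
  obtain ⟨e⟩ := (SES.ofEpi b).iso_biprod_of_subsingleton
  refine ⟨kernel b, ?_, ⟨e ≪≫ biprod.braiding _ _⟩⟩
  exact Retract.projective (Y := Q) ⟨biprod.inl ≫ e.inv, e.hom ≫ biprod.fst, by simp⟩

theorem one_lt_card_hom_iff {M N : FGModuleCat.{u} A} :
    1 < Nat.card (M ⟶ N) ↔ ∃ f : M ⟶ N, f ≠ 0 := by
  rw [Finite.one_lt_card_iff_nontrivial]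
  exact ⟨fun _ => exists_ne 0, fun ⟨f, hf⟩ => ⟨f, 0, hf⟩⟩

/-- A projective module is determined by the numbers of homomorphisms to the simple modules. -/
theorem iso_of_card_hom_simple {P Q : FGModuleCat.{u} A} [Projective P] [Projective Q]
    (h : ∀ S : FGModuleCat.{u} A, Simple S → Nat.card (P ⟶ S) = Nat.card (Q ⟶ S)) :
    Nonempty (P ≅ Q) := by
  induction hn : Nat.card P using Nat.strong_induction_on generalizing P Q with
  | _ n ih =>
    by_cases h0 : IsZero P
    · by_cases h0' : IsZero Q
      · exact ⟨h0.iso h0'⟩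
      · obtain ⟨S, f, hS, hf⟩ := exists_simple_quotient h0'
        have h1 : 1 < Nat.card (Q ⟶ S) := one_lt_card_hom_iff.2
          ⟨f, fun h => Simple.not_isZero S (IsZero.of_epi_eq_zero f h)⟩
        rw [← h S hS, one_lt_card_hom_iff] at h1
        obtain ⟨g, hg⟩ := h1
        exact (hg (h0.eq_of_src _ _)).elim
    · obtain ⟨S, f, hS, hf⟩ := exists_simple_quotient h0
      have h1 : 1 < Nat.card (P ⟶ S) := one_lt_card_hom_iff.2
        ⟨f, fun h => Simple.not_isZero S (IsZero.of_epi_eq_zero f h)⟩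
      rw [h S hS, one_lt_card_hom_iff] at h1
      obtain ⟨g, hg⟩ := h1
      have : Epi g := epi_of_nonzero_to_simple hg
      obtain ⟨C, π, hπ⟩ := exists_isCover S
      obtain ⟨P', hP', ⟨e⟩⟩ := hπ.exists_iso f
      obtain ⟨Q', hQ', ⟨e'⟩⟩ := hπ.exists_iso g
      have hC : ¬ IsZero C := fun hC => Simple.not_isZero S
        (have := hπ.epi; IsZero.of_epi_eq_zero π (hC.eq_of_src _ _))
      obtain ⟨i⟩ := ih (Nat.card P')
        (hn ▸ (((SES.split P' C).congrMid (biprod.braiding _ _ ≪≫ e.symm)).card_lt hC))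
        (P := P') (Q := Q') (fun S' hS' => by
          have h2 := h S' hS'
          rw [Nat.card_congr (e.homCongr (Iso.refl S')), Nat.card_congr (e'.homCongr (Iso.refl S')),
            card_biprod_hom, card_biprod_hom] at h2
          exact Nat.eq_of_mul_eq_mul_left (card_hom_pos C S') h2) rfl
      exact ⟨e ≪≫ biprod.mapIso (Iso.refl C) i ≪≫ e'.symm⟩

/-! ### The Euler pairing on Grothendieck groups -/

/-- The multiplicative Euler form as an element of an additive group. -/
noncomputable def logEf (M N : FGModuleCat.{u} A) : Additive ℚˣ :=
  Additive.ofMul (Units.mk0 (ef M N) (ef_ne M N))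

theorem logEf_eq_iff {M N M' N' : FGModuleCat.{u} A} :
    logEf M N = logEf M' N' ↔ ef M N = ef M' N' := by
  rw [logEf, logEf, Additive.ofMul.injective.eq_iff, Units.ext_iff]
  rfl

theorem logEf_add {M N M' N' M'' N'' : FGModuleCat.{u} A} (h : ef M N = ef M' N' * ef M'' N'') :
    logEf M N = logEf M' N' + logEf M'' N'' := by
  rw [logEf, logEf, logEf, ← ofMul_mul, Additive.ofMul.injective.eq_iff, Units.ext_iff]
  exact h

theorem logEf_left (X : FGModuleCat.{u} A) {M N L : FGModuleCat.{u} A} (s : SES M N L)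
    (hM : projDimLEOne A M) (_ : projDimLEOne A N) (_ : projDimLEOne A L) :
    logEf L X = logEf N X + logEf M X :=
  logEf_add (have := hM.subsingleton_ext_two X; ef_left s X)

/-- The pairing with a fixed module `X` in the second argument. -/
noncomputable def logEfLeft (X : FGModuleCat.{u} A) : K0 (projDimLEOne A) →+ Additive ℚˣ :=
  K0.lift (fun M => logEf M X) (logEf_left X)

theorem logEfLeft_cls (X : FGModuleCat.{u} A) {M : FGModuleCat.{u} A} (hM : projDimLEOne A M) :
    logEfLeft X (K0.cls M hM) = logEf M X :=
  K0.lift_cls _ (logEf_left X) (fun e => logEf_eq_iff.2 (ef_congr_left e X)) hM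

theorem logEf_right (P : FGModuleCat.{u} A) [Projective P] {M N L : FGModuleCat.{u} A}
    (s : SES M N L) (_ : (⊤ : ObjectProperty (FGModuleCat.{u} A)) M)
    (_ : (⊤ : ObjectProperty (FGModuleCat.{u} A)) N)
    (_ : (⊤ : ObjectProperty (FGModuleCat.{u} A)) L) : logEf P L = logEf P N + logEf P M :=
  logEf_add (ef_right s P)

/-- The pairing with a fixed projective module in the first argument. -/
noncomputable def logEfRight (P : FGModuleCat.{u} A) [Projective P] :
    K0 (⊤ : ObjectProperty (FGModuleCat.{u} A)) →+ Additive ℚˣ :=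
  K0.lift (fun M => logEf P M) (logEf_right P)

theorem logEfRight_cls (P M : FGModuleCat.{u} A) [Projective P] :
    logEfRight P (K0.cls M trivial) = logEf P M :=
  K0.lift_cls _ (logEf_right P) (fun e => logEf_eq_iff.2 (ef_congr_right e P)) trivial

/-- Projective modules with the same class in the Grothendieck group are isomorphic. -/
theorem iso_of_cls_eq {P Q : FGModuleCat.{u} A} [Projective P] [Projective Q]
    (h : K0.cls P (projDimLEOne_of_projective P) = K0.cls Q (projDimLEOne_of_projective Q)) :
    Nonempty (P ≅ Q) := by
  refine iso_of_card_hom_simple fun S _ => ?_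
  have h' := congrArg (logEfLeft S) h
  rw [logEfLeft_cls, logEfLeft_cls, logEf_eq_iff, ef_of_subsingleton, ef_of_subsingleton] at h'
  exact_mod_cast h'

/-- Independence over `ℤ` from a diagonal pairing with values in the multiplicative group of `ℚ`; a
rational number greater than `1` has infinite order. -/
theorem linearIndependent_of_pairing {ι G : Type*} [AddCommGroup G] (T : ι → G)
    (χ : ι → G →+ Additive ℚˣ) (h₀ : ∀ i j, i ≠ j → χ i (T j) = 0)
    (h₁ : ∀ i, 1 < ((χ i (T i)).toMul : ℚ)) : LinearIndependent ℤ T := by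
  rw [linearIndependent_iff']
  intro s g hg i hi
  have h := congrArg (χ i) hg
  rw [map_sum, map_zero, Finset.sum_eq_single_of_mem i hi
    (fun j _ hj => by rw [map_zsmul, h₀ i j hj.symm, smul_zero]), map_zsmul] at h
  have h2 : ((χ i (T i)).toMul : ℚ) ^ g i = 1 := by
    have := congrArg (fun x => ((Additive.toMul x : ℚˣ) : ℚ)) h
    simpa using this
  exact (zpow_eq_one_iff_right₀ (zero_le_one.trans (h₁ i).le) (h₁ i).ne').1 h2

/-- The isomorphism classes of the simple modules. -/
abbrev SimpleCl (A : Type u) [Ring A] [Finite A] : Type (u + 1) :=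
  {x : IsoCl (⊤ : ObjectProperty (FGModuleCat.{u} A)) // Simple x.rep}

/-- The projective cover of a simple module. -/
noncomputable def SimpleCl.cover (x : SimpleCl A) : FGModuleCat.{u} A :=
  have := x.2; (exists_isCover x.1.rep).choose

theorem SimpleCl.exists_cover (x : SimpleCl A) : ∃ π : x.cover ⟶ x.1.rep, IsCover π :=
  have := x.2; (exists_isCover x.1.rep).choose_spec

instance (x : SimpleCl A) : Projective x.cover := x.exists_cover.choose_spec.projective

theorem SimpleCl.ef_cover_of_ne {x y : SimpleCl A} (h : x ≠ y) : ef x.cover y.1.rep = 1 := by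
  obtain ⟨π, hπ⟩ := x.exists_cover
  have := y.2
  have : Subsingleton (x.cover ⟶ y.1.rep) := subsingleton_of_forall_eq 0 fun f =>
    hπ.hom_eq_zero ⟨fun e => h (Subtype.ext (IsoCl.eq_of_iso e))⟩ f
  rw [ef_of_subsingleton, Nat.card_of_subsingleton 0, Nat.cast_one]

theorem SimpleCl.one_lt_ef_cover (x : SimpleCl A) : 1 < ef x.cover x.1.rep := by
  obtain ⟨π, hπ⟩ := x.exists_cover
  have := hπ.epi
  rw [ef_of_subsingleton]
  exact_mod_cast one_lt_card_hom_iff.2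
    ⟨π, fun h => have := x.2; Simple.not_isZero x.1.rep (IsZero.of_epi_eq_zero π h)⟩

theorem exists_simpleCl (S : FGModuleCat.{u} A) [Simple S] :
    ∃ x : SimpleCl A, Nonempty (x.1.rep ≅ S) := by
  obtain ⟨e⟩ := IsoCl.rep_mk (E := ⊤) S trivial
  exact ⟨⟨IsoCl.mk S trivial, Simple.of_iso e⟩, ⟨e⟩⟩

/-- The classes of the simple modules form a basis of the Grothendieck group of all modules. -/
noncomputable def simpleBasis (A : Type u) [Ring A] [Finite A] :
    Module.Basis (SimpleCl A) ℤ (K0 (⊤ : ObjectProperty (FGModuleCat.{u} A))) :=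
  Module.Basis.mk (v := fun x => K0.cls x.1.rep trivial)
    (linearIndependent_of_pairing _ (fun x => logEfRight x.cover)
      (fun x y h => by
        rw [logEfRight_cls, logEf, ofMul_eq_zero, Units.ext_iff]
        exact SimpleCl.ef_cover_of_ne h)
      fun x => by rw [logEfRight_cls]; exact x.one_lt_ef_cover)
    (K0.span_eq_top fun M hM => by
      induction hn : Nat.card M using Nat.strong_induction_on generalizing M with
      | _ n ih =>
        by_cases h0 : IsZero M
        · rw [K0.cls_zero h0]; exact zero_mem _
        · obtain ⟨S, f, hS, hf⟩ := exists_simple_quotient h0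
          obtain ⟨x, ⟨e⟩⟩ := exists_simpleCl S
          rw [K0.cls_mid ((SES.ofEpi f).congrRight e.symm) trivial trivial]
          exact add_mem (ih _ (hn ▸ (SES.ofEpi f).card_lt (Simple.not_isZero S)) _ _ rfl)
            (Submodule.subset_span ⟨x, rfl⟩))

/-- The classes of the indecomposable projective modules form a basis of the Grothendieck group of
the modules of projective dimension at most one. -/
noncomputable def coverBasis (A : Type u) [Ring A] [Finite A] :
    Module.Basis (SimpleCl A) ℤ (K0 (projDimLEOne A)) :=
  Module.Basis.mk (v := fun x => K0.cls x.cover (projDimLEOne_of_projective _))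
    (linearIndependent_of_pairing _ (fun x => logEfLeft x.1.rep)
      (fun x y h => by
        rw [logEfLeft_cls, logEf, ofMul_eq_zero, Units.ext_iff]
        exact SimpleCl.ef_cover_of_ne h.symm)
      fun x => by rw [logEfLeft_cls]; exact x.one_lt_ef_cover)
    (K0.span_eq_top fun M hM => by
      have key (P : FGModuleCat.{u} A) (hP : Projective P) :
          K0.cls P (projDimLEOne_of_projective P) ∈ Submodule.span ℤ (Set.range
            fun x : SimpleCl A => K0.cls x.cover (projDimLEOne_of_projective _)) := by
        induction hn : Nat.card P using Nat.strong_induction_on generalizing P with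
        | _ n ih =>
          by_cases h0 : IsZero P
          · rw [K0.cls_zero h0]; exact zero_mem _
          · obtain ⟨S, f, hS, hf⟩ := exists_simple_quotient h0
            obtain ⟨x, ⟨e⟩⟩ := exists_simpleCl S
            obtain ⟨π, hπ⟩ := x.exists_cover
            obtain ⟨R, hR, ⟨i⟩⟩ := hπ.exists_iso (f ≫ e.inv)
            have s := (SES.split R x.cover).congrMid (biprod.braiding _ _ ≪≫ i.symm)
            have hC : ¬ IsZero x.cover := fun hC => Simple.not_isZero S (have := hπ.epi
              (IsZero.of_epi_eq_zero π (hC.eq_of_src _ _)).of_iso e.symm)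
            rw [K0.cls_mid s (projDimLEOne_of_projective _) (projDimLEOne_of_projective R)]
            exact add_mem (ih _ (hn ▸ s.card_lt hC) _ hR rfl) (Submodule.subset_span ⟨x, rfl⟩)
      obtain ⟨P₀, P₁, s, h₀, h₁⟩ := hM.exists_resolution
      have h := K0.cls_mid s hM (projDimLEOne_of_projective P₁) (projDimLEOne_of_projective P₀)
      rw [← sub_eq_iff_eq_add'] at h
      rw [← h]
      exact sub_mem (key _ h₀) (key _ h₁))

/-- Both groups are free on the simple modules. -/
theorem nonempty_K0_equiv (A : Type u) [Ring A] [Finite A] : Nonempty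
    (K0 (⊤ : ObjectProperty (FGModuleCat.{u} A)) ≃+ K0 (projDimLEOne A)) :=
  ⟨((simpleBasis A).equiv (coverBasis A) (Equiv.refl _)).toAddEquiv⟩

/-! ### The quantum torus -/

/-- Equality up to a nonzero rational factor. -/
def Proportional {B : Type*} [Ring B] [Algebra ℚ B] (x y : B) : Prop :=
  ∃ c : ℚ, c ≠ 0 ∧ x = c • y

namespace Proportional
variable {B : Type*} [Ring B] [Algebra ℚ B] {x y z x' y' u : B}

theorem refl (x : B) : Proportional x x := ⟨1, one_ne_zero, (one_smul _ _).symm⟩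

theorem smul {c : ℚ} (hc : c ≠ 0) (x : B) : Proportional (c • x) x := ⟨c, hc, rfl⟩

theorem symm : Proportional x y → Proportional y x := fun ⟨c, hc, h⟩ =>
  ⟨c⁻¹, inv_ne_zero hc, by rw [h, smul_smul, inv_mul_cancel₀ hc, one_smul]⟩

theorem trans : Proportional x y → Proportional y z → Proportional x z :=
  fun ⟨c, hc, h⟩ ⟨d, hd, h'⟩ => ⟨c * d, mul_ne_zero hc hd, by rw [h, h', smul_smul]⟩

theorem mul : Proportional x y → Proportional x' y' → Proportional (x * x') (y * y') :=
  fun ⟨c, hc, h⟩ ⟨d, hd, h'⟩ => ⟨c * d, mul_ne_zero hc hd, by rw [h, h', smul_mul_smul_comm]⟩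

theorem mul_left (z : B) (h : Proportional x y) : Proportional (z * x) (z * y) := (refl z).mul h

theorem mul_right (z : B) (h : Proportional x y) : Proportional (x * z) (y * z) := h.mul (refl z)

theorem of_mul_right (hu : IsUnit u) : Proportional (x * u) (y * u) → Proportional x y :=
  fun ⟨c, hc, h⟩ => ⟨c, hc, hu.mul_left_injective (by simpa only [smul_mul_assoc] using h)⟩

theorem isUnit (h : Proportional x y) (hy : IsUnit y) : IsUnit x := by
  obtain ⟨c, hc, rfl⟩ := h
  exact isUnit_rat_smul hc hy

end Proportional

section
variable [Gorenstein A]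

open ModifiedHall

theorem ef_eq_of_cls_eq {U V : FGModuleCat.{u} A} {hU : projDimLEOne A U} {hV : projDimLEOne A V}
    (h : K0.cls U hU = K0.cls V hV) (X : FGModuleCat.{u} A) : ef U X = ef V X := by
  have := congrArg (logEfLeft X) h
  rwa [logEfLeft_cls, logEfLeft_cls, logEf_eq_iff] at this

theorem ModifiedHall.cls_mul_comm {K : FGModuleCat.{u} A} (hK : projDimLEOne A K)
    (M : FGModuleCat.{u} A) : cls K * cls M = (ef M K / ef K M) • (cls M * cls K) := by
  rw [div_eq_inv_mul, ← smul_smul, ← cls_comm hK, smul_smul, inv_mul_cancel₀ (ef_ne _ _), one_smul]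

theorem ModifiedHall.cls_biprod {K : FGModuleCat.{u} A} (hK : projDimLEOne A K)
    (M : FGModuleCat.{u} A) : cls (K ⊞ M) = ef M K • (cls M * cls K) :=
  cls_mid (SES.split K M) hK

/-- The class of a module of projective dimension at most one depends only on its class in the
Grothendieck group. -/
theorem ModifiedHall.cls_eq_of_cls_eq {X Y : FGModuleCat.{u} A} {hX : projDimLEOne A X}
    {hY : projDimLEOne A Y} (h : K0.cls X hX = K0.cls Y hY) : cls X = cls Y := by
  obtain ⟨X₀, X₁, s, hX₀, hX₁⟩ := hX.exists_resolution
  obtain ⟨Y₀, Y₁, t, hY₀, hY₁⟩ := hY.exists_resolution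
  have pX₁ := projDimLEOne_of_projective X₁
  have pY₁ := projDimLEOne_of_projective Y₁
  have pX₀ := projDimLEOne_of_projective X₀
  have pY₀ := projDimLEOne_of_projective Y₀
  obtain ⟨e⟩ : Nonempty (Y₁ ⊞ X₀ ≅ X₁ ⊞ Y₀) := iso_of_cls_eq (by
    rw [K0.cls_mid (SES.split Y₁ X₀) pX₀ pY₁, K0.cls_mid (SES.split X₁ Y₀) pY₀ pX₁,
      K0.cls_mid s hX pX₁, K0.cls_mid t hY pY₁, h]
    abel)
  have h1 := ModifiedHall.cls_congr e
  have h2 : Subsingleton (Ext X Y₁ 2) := hX.subsingleton_ext_two _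
  have h3 : Subsingleton (Ext Y X₁ 2) := hY.subsingleton_ext_two _
  rw [cls_biprod pY₁, cls_biprod pX₁, cls_mid s pX₁, cls_mid t pY₁, ef_left s Y₁, ef_left t X₁,
    smul_mul_assoc, smul_mul_assoc, mul_assoc, mul_assoc, cls_mul_comm pX₁ Y₁,
    mul_smul_comm, smul_smul, smul_smul, smul_smul, ef_eq_of_cls_eq h, ef_eq_of_cls_eq h] at h1
  have h4 : ef X₁ Y₁ * ef Y Y₁ * ef Y X₁ * (ef Y₁ X₁ / ef X₁ Y₁) =
      ef Y₁ X₁ * ef Y X₁ * ef Y Y₁ := by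
    have := ef_ne X₁ Y₁
    field_simp
  rw [h4] at h1
  have h5 := smul_right_injective _
    (mul_ne_zero (mul_ne_zero (ef_ne Y₁ X₁) (ef_ne Y X₁)) (ef_ne Y Y₁)) h1
  exact ((isUnit_cls pY₁).mul (isUnit_cls pX₁)).mul_left_injective h5

/-- The element `⟨U - V, V⟩⁻¹ [U] [V]⁻¹`, with the multiplicative Euler form. -/
noncomputable def torusElement (U V : FGModuleCat.{u} A) : ModifiedHall A :=
  ((ef U V)⁻¹ * ef V V) • (cls U * Ring.inverse (cls V))

theorem torusElement_mul (U : FGModuleCat.{u} A) {V : FGModuleCat.{u} A} (hV : projDimLEOne A V) :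
    torusElement U V * cls V = ((ef U V)⁻¹ * ef V V) • cls U := by
  rw [torusElement, smul_mul_assoc, mul_assoc, Ring.inverse_mul_cancel _ (isUnit_cls hV), mul_one]

theorem ef_biprod_left {U V : FGModuleCat.{u} A} (hV : projDimLEOne A V) (X : FGModuleCat.{u} A) :
    ef (U ⊞ V) X = ef U X * ef V X :=
  have := hV.subsingleton_ext_two X
  ef_left (SES.split U V) X

theorem projDimLEOne_biprod {U V : FGModuleCat.{u} A} (hU : projDimLEOne A U)
    (hV : projDimLEOne A V) : projDimLEOne A (U ⊞ V) := projDimLEOne_mid (SES.split U V) hU hV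

/-- The element `torusElement U V` depends only on the class of `U - V`. -/
theorem torusElement_eq {U V U' V' : FGModuleCat.{u} A} {hU : projDimLEOne A U}
    {hV : projDimLEOne A V} {hU' : projDimLEOne A U'} {hV' : projDimLEOne A V'}
    (h : K0.cls U hU - K0.cls V hV = K0.cls U' hU' - K0.cls V' hV') :
    torusElement U V = torusElement U' V' := by
  have h1 : K0.cls (V' ⊞ U) (projDimLEOne_biprod hV' hU) =
      K0.cls (V ⊞ U') (projDimLEOne_biprod hV hU') := by
    rw [K0.cls_mid (SES.split V' U) hU hV', K0.cls_mid (SES.split V U') hU' hV]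
    rw [sub_eq_sub_iff_add_eq_add] at h
    rw [add_comm, h, add_comm]
  have h2 := cls_eq_of_cls_eq h1
  have h3 := ef_eq_of_cls_eq h1
  have h4 := h3 V
  have h5 := h3 V'
  rw [ef_biprod_left hU, ef_biprod_left hU'] at h4 h5
  rw [cls_biprod hV', cls_biprod hV] at h2
  have n1 := ef_ne U V
  have n2 := ef_ne U' V'
  have n3 := ef_ne U V'
  have n4 := ef_ne U' V
  have n5 := ef_ne V V'
  have n6 := ef_ne V' V
  have e1 : torusElement U V * (cls V * cls V') =
      ((ef U V)⁻¹ * ef V V * (ef U V')⁻¹) • (ef U V' • (cls U * cls V')) := by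
    rw [← mul_assoc, torusElement_mul U hV, smul_mul_assoc, smul_smul, mul_assoc _ _ (ef U V'),
      inv_mul_cancel₀ n3, mul_one]
  have e2 : torusElement U' V' * (cls V * cls V') =
      ((ef V' V / ef V V') * ((ef U' V')⁻¹ * ef V' V') * (ef U' V)⁻¹) •
        (ef U' V • (cls U' * cls V)) := by
    rw [cls_mul_comm hV, mul_smul_comm, ← mul_assoc, torusElement_mul U' hV', smul_mul_assoc,
      smul_smul, smul_smul, mul_assoc _ _ (ef U' V), inv_mul_cancel₀ n4, mul_one]
  refine ((isUnit_cls hV).mul (isUnit_cls hV')).mul_left_injective ?_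
  dsimp only
  rw [e1, e2, h2]
  congr 1
  field_simp
  linear_combination -(ef V V' * ef U' V') * h4 - (ef U V * ef V' V) * h5

end

section

/-- The class of a projective module in the Grothendieck group. -/
noncomputable def projCls (P : FGModuleCat.{u} A) [Projective P] : K0 (projDimLEOne A) :=
  K0.cls P (projDimLEOne_of_projective P)

theorem projCls_biprod (P Q : FGModuleCat.{u} A) [Projective P] [Projective Q] :
    projCls (P ⊞ Q) = projCls P + projCls Q :=
  K0.cls_mid (SES.split P Q) (projDimLEOne_of_projective Q) (projDimLEOne_of_projective P)
    (projDimLEOne_of_projective _)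

theorem projCls_congr {P Q : FGModuleCat.{u} A} [Projective P] [Projective Q] (e : P ≅ Q) :
    projCls P = projCls Q := K0.cls_congr e _ _

theorem exists_projCls_sub (α : K0 (projDimLEOne A)) :
    ∃ (U V : FGModuleCat.{u} A) (_ : Projective U) (_ : Projective V),
      α = projCls U - projCls V := by
  induction α using K0.induction with
  | h0 =>
    obtain ⟨Z, hZ⟩ := HasZeroObject.zero (C := FGModuleCat.{u} A)
    have := hZ.projective
    exact ⟨Z, Z, this, this, (sub_self _).symm⟩
  | hcls M hM =>
    obtain ⟨P₀, P₁, s, h₀, h₁⟩ := hM.exists_resolution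
    refine ⟨P₀, P₁, h₀, h₁, ?_⟩
    rw [projCls, projCls, K0.cls_mid s hM (projDimLEOne_of_projective P₁), add_sub_cancel_left]
  | hneg x h =>
    obtain ⟨U, V, hU, hV, rfl⟩ := h
    exact ⟨V, U, hV, hU, neg_sub _ _⟩
  | hadd x y hx hy =>
    obtain ⟨U, V, hU, hV, rfl⟩ := hx
    obtain ⟨U', V', hU', hV', rfl⟩ := hy
    refine ⟨U ⊞ U', V ⊞ V', inferInstance, inferInstance, ?_⟩
    rw [projCls_biprod, projCls_biprod]
    abel

variable [Gorenstein A]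

open ModifiedHall

theorem isUnit_cls_projective (P : FGModuleCat.{u} A) [Projective P] : IsUnit (cls P) :=
  isUnit_cls (projDimLEOne_of_projective P)

theorem proportional_comm {K : FGModuleCat.{u} A} (hK : projDimLEOne A K) (M : FGModuleCat.{u} A) :
    Proportional (cls K * cls M) (cls M * cls K) := by
  rw [cls_mul_comm hK]
  exact .smul (div_ne_zero (ef_ne _ _) (ef_ne _ _)) _

theorem proportional_comm_projective (P M : FGModuleCat.{u} A) [Projective P] :
    Proportional (cls P * cls M) (cls M * cls P) :=
  proportional_comm (projDimLEOne_of_projective P) M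

theorem proportional_biprod (M P : FGModuleCat.{u} A) [Projective P] :
    Proportional (cls (M ⊞ P)) (cls M * cls P) := by
  rw [ModifiedHall.cls_congr (biprod.braiding M P), cls_biprod (projDimLEOne_of_projective P)]
  exact .smul (ef_ne _ _) _

theorem proportional_ses {M P L : FGModuleCat.{u} A} (s : SES M P L) [Projective P] :
    Proportional (cls M * cls P) (cls L) := by
  rw [cls_mid s (projDimLEOne_of_projective P)]
  exact (Proportional.smul (ef_ne _ _) _).symm

/-- The elements proportional to `[U] [V]⁻¹` with `U` and `V` projective and `U - V` of class `α`.
-/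
def IsMonomial (x : ModifiedHall A) (α : K0 (projDimLEOne A)) : Prop :=
  ∃ (U V : FGModuleCat.{u} A) (_ : Projective U) (_ : Projective V),
    α = projCls U - projCls V ∧ Proportional (x * cls V) (cls U)

namespace IsMonomial
variable {x y : ModifiedHall A} {α β : K0 (projDimLEOne A)}

theorem isUnit (h : IsMonomial x α) : IsUnit x := by
  obtain ⟨U, V, hU, hV, -, h⟩ := h
  have h1 := h.isUnit (isUnit_cls_projective U)
  obtain ⟨v, hv⟩ := isUnit_cls_projective V
  rw [← hv] at h1
  simpa using h1.mul v⁻¹.isUnit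

theorem of_cls {K : FGModuleCat.{u} A} (hK : projDimLEOne A K) :
    IsMonomial (cls K) (K0.cls K hK) := by
  obtain ⟨P₀, P₁, s, h₀, h₁⟩ := hK.exists_resolution
  refine ⟨P₀, P₁, h₀, h₁, ?_, proportional_ses s⟩
  rw [projCls, projCls, K0.cls_mid s hK (projDimLEOne_of_projective P₁), add_sub_cancel_left]

theorem of_proportional (h : Proportional y x) (hx : IsMonomial x α) : IsMonomial y α := by
  obtain ⟨U, V, hU, hV, hα, hx⟩ := hx
  exact ⟨U, V, hU, hV, hα, (h.mul_right _).trans hx⟩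

/-- Monomials commute with the class of every module up to a factor. -/
theorem comm (h : IsMonomial x α) (M : FGModuleCat.{u} A) :
    Proportional (x * cls M) (cls M * x) := by
  obtain ⟨U, V, hU, hV, -, h⟩ := h
  refine .of_mul_right (isUnit_cls_projective V) ?_
  have h1 : Proportional (x * cls M * cls V) (x * cls V * cls M) := by
    rw [mul_assoc, mul_assoc]
    exact (proportional_comm_projective V M).symm.mul_left x
  refine h1.trans ((h.mul_right _).trans ((proportional_comm_projective U M).trans ?_))
  rw [mul_assoc]
  exact h.symm.mul_left _

theorem mul (hx : IsMonomial x α) (hy : IsMonomial y β) : IsMonomial (x * y) (α + β) := by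
  have hx' := hx
  obtain ⟨U, V, hU, hV, rfl, h⟩ := hx
  obtain ⟨U', V', hU', hV', rfl, h'⟩ := hy
  refine ⟨U ⊞ U', V ⊞ V', inferInstance, inferInstance, ?_, ?_⟩
  · rw [projCls_biprod, projCls_biprod]; abel
  have h1 := ((proportional_biprod V V').trans (proportional_comm_projective V V')).mul_left (x * y)
  have h2 : x * y * (cls V' * cls V) = x * (y * cls V' * cls V) := by simp only [mul_assoc]
  rw [h2] at h1
  have h3 := ((h'.mul_right (cls V)).trans (proportional_comm_projective U' V)).mul_left x
  rw [← mul_assoc x (cls V)] at h3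
  exact h1.trans (h3.trans ((h.mul_right _).trans (proportional_biprod U U').symm))

theorem inverse (hx : IsMonomial x α) : IsMonomial (Ring.inverse x) (-α) := by
  have hu := hx.isUnit
  obtain ⟨U, V, hU, hV, rfl, h⟩ := hx
  refine ⟨V, U, hV, hU, neg_sub _ _, ?_⟩
  have := h.symm.mul_left (Ring.inverse x)
  rwa [← mul_assoc, Ring.inverse_mul_cancel _ hu, one_mul] at this

theorem proportional (hx : IsMonomial x α) (hy : IsMonomial y α) : Proportional x y := by
  obtain ⟨U, V, hU, hV, rfl, h⟩ := hx
  obtain ⟨U', V', hU', hV', hα, h'⟩ := hy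
  have hiso : Nonempty (U ⊞ V' ≅ U' ⊞ V) := iso_of_cls_eq (by
    change projCls (U ⊞ V') = projCls (U' ⊞ V)
    rw [projCls_biprod, projCls_biprod]
    exact sub_eq_sub_iff_add_eq_add.1 hα)
  obtain ⟨e⟩ := hiso
  refine .of_mul_right ((isUnit_cls_projective V).mul (isUnit_cls_projective V')) ?_
  have h1 := (h.mul_right (cls V')).trans (proportional_biprod U V').symm
  have h2 := (h'.mul_right (cls V)).trans (proportional_biprod U' V).symm
  rw [← ModifiedHall.cls_congr e, mul_assoc] at h2
  rw [mul_assoc] at h1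
  exact h1.trans (h2.symm.trans ((proportional_comm_projective V' V).mul_left y))

theorem one : IsMonomial (1 : ModifiedHall A) 0 := by
  obtain ⟨Z, hZ⟩ := HasZeroObject.zero (C := FGModuleCat.{u} A)
  have := hZ.projective
  exact ⟨Z, Z, this, this, (sub_self _).symm, by rw [one_mul]; exact .refl _⟩

end IsMonomial

theorem isMonomial_torusElement {U V : FGModuleCat.{u} A} (hU : projDimLEOne A U)
    (hV : projDimLEOne A V) : IsMonomial (torusElement U V) (K0.cls U hU - K0.cls V hV) := by
  rw [sub_eq_add_neg]
  exact .of_proportional (.smul (mul_ne_zero (inv_ne_zero (ef_ne _ _)) (ef_ne _ _)) _)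
    ((IsMonomial.of_cls hU).mul (IsMonomial.of_cls hV).inverse)

/-- The elements `[K_α]` of the quantum torus. -/
noncomputable def torusMonomial (α : K0 (projDimLEOne A)) : ModifiedHall A :=
  torusElement (exists_projCls_sub α).choose (exists_projCls_sub α).choose_spec.choose

theorem torusMonomial_sub {U V : FGModuleCat.{u} A} (hU : projDimLEOne A U)
    (hV : projDimLEOne A V) : torusMonomial (K0.cls U hU - K0.cls V hV) = torusElement U V := by
  obtain ⟨_, _, h⟩ := (exists_projCls_sub (K0.cls U hU - K0.cls V hV)).choose_spec.choose_spec
  exact (torusElement_eq h).symm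

theorem isMonomial_torusMonomial (α : K0 (projDimLEOne A)) : IsMonomial (torusMonomial α) α := by
  obtain ⟨U, V, hU, hV, rfl⟩ := exists_projCls_sub α
  rw [projCls, projCls, torusMonomial_sub]
  exact isMonomial_torusElement _ _

theorem torusMonomial_mem (α : K0 (projDimLEOne A)) : torusMonomial α ∈ quantumTorus A := by
  obtain ⟨U, V, hU, hV, rfl⟩ := exists_projCls_sub α
  rw [projCls, projCls, torusMonomial_sub]
  refine Subalgebra.smul_mem _ (mul_mem (Algebra.subset_adjoin ?_) (Algebra.subset_adjoin ?_)) _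
  · exact ⟨U, projDimLEOne_of_projective U, .inl rfl⟩
  · exact ⟨V, projDimLEOne_of_projective V, .inr rfl⟩

theorem IsMonomial.mem_span {x : ModifiedHall A} {α : K0 (projDimLEOne A)} (h : IsMonomial x α) :
    x ∈ Submodule.span ℚ (Set.range (torusMonomial (A := A))) := by
  obtain ⟨c, -, rfl⟩ := h.proportional (isMonomial_torusMonomial α)
  exact Submodule.smul_mem _ _ (Submodule.subset_span ⟨α, rfl⟩)

/-- The quantum torus is spanned by the elements `[K_α]`. -/
theorem mem_span_of_mem_quantumTorus {x : ModifiedHall A} (hx : x ∈ quantumTorus A) :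
    x ∈ Submodule.span ℚ (Set.range (torusMonomial (A := A))) := by
  induction hx using Algebra.adjoin_induction with
  | mem x hx =>
    obtain ⟨K, hK, rfl | rfl⟩ := hx
    · exact (IsMonomial.of_cls hK).mem_span
    · exact (IsMonomial.of_cls hK).inverse.mem_span
  | algebraMap r =>
    rw [Algebra.algebraMap_eq_smul_one]
    exact Submodule.smul_mem _ _ IsMonomial.one.mem_span
  | add x y _ _ hx hy => exact add_mem hx hy
  | mul x y _ _ hx hy =>
    have := Submodule.mul_mem_mul hx hy
    rw [Submodule.span_mul_span] at this
    refine Submodule.span_le.2 ?_ this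
    rintro _ ⟨_, ⟨α, rfl⟩, _, ⟨β, rfl⟩, rfl⟩
    exact ((isMonomial_torusMonomial α).mul (isMonomial_torusMonomial β)).mem_span

end

/-! ### The bases of the modified Ringel–Hall algebra -/

section
variable [Gorenstein A]

open ModifiedHall

/-- Multiplication of `v` by `[R]` gives a multiple of `[G ⊞ Q]`, where `Q` is projective of class
`α + R - P`. For `v = [M] [K_α]` and a resolution `0 → P → G → M → 0` this brings `v` into the Hall
algebra of the Gorenstein projective modules. -/
def Clears (P G : FGModuleCat.{u} A) [Projective P] (α : K0 (projDimLEOne A)) (v : ModifiedHall A)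
    (R : FGModuleCat.{u} A) [Projective R] : Prop :=
  ∃ (Q : FGModuleCat.{u} A) (_ : Projective Q), Proportional (v * cls R) (cls (G ⊞ Q)) ∧
    projCls Q + projCls P = α + projCls R

theorem Clears.biprod {P G : FGModuleCat.{u} A} [Projective P] {α : K0 (projDimLEOne A)}
    {v : ModifiedHall A} {R : FGModuleCat.{u} A} [Projective R] (h : Clears P G α v R)
    (R' : FGModuleCat.{u} A) [Projective R'] : Clears P G α v (R ⊞ R') := by
  obtain ⟨Q, hQ, h1, h2⟩ := h
  refine ⟨Q ⊞ R', inferInstance, ?_, ?_⟩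
  · have h3 := (proportional_biprod R R').mul_left v
    rw [← mul_assoc] at h3
    have h4 := (proportional_biprod G Q).mul_right (cls R')
    rw [mul_assoc] at h4
    exact h3.trans ((h1.mul_right _).trans (h4.trans
      (((proportional_biprod Q R').symm.mul_left _).trans (proportional_biprod G (Q ⊞ R')).symm)))
  · rw [projCls_biprod, projCls_biprod, add_right_comm, h2, add_assoc]

theorem Clears.congr {P G : FGModuleCat.{u} A} [Projective P] {α : K0 (projDimLEOne A)}
    {v : ModifiedHall A} {R R' : FGModuleCat.{u} A} [Projective R] [Projective R']
    (h : Clears P G α v R) (e : R ≅ R') : Clears P G α v R' := by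
  obtain ⟨Q, hQ, h1, h2⟩ := h
  exact ⟨Q, hQ, by rwa [← ModifiedHall.cls_congr e], by rwa [← projCls_congr e]⟩

theorem exists_clears {M P G : FGModuleCat.{u} A} (s : SES M P G) [Projective P]
    (α : K0 (projDimLEOne A)) : ∃ (R : FGModuleCat.{u} A) (_ : Projective R),
      Clears P G α (cls M * torusMonomial α) R := by
  obtain ⟨U, V, hU, hV, hα, h⟩ := isMonomial_torusMonomial α
  refine ⟨V ⊞ P, inferInstance, U, hU, ?_, ?_⟩
  · have h1 := (proportional_biprod V P).mul_left (cls M * torusMonomial α)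
    have h2 : cls M * torusMonomial α * (cls V * cls P) =
        cls M * (torusMonomial α * cls V * cls P) := by simp only [mul_assoc]
    rw [h2] at h1
    have h3 := ((h.mul_right (cls P)).trans (proportional_comm_projective U P)).mul_left (cls M)
    rw [← mul_assoc (cls M) (cls P)] at h3
    exact h1.trans (h3.trans (((proportional_ses s).mul_right _).trans
      (proportional_biprod G U).symm))
  · rw [projCls_biprod, hα]; abel

theorem exists_clears_finset {ι : Type*} {P G : ι → FGModuleCat.{u} A} [∀ i, Projective (P i)]
    {α : ι → K0 (projDimLEOne A)} {v : ι → ModifiedHall A}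
    (h : ∀ i, ∃ (R : FGModuleCat.{u} A) (_ : Projective R), Clears (P i) (G i) (α i) (v i) R)
    (s : Finset ι) : ∃ (R : FGModuleCat.{u} A) (_ : Projective R),
      ∀ i ∈ s, Clears (P i) (G i) (α i) (v i) R := by
  classical
  induction s using Finset.induction_on with
  | empty =>
    obtain ⟨Z, hZ⟩ := HasZeroObject.zero (C := FGModuleCat.{u} A)
    exact ⟨Z, hZ.projective, by simp⟩
  | insert i s _ ih =>
    obtain ⟨R, hR, h1⟩ := ih
    obtain ⟨R', hR', h2⟩ := h i
    refine ⟨R ⊞ R', inferInstance, fun j hj => ?_⟩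
    obtain rfl | hj := Finset.mem_insert.1 hj
    · exact (h2.biprod R).congr (biprod.braiding _ _)
    · exact (h1 j hj).biprod R'

theorem extProj_biprod {G Q : FGModuleCat.{u} A} (hG : ExtProj G) [Projective Q] :
    ExtProj (G ⊞ Q) := ExtProj.mid (SES.split G Q) hG (.of_projective Q)

theorem sgClass_biprod (G Q : FGModuleCat.{u} A) [Projective Q] :
    sgClass (G ⊞ Q) = sgClass G :=
  sgClass_eq_of_ses ((SES.split Q G).congrMid (biprod.braiding _ _))

/-- Finitely many products `[M] [K_α]` are carried by multiplication with one `[R]` to multiples of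
`[G ⊞ Q]`, with `G` a resolution of `M`. These are distinct: `M` is recovered from `G ⊞ Q` in the
singularity category, then `Q` by cancellation, then `α` from the class of `Q`. -/
theorem linearIndependent_cls_mul_torusMonomial (r : SgClass A → FGModuleCat.{u} A)
    (hr : ∀ x, sgClass (r x) = x) : LinearIndependent ℚ
      (fun p : SgClass A × K0 (projDimLEOne A) => cls (r p.1) * torusMonomial p.2) := by
  choose P G Q s f hP hG _ _ using fun x => exists_gorenstein_resolution (r x)
  rw [linearIndependent_iff_finset_linearIndependent]
  intro t
  obtain ⟨R, hR, hcl⟩ := exists_clears_finset (P := fun p : SgClass A × K0 (projDimLEOne A) => P p.1)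
    (G := fun p => G p.1) (α := fun p => p.2) (fun p => exists_clears (s p.1) p.2) t
  choose Q hQ hc hK using fun p : t => hcl p.1 p.2
  choose c hc0 hc using hc
  have hmem (p : t) : gproj A (G p.1.1 ⊞ Q p) := gproj_iff.2 (extProj_biprod (hG _))
  refine LinearIndependent.of_comp (LinearMap.mulRight ℚ (cls R)) ?_
  have hli := HallAlg.basis (E := gproj A).linearIndependent.map' (gprojToModified A).toLinearMap
    (LinearMap.ker_eq_bot.2 gprojToModified_injective)
  have hinj : Function.Injective fun p : t => IsoCl.mk _ (hmem p) := by
    intro p q h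
    obtain ⟨e⟩ := IsoCl.mk_eq_iff.1 h
    have hx : p.1.1 = q.1.1 := by
      have := sgClass_congr e
      rwa [sgClass_biprod, sgClass_biprod, sgClass_eq_of_ses (s _), sgClass_eq_of_ses (s _), hr,
        hr] at this
    have h1 := hK p
    have h2 := hK q
    rw [← hx] at e h2
    obtain ⟨e'⟩ := biprod_cancel_left e
    rw [projCls_congr e', h2] at h1
    exact Subtype.ext (Prod.ext hx (add_right_cancel h1).symm)
  have key := linearIndependent_smul hli hinj c hc0
  rw [show (LinearMap.mulRight ℚ (cls R)) ∘
    (fun p : SgClass A × K0 (projDimLEOne A) => cls (r p.1) * torusMonomial p.2) ∘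
      (Subtype.val : t → _) = _ from funext fun p => ?_]
  · exact key
  change cls (r p.1.1) * torusMonomial p.1.2 * cls R = c p • gprojToModified A (HallAlg.basis _)
  rw [hc p, ← gprojToModified_cl (hmem p), HallAlg.cl_eq (hmem p)]
  rfl

/-- Every class `[M]` is a monomial multiple of the class of the module chosen to represent `M` in
the singularity category. -/
theorem exists_cls_eq_mul_monomial {M N : FGModuleCat.{u} A} (h : sgClass M = sgClass N) :
    ∃ (x : ModifiedHall A) (α : K0 (projDimLEOne A)), IsMonomial x α ∧ cls M = cls N * x := by
  obtain ⟨P, G, _, s, _, hP, hG, _, _⟩ := exists_gorenstein_resolution M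
  obtain ⟨P', G', _, s', _, hP', hG', _, _⟩ := exists_gorenstein_resolution N
  obtain ⟨Q, Q', hQ, hQ', ⟨e⟩⟩ := stablyIso_of_sgClass_eq hG hG'
    (by rw [sgClass_eq_of_ses s, sgClass_eq_of_ses s', h])
  have h1 : Proportional (cls M * (cls P * cls Q)) (cls N * (cls P' * cls Q')) := by
    have h2 := ((proportional_ses s).mul_right (cls Q)).trans (proportional_biprod G Q).symm
    have h3 := ((proportional_ses s').mul_right (cls Q')).trans (proportional_biprod G' Q').symm
    rw [ModifiedHall.cls_congr e] at h2
    rw [mul_assoc] at h2 h3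
    exact h2.trans h3.symm
  have hm (P : FGModuleCat.{u} A) [Projective P] : IsMonomial (cls P) (projCls P) :=
    IsMonomial.of_cls (projDimLEOne_of_projective P)
  obtain ⟨c, hc, h1⟩ := h1
  have hPQ := (hm P).mul (hm Q)
  refine ⟨_, _, .of_proportional (.smul hc _) (((hm P').mul (hm Q')).mul hPQ.inverse), ?_⟩
  rw [mul_smul_comm, ← mul_assoc, ← smul_mul_assoc, ← h1, mul_assoc,
    Ring.mul_inverse_cancel _ hPQ.isUnit, mul_one]

theorem cls_mul_monomial_mem_span {r : SgClass A → FGModuleCat.{u} A}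
    (hr : ∀ x, sgClass (r x) = x) (M : FGModuleCat.{u} A) {x : ModifiedHall A}
    {α : K0 (projDimLEOne A)} (hx : IsMonomial x α) : cls M * x ∈ Submodule.span ℚ
      (Set.range fun p : SgClass A × K0 (projDimLEOne A) => cls (r p.1) * torusMonomial p.2) := by
  obtain ⟨y, β, hy, h⟩ := exists_cls_eq_mul_monomial (hr (sgClass M)).symm
  obtain ⟨c, -, hc⟩ := (hy.mul hx).proportional (isMonomial_torusMonomial (β + α))
  rw [h, mul_assoc, hc, mul_smul_comm]
  exact Submodule.smul_mem _ _ (Submodule.subset_span ⟨(_, _), rfl⟩)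

end

/-! ### The right Ore localization -/

/-- A subspace of `R[S⁻¹]` that contains `1` and is stable under left multiplication by the elements
of `R` and the inverses of those of `S` is everything. -/
theorem Loc.submodule_eq_top {R : Type*} [Ring R] [Algebra ℚ R] {S : Set R}
    (F : Submodule ℚ (Loc S)) (h1 : 1 ∈ F) (hR : ∀ a, ∀ x ∈ F, toLoc S a * x ∈ F)
    (hS : ∀ s ∈ S, ∀ x ∈ F, Ring.inverse (toLoc S s) * x ∈ F) : F = ⊤ := by
  have key (w : FreeAlgebra ℚ (R ⊕ S)) : ∀ x ∈ F, RingQuot.mkAlgHom ℚ (LocRel S) w * x ∈ F := by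
    induction w using FreeAlgebra.induction with
    | grade0 c =>
      intro x hx
      rw [AlgHom.commutes, ← Algebra.smul_def]
      exact F.smul_mem _ hx
    | grade1 g =>
      obtain a | s := g
      · exact hR a
      · have h2 : RingQuot.mkAlgHom ℚ (LocRel S) (FreeAlgebra.ι ℚ (Sum.inr s)) =
            Ring.inverse (toLoc S s) := by
          have h3 := RingQuot.mkAlgHom_rel ℚ (LocRel.inv_mul (S := S) s)
          rw [map_mul, map_one] at h3
          change _ * toLoc S (s : R) = 1 at h3
          rw [← mul_one (RingQuot.mkAlgHom ℚ (LocRel S) _),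
            ← Ring.mul_inverse_cancel _ (isUnit_toLoc S s.2), ← mul_assoc, h3, one_mul]
        rw [h2]
        exact hS s s.2
    | mul v w hv hw =>
      intro x hx
      rw [map_mul, mul_assoc]
      exact hv _ (hw _ hx)
    | add v w hv hw =>
      intro x hx
      rw [map_add, add_mul]
      exact add_mem (hv _ hx) (hw _ hx)
  rw [eq_top_iff]
  intro x _
  obtain ⟨w, rfl⟩ := RingQuot.mkAlgHom_surjective ℚ (LocRel S) x
  simpa using key w 1 h1

section
variable [Gorenstein A]

theorem HallQuot.mem_of_cls {F : Submodule ℚ (HallQuot A)} (h : ∀ M, HallQuot.cls M ∈ F)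
    (x : HallQuot A) : x ∈ F := by
  have : F.mkQ = 0 := HallQuot.linearMap_ext fun M => by simpa using h M
  simpa using LinearMap.congr_fun this x

theorem HallQuot.proportional_ses {M K L : FGModuleCat.{u} A} (s : SES M K L)
    (hK : projDimLEOne A K) : Proportional (HallQuot.cls L) (HallQuot.cls M * HallQuot.cls K) := by
  rw [HallQuot.cls_mid s hK]
  exact .smul (ef_ne _ _) _

theorem ModifiedHall.toLoc_cls (M : FGModuleCat.{u} A) :
    toLoc (invertedSet A) (HallQuot.cls M) = ModifiedHall.cls M := rfl

/-- Monomials normalize the image of the quotient by the ideal. -/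
theorem IsMonomial.exists_mul_eq {y : ModifiedHall A} {α : K0 (projDimLEOne A)}
    (hy : IsMonomial y α) (a : HallQuot A) :
    ∃ b, y * toLoc (invertedSet A) a = toLoc (invertedSet A) b * y := by
  let F : Submodule ℚ (HallQuot A) :=
    { carrier := {a | ∃ b, y * toLoc (invertedSet A) a = toLoc (invertedSet A) b * y}
      zero_mem' := ⟨0, by simp⟩
      smul_mem' := by
        rintro c x ⟨b, h⟩
        exact ⟨c • b, by rw [map_smul, map_smul, mul_smul_comm, h, smul_mul_assoc]⟩
      add_mem' := by
        rintro x x' ⟨b, h⟩ ⟨b', h'⟩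
        exact ⟨b + b', by rw [map_add, map_add, mul_add, h, h', add_mul]⟩ }
  refine HallQuot.mem_of_cls (F := F) (fun M => ?_) a
  obtain ⟨c, -, h⟩ := hy.comm M
  exact ⟨c • HallQuot.cls M, by rw [ModifiedHall.toLoc_cls, h, map_smul, smul_mul_assoc]; rfl⟩

theorem exists_mul_cls_biprod {x : ModifiedHall A} {a : HallQuot A} {K K' : FGModuleCat.{u} A}
    (hK' : projDimLEOne A K') (h : x * ModifiedHall.cls K = toLoc (invertedSet A) a) :
    ∃ b, x * ModifiedHall.cls (K' ⊞ K) = toLoc (invertedSet A) b := by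
  refine ⟨ef K K' • (a * HallQuot.cls K'), ?_⟩
  rw [ModifiedHall.cls_biprod hK', mul_smul_comm, ← mul_assoc, h, map_smul, map_mul]
  rfl

/-- Every element of the modified Ringel–Hall algebra has a right denominator `[K]`. -/
theorem exists_mul_cls_eq_toLoc (x : ModifiedHall A) :
    ∃ (a : HallQuot A) (K : FGModuleCat.{u} A), projDimLEOne A K ∧
      x * ModifiedHall.cls K = toLoc (invertedSet A) a := by
  let F : Submodule ℚ (ModifiedHall A) :=
    { carrier := {x | ∃ (a : HallQuot A) (K : FGModuleCat.{u} A), projDimLEOne A K ∧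
        x * ModifiedHall.cls K = toLoc (invertedSet A) a}
      zero_mem' := by
        obtain ⟨Z, hZ⟩ := HasZeroObject.zero (C := FGModuleCat.{u} A)
        have := hZ.projective
        exact ⟨0, Z, projDimLEOne_of_projective Z, by rw [zero_mul, map_zero]⟩
      smul_mem' := by
        rintro c x ⟨a, K, hK, h⟩
        exact ⟨c • a, K, hK, by rw [smul_mul_assoc, h, map_smul]⟩
      add_mem' := by
        rintro x y ⟨a, K, hK, h⟩ ⟨b, K', hK', h'⟩
        obtain ⟨a', ha⟩ := exists_mul_cls_biprod hK' h
        obtain ⟨b', hb⟩ := exists_mul_cls_biprod hK h'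
        rw [ModifiedHall.cls_congr (biprod.braiding K K')] at hb
        exact ⟨a' + b', _, projDimLEOne_biprod hK' hK, by rw [add_mul, ha, hb, map_add]⟩ }
  have hF : F = ⊤ := by
    refine Loc.submodule_eq_top F ?_ ?_ ?_
    · obtain ⟨Z, hZ⟩ := HasZeroObject.zero (C := FGModuleCat.{u} A)
      have := hZ.projective
      exact ⟨HallQuot.cls Z, Z, projDimLEOne_of_projective Z, one_mul _⟩
    · rintro a x ⟨b, K, hK, h⟩
      exact ⟨a * b, K, hK, by rw [mul_assoc, h, map_mul]⟩
    · rintro _ ⟨c, K₀, hc, hK₀, rfl⟩ x ⟨a, K, hK, h⟩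
      have hm : IsMonomial (toLoc (invertedSet A) (c • HallQuot.cls K₀)) (K0.cls K₀ hK₀) := by
        rw [map_smul]
        exact .of_proportional (.smul hc _) (.of_cls hK₀)
      obtain ⟨b, hb⟩ := hm.inverse.exists_mul_eq a
      have h1 := Ring.inverse_mul_cancel _ hm.isUnit
      set y := Ring.inverse (toLoc (invertedSet A) (c • HallQuot.cls K₀))
      refine ⟨(ef K K₀ * c⁻¹) • b, K₀ ⊞ K, projDimLEOne_biprod hK₀ hK, ?_⟩
      rw [map_smul, mul_smul_comm, ModifiedHall.toLoc_cls] at h1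
      have h2 : y * ModifiedHall.cls K₀ = c⁻¹ • 1 := by
        rw [← h1, smul_smul, inv_mul_cancel₀ hc, one_smul]
      rw [ModifiedHall.cls_biprod hK₀, mul_smul_comm, ← mul_assoc, mul_assoc y, h, hb, mul_assoc,
        h2, mul_smul_comm, mul_one, smul_smul, map_smul]
  have : x ∈ F := hF ▸ Submodule.mem_top
  exact this

/-- The linear map from the Hall algebra of the Gorenstein projective modules to the quotient of the
Hall algebra of all modules. -/
noncomputable def gprojToQuot (A : Type u) [Ring A] [Finite A] :
    HallAlg (gproj A) →ₗ[ℚ] HallQuot A :=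
  HallAlg.basis.constr ℚ fun x => HallQuot.cls x.rep

theorem gprojToQuot_cl {G : FGModuleCat.{u} A} (hG : gproj A G) :
    gprojToQuot A (HallAlg.cl (gproj A) G) = HallQuot.cls G := by
  rw [HallAlg.cl_eq hG, HallAlg.cls, gprojToQuot, Module.Basis.constr_basis]
  exact HallQuot.cls_congr (IsoCl.rep_mk G hG).some

theorem toLoc_gprojToQuot (h : HallAlg (gproj A)) :
    toLoc (invertedSet A) (gprojToQuot A h) = gprojToModified A h := by
  have : (toLoc (invertedSet A)).toLinearMap ∘ₗ gprojToQuot A = (gprojToModified A).toLinearMap :=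
    HallAlg.hom_ext fun G hG => by
      rw [LinearMap.comp_apply, gprojToQuot_cl hG]
      exact (gprojToModified_cl hG).symm
  exact LinearMap.congr_fun this h

theorem exists_gprojToQuot_mul (h : HallAlg (gproj A)) (R : FGModuleCat.{u} A) [Projective R] :
    ∃ h', gprojToQuot A h * HallQuot.cls R = gprojToQuot A h' := by
  refine ⟨h * HallAlg.cl (gproj A) R, ?_⟩
  have : LinearMap.mulRight ℚ (HallQuot.cls R) ∘ₗ gprojToQuot A =
      gprojToQuot A ∘ₗ LinearMap.mulRight ℚ (HallAlg.cl (gproj A) R) :=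
    HallAlg.hom_ext fun G hG => by
      have hmem : gproj A (R ⊞ G) := gproj_iff.2
        (ExtProj.mid (SES.split R G) (.of_projective R) (gproj_iff.1 hG))
      rw [LinearMap.comp_apply, LinearMap.comp_apply, LinearMap.mulRight_apply,
        LinearMap.mulRight_apply, HallAlg.cl_mul_projective (gproj_iff.1 hG), map_smul,
        gprojToQuot_cl hG, gprojToQuot_cl hmem,
        HallQuot.cls_mid (SES.split R G) (projDimLEOne_of_projective R), smul_smul,
        inv_mul_cancel₀ (ef_ne _ _), one_smul]
  exact LinearMap.congr_fun this h

/-- A suitable multiple of every element of the quotient comes from the Hall algebra of the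
Gorenstein projective modules. -/
theorem exists_mul_cls_eq_gprojToQuot (a : HallQuot A) :
    ∃ (P : FGModuleCat.{u} A) (_ : Projective P) (h : HallAlg (gproj A)),
      a * HallQuot.cls P = gprojToQuot A h := by
  have aux {x : HallQuot A} {P R : FGModuleCat.{u} A} [Projective P] [Projective R]
      {h : HallAlg (gproj A)} (hx : x * HallQuot.cls P = gprojToQuot A h) :
      ∃ h', x * HallQuot.cls (R ⊞ P) = gprojToQuot A h' := by
    obtain ⟨h', hh⟩ := exists_gprojToQuot_mul h R
    refine ⟨ef P R • h', ?_⟩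
    rw [HallQuot.cls_mid (SES.split R P) (projDimLEOne_of_projective R), mul_smul_comm,
      ← mul_assoc, hx, hh, map_smul]
  let F : Submodule ℚ (HallQuot A) :=
    { carrier := {a | ∃ (P : FGModuleCat.{u} A) (_ : Projective P) (h : HallAlg (gproj A)),
        a * HallQuot.cls P = gprojToQuot A h}
      zero_mem' := by
        obtain ⟨Z, hZ⟩ := HasZeroObject.zero (C := FGModuleCat.{u} A)
        exact ⟨Z, hZ.projective, 0, by rw [zero_mul, map_zero]⟩
      smul_mem' := by
        rintro c x ⟨P, hP, h, hx⟩
        exact ⟨P, hP, c • h, by rw [smul_mul_assoc, hx, map_smul]⟩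
      add_mem' := by
        rintro x y ⟨P, hP, h, hx⟩ ⟨P', hP', h', hy⟩
        obtain ⟨h₁, hh⟩ := aux (R := P') hx
        obtain ⟨h₂, hh'⟩ := aux (R := P) hy
        rw [HallQuot.cls_congr (biprod.braiding P P')] at hh'
        exact ⟨_, inferInstance, h₁ + h₂, by rw [add_mul, hh, hh', map_add]⟩ }
  refine HallQuot.mem_of_cls (F := F) (fun M => ?_) a
  obtain ⟨P, G, _, s, _, hP, hG, _, _⟩ := exists_gorenstein_resolution M
  refine ⟨P, hP, (ef M P)⁻¹ • HallAlg.cl (gproj A) G, ?_⟩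
  rw [map_smul, gprojToQuot_cl (gproj_iff.2 hG),
    HallQuot.cls_mid s (projDimLEOne_of_projective P), smul_smul, inv_mul_cancel₀ (ef_ne _ _),
    one_smul]

theorem HallQuot.cls_mem_invertedSet {K : FGModuleCat.{u} A} (hK : projDimLEOne A K) :
    HallQuot.cls K ∈ invertedSet A := ⟨1, K, one_ne_zero, hK, (one_smul _ _).symm⟩

/-- The modified Ringel–Hall algebra is a right localization. Elements of the quotient algebra that
become equal are already equal after multiplication with the class of a projective module, since a
multiple of their difference comes from the Hall algebra of the Gorenstein projective modules,
which embeds. -/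
theorem isRightLocalization_modifiedHall (A : Type u) [Ring A] [Finite A] [Gorenstein A] :
    IsRightLocalization (invertedSet A)
      (toLoc (invertedSet A) : HallQuot A →+* ModifiedHall A) where
  one_mem := by
    obtain ⟨Z, hZ⟩ := HasZeroObject.zero (C := FGModuleCat.{u} A)
    have := hZ.projective
    rw [← HallQuot.cls_zero hZ]
    exact HallQuot.cls_mem_invertedSet (projDimLEOne_of_projective Z)
  mul_mem := by
    rintro _ ⟨c, K, hc, hK, rfl⟩ _ ⟨d, K', hd, hK', rfl⟩
    obtain ⟨e, he, h⟩ := (HallQuot.proportional_ses (SES.split K' K) hK').symm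
    exact ⟨c * d * e, K' ⊞ K, mul_ne_zero (mul_ne_zero hc hd) he, projDimLEOne_biprod hK' hK,
      by rw [smul_mul_smul_comm, h, smul_smul]⟩
  isUnit s hs := isUnit_toLoc _ hs
  exists_frac x := by
    obtain ⟨a, K, hK, h⟩ := exists_mul_cls_eq_toLoc x
    refine ⟨a, HallQuot.cls K, HallQuot.cls_mem_invertedSet hK, ?_⟩
    change x = toLoc (invertedSet A) a * Ring.inverse (ModifiedHall.cls K)
    rw [← h, mul_assoc, Ring.mul_inverse_cancel _ (ModifiedHall.isUnit_cls hK), mul_one]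
  eq_iff a b := by
    constructor
    · intro h
      obtain ⟨P, hP, x, hx⟩ := exists_mul_cls_eq_gprojToQuot (a - b)
      refine ⟨HallQuot.cls P, HallQuot.cls_mem_invertedSet (projDimLEOne_of_projective P), ?_⟩
      have h : toLoc (invertedSet A) a = toLoc (invertedSet A) b := h
      have h0 : gprojToModified A x = 0 := by
        rw [← toLoc_gprojToQuot, ← hx, map_mul, map_sub, sub_eq_zero.2 h, zero_mul]
      rw [gprojToModified_injective (h0.trans (map_zero _).symm), map_zero, sub_mul,
        sub_eq_zero] at hx
      exact hx
    · rintro ⟨t, ht, h⟩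
      have h' := congrArg (toLoc (invertedSet A)) h
      rw [map_mul, map_mul] at h'
      exact (isUnit_toLoc _ ht).mul_left_injective h'

theorem span_cls_mul_torusMonomial (r : SgClass A → FGModuleCat.{u} A)
    (hr : ∀ x, sgClass (r x) = x) : Submodule.span ℚ (Set.range
      fun p : SgClass A × K0 (projDimLEOne A) =>
        ModifiedHall.cls (r p.1) * torusMonomial p.2) = ⊤ := by
  rw [eq_top_iff]
  intro x _
  obtain ⟨a, K, hK, h⟩ := exists_mul_cls_eq_toLoc x
  have hx : x = toLoc (invertedSet A) a * Ring.inverse (ModifiedHall.cls K) := by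
    rw [← h, mul_assoc, Ring.mul_inverse_cancel _ (ModifiedHall.isUnit_cls hK), mul_one]
  rw [hx]
  refine HallQuot.mem_of_cls (F := (Submodule.span ℚ _).comap
    (LinearMap.mulRight ℚ (Ring.inverse (ModifiedHall.cls K)) ∘ₗ
      (toLoc (invertedSet A)).toLinearMap)) (fun M => ?_) a
  exact cls_mul_monomial_mem_span hr M (IsMonomial.of_cls hK).inverse

/-! ### Freeness over the quantum torus -/

/-- The basis of the modified Ringel–Hall algebra given by a choice of representatives. -/
noncomputable def modifiedBasis (r : SgClass A → FGModuleCat.{u} A)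
    (hr : ∀ x, sgClass (r x) = x) :
    Module.Basis (SgClass A × K0 (projDimLEOne A)) ℚ (ModifiedHall A) :=
  Module.Basis.mk (linearIndependent_cls_mul_torusMonomial r hr)
    (span_cls_mul_torusMonomial r hr).ge

theorem linearIndependent_torusMonomial :
    LinearIndependent ℚ (torusMonomial : K0 (projDimLEOne A) → ModifiedHall A) := by
  choose r hr using exists_sgClass_eq (A := A)
  obtain ⟨Z, hZ⟩ := HasZeroObject.zero (C := FGModuleCat.{u} A)
  have h := (linearIndependent_cls_mul_torusMonomial r hr).comp
    (fun α => (sgClass Z, α)) (fun _ _ h => (Prod.mk.inj h).2)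
  exact LinearIndependent.of_comp (LinearMap.mulLeft ℚ (ModifiedHall.cls (r (sgClass Z)))) h

/-- The elements `[K_α]` form a basis of the quantum torus. -/
noncomputable def torusBasis (A : Type u) [Ring A] [Finite A] [Gorenstein A] :
    Module.Basis (K0 (projDimLEOne A)) ℚ (quantumTorus A) :=
  Module.Basis.mk (v := fun α => (⟨torusMonomial α, torusMonomial_mem α⟩ : quantumTorus A))
    (LinearIndependent.of_comp (quantumTorus A).val.toLinearMap linearIndependent_torusMonomial) <| by
    rintro ⟨x, hx⟩ -
    have h := mem_span_of_mem_quantumTorus hx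
    rw [show (torusMonomial : K0 (projDimLEOne A) → ModifiedHall A) =
      (quantumTorus A).val.toLinearMap ∘ fun α => ⟨torusMonomial α, torusMonomial_mem α⟩ from rfl,
      Set.range_comp, Submodule.span_image] at h
    obtain ⟨y, hy, hxy⟩ := h
    rwa [show (⟨x, hx⟩ : quantumTorus A) = y from Subtype.ext hxy.symm]

theorem bijective_of_basis {ι κ V W : Type*} [AddCommMonoid V] [Module ℚ V]
    [AddCommMonoid W] [Module ℚ W] (b : Module.Basis ι ℚ V) (b' : Module.Basis κ ℚ W)
    (f : V →ₗ[ℚ] W) (σ : ι ≃ κ)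
    (c : ι → ℚ) (hc : ∀ i, c i ≠ 0) (hf : ∀ i, f (b i) = c i • b' (σ i)) :
    Function.Bijective f := by
  refine ⟨injective_of_basis b b'.linearIndependent f c hc σ.injective hf, ?_⟩
  rw [← LinearMap.range_eq_top, eq_top_iff, ← b'.span_eq, Submodule.span_le]
  rintro _ ⟨j, rfl⟩
  obtain ⟨i, rfl⟩ := σ.surjective j
  exact ⟨(c i)⁻¹ • b i, by rw [map_smul, hf, smul_smul, inv_mul_cancel₀ (hc i), one_smul]⟩

theorem bijective_sum_cls_mul (r : SgClass A → FGModuleCat.{u} A)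
    (hr : ∀ x, sgClass (r x) = x) : Function.Bijective (fun c : SgClass A →₀ quantumTorus A =>
    c.sum fun x t => ModifiedHall.cls (r x) * (t : ModifiedHall A)) := by
  refine bijective_of_basis (Finsupp.basis fun _ => torusBasis A) (modifiedBasis r hr)
    (Finsupp.lsum ℚ fun x => LinearMap.mulLeft ℚ (ModifiedHall.cls (r x)) ∘ₗ
      (quantumTorus A).val.toLinearMap) (Equiv.sigmaEquivProd _ _) (fun _ => 1)
    (fun _ => one_ne_zero) ?_
  rintro ⟨x, α⟩
  simp [torusBasis, modifiedBasis]

theorem bijective_sum_mul_cls (r : SgClass A → FGModuleCat.{u} A)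
    (hr : ∀ x, sgClass (r x) = x) : Function.Bijective (fun c : SgClass A →₀ quantumTorus A =>
    c.sum fun x t => (t : ModifiedHall A) * ModifiedHall.cls (r x)) := by
  choose c hc h using fun p : Σ _ : SgClass A, K0 (projDimLEOne A) =>
    (isMonomial_torusMonomial p.2).comm (r p.1)
  refine bijective_of_basis (Finsupp.basis fun _ => torusBasis A) (modifiedBasis r hr)
    (Finsupp.lsum ℚ fun x => LinearMap.mulRight ℚ (ModifiedHall.cls (r x)) ∘ₗ
      (quantumTorus A).val.toLinearMap) (Equiv.sigmaEquivProd _ _) c hc ?_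
  rintro ⟨x, α⟩
  simpa [torusBasis, modifiedBasis] using h ⟨x, α⟩

end

theorem ef_eq_pow (k : Type*) [Field k] [Finite k] [Algebra k A] (M N : FGModuleCat.{u} A) :
    ef M N = (Nat.card k : ℚ) ^ eulerForm k M N := by
  have h0 : (Nat.card k : ℚ) ≠ 0 := by exact_mod_cast (Nat.card_pos (α := k)).ne'
  have h1 : Module.Finite k (M ⟶ N) := .of_finite
  have h2 : Module.Finite k (Ext M N 1) := .of_finite
  rw [ef, eulerForm, zpow_sub₀ h0, Module.natCard_eq_pow_finrank (K := k),
    Module.natCard_eq_pow_finrank (K := k) (V := Ext M N 1)]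
  simp only [Nat.cast_pow, zpow_natCast]

end RingelHall

theorem theoremC {k : Type*} [Field k] [Finite k] {A : Type u} [Ring A] [Finite A] [Algebra k A]
    [Module.Finite k A] (hA : IsOneGorenstein A) :
    -- the modified Ringel-Hall algebra is a right Ore localization
    IsRightLocalization (invertedSet A) (toLoc (invertedSet A) : HallQuot A →+* ModifiedHall A) ∧
    -- the isomorphism with the semi-derived Hall algebra of the Gorenstein projective modules
    (∃ (_ : (gproj A).ContainsZero) (_ : (gproj A).IsClosedUnderExtensions),
      Nonempty (ModifiedHall A ≃ₐ[ℚ] SemiDerivedHall (gproj A))) ∧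
    -- every object of the singularity category is represented by a module
    (∀ x : SgClass A, ∃ M : FGModuleCat.{u} A, sgClass M = x) ∧
    -- abstract identification of the two Grothendieck groups
    Nonempty (K0 (⊤ : ObjectProperty (FGModuleCat.{u} A)) ≃+ K0 (projDimLEOne A)) ∧
    -- the elements `[K_α]`, and the bases
    ∃ κ : K0 (projDimLEOne A) → ModifiedHall A,
      (∀ (U V : FGModuleCat.{u} A) (hU : projDimLEOne A U) (hV : projDimLEOne A V),
        κ (K0.cls U hU - K0.cls V hV) =
          (Nat.card k : ℚ) ^ (-(eulerForm k U V - eulerForm k V V)) •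
            (ModifiedHall.cls U * Ring.inverse (ModifiedHall.cls V))) ∧
      ∀ r : SgClass A → FGModuleCat.{u} A, (∀ x, sgClass (r x) = x) →
        -- free as a right module over the quantum torus
        Function.Bijective (fun c : SgClass A →₀ quantumTorus A =>
          c.sum fun x t => ModifiedHall.cls (r x) * (t : ModifiedHall A)) ∧
        -- free as a left module over the quantum torus
        Function.Bijective (fun c : SgClass A →₀ quantumTorus A =>
          c.sum fun x t => (t : ModifiedHall A) * ModifiedHall.cls (r x)) ∧
        -- the rational basis
        LinearIndependent ℚ (fun p : SgClass A × K0 (projDimLEOne A) =>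
          ModifiedHall.cls (r p.1) * κ p.2) ∧
        Submodule.span ℚ (Set.range fun p : SgClass A × K0 (projDimLEOne A) =>
          ModifiedHall.cls (r p.1) * κ p.2) = ⊤ := by
  have := gorenstein_of_isOneGorenstein k hA
  refine ⟨isRightLocalization_modifiedHall A, ⟨inferInstance, inferInstance,
    ⟨modifiedEquivSemiDerived A⟩⟩, exists_sgClass_eq, nonempty_K0_equiv A, torusMonomial,
    fun U V hU hV => ?_, fun r hr => ⟨bijective_sum_cls_mul r hr, bijective_sum_mul_cls r hr,
      linearIndependent_cls_mul_torusMonomial r hr, span_cls_mul_torusMonomial r hr⟩⟩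
  have h0 : (Nat.card k : ℚ) ≠ 0 := by exact_mod_cast (Nat.card_pos (α := k)).ne'
  rw [torusMonomial_sub hU hV, torusElement, ef_eq_pow k, ef_eq_pow k, neg_sub, sub_eq_neg_add,
    zpow_add₀ h0, zpow_neg]
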